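/- **Setting.** Let $Z$ be a connected orbifold of dimension $m\ge 0$: $Z$ is a connected, Hausdorff, second countable topological space with an orbifold atlas $\widetilde{\mathcal U}$. Its charts are triples $(\widetilde U,G,\pi)$, where $\widetilde U\subset\mathbb R^m$ is a connected open set, $G$ is a finite group acting smoothly and effectively on $\widetilde U$, and $\pi:\widetilde U\to Z$ is a continuous $G$-invariant map inducing a homeomorphism of $G\backslash\widetilde U$ onto an open set $U\subset Z$. The sets $U$ cover $Z$, and any two charts are compatible: every $z\in U_1\cap U_2$ lies in the image of a chart $(\widetilde U_0,G_0,\pi_0)$ which has smooth embeddings over $Z$ into both. A chart of $Z$ is a triple of this kind that is compatible with all charts of the atlas. Assume that the atlas is countable and that every $\widetilde U$ in it is simply connected. Let $\mathcal G$ be the groupoid with objects $\mathcal G_0=\coprod\widetilde U$ (over the charts of the atlas) and arrows $\mathcal G_1$ the germs of the coordinate transformations $\psi\circ\varphi^{-1}$, where $\varphi,\psi$ are embeddings over $Z$ of a chart of $Z$ into two charts of the atlas; $\mathcal G_1$ has the étale topology of germs. A $\mathcal G$-path from $x$ to $y$ is a sequence $c=(g_0,b_1,g_1,\dots,b_k,g_k)$,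 $k\ge1$, of arrows $g_i$ and paths $b_i:[0,1]\to\mathcal G_0$ such that $g_0$ goes from $x$ to $b_1(0)$, $g_i$ from $b_i(1)$ to $b_{i+1}(0)$ for $0<i<k$, and $g_k$ from $b_k(1)$ to $y$. Two $\mathcal G$-paths with the same ends are homotopic if they are related by a finite sequence of the following operations and their inverses: subdividing some $b_i$ and inserting an identity arrow; replacing $b_i,g_{i-1},g_i$ by $h\circ b_i$, $h_{b_i(0)}\,g_{i-1}$, $g_i\,h_{b_i(1)}^{-1}$, where $h$ is a coordinate transformation whose domain contains $b_i$ (here $h_v$ is the germ of $h$ at $v$, and arrows are composed from right to left); and continuous deformations of all the $b_i$ and $g_i$ with fixed ends and fixed $k$. Let $[c]$ be the homotopy class of $c$, and write $[c][c']$ for the class of the concatenation, first $c$ and then $c'$. Fix $x_0\in\mathcal G_0$. The orbifold fundamental group $\Gamma=\pi_1^{\mathrm{orb}}(Z,x_0)$ is the group of homotopy classes of $\mathcal G$-loops at $x_0$. Let $\widehat{\mathcal G}_0$ be the set of homotopy classes of $\mathcal G$-paths starting at $x_0$. For $[c]\in\widehat{\mathcal G}_0$ ending at $u\in\widetilde U$,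 let $$s_c:\widetilde U\to\widehat{\mathcal G}_0,\qquad s_c(v)=[c][b_{uv}],$$ where $b_{uv}$ is any path in $\widetilde U$ from $u$ to $v$. Give $\widehat{\mathcal G}_0$ the finest topology for which all the maps $s_c$ are continuous; it is the disjoint union of the sheets $s_c(\widetilde U)\cong\widetilde U$. Let $X$ be the quotient space of $\widehat{\mathcal G}_0$ by the equivalence relation generated by $[c]\sim[c][g]$, where $g\in\mathcal G_1$ is an arrow starting at the end point of $c$ and $[g]$ is the class of the $\mathcal G$-path formed by a constant path followed by $g$. The group $\Gamma$ acts on $X$ by composition at $x_0$. Let $p:X\to Z$ send the class of $[c]$ to the image in $Z$ of the end point of $c$; it is $\Gamma$-invariant. An *orbifold covering* is a continuous map $q:Y\to W$ of orbifolds such that every $w\in W$ lies in the image $V$ of a chart $(\widetilde V,G,\pi)$ of $W$ with the following property: every connected component of $q^{-1}(V)$ is the image of a chart $(\widetilde V,G',\pi')$ of $Y$ with $G'\subset G$ and $q\circ\pi'=\pi$. **Theorem.** The space $X$ is Hausdorff and second countable, and it has a canonical orbifold structure, in which each of the maps $\widetilde U\to\widehat{\mathcal G}_0\to X$ given by $s_c$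 is the projection of an orbifold chart with domain $\widetilde U$. For this structure: 1. $\Gamma$ acts on $X$ smoothly (each $\gamma\in\Gamma$ acts by a smooth map of orbifolds), effectively and properly discontinuously. 2. $\Gamma\backslash X$ is Hausdorff and second countable, it has an orbifold structure induced by that of $X$ (around every point of $X$ there is a chart $(\widetilde V,H,\pi)$ of $X$ such that, for some finite group $G$, $(\widetilde V,G,q\circ\pi)$ is a chart of $\Gamma\backslash X$, where $q:X\to\Gamma\backslash X$ is the quotient map), and $p$ induces an isomorphism of orbifolds $\Gamma\backslash X\to Z$. 3. $X$ is the universal covering orbifold of $Z$: $X$ is connected, $p:X\to Z$ is an orbifold covering, and for every orbifold covering $p':Y\to Z$ with $Y$ a connected ($m$-dimensional, Hausdorff, second countable) orbifold there is an orbifold covering $p'':X\to Y$ with $p'\circ p''=p$. -/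

import Mathlib

universe u v

open Set Filter Topology TopologicalSpace Function
open scoped Manifold ContDiff unitInterval

namespace Orbi

/-! ### Orbifold charts and atlases -/

/-- The model space `ℝ^m`. -/
abbrev Euc (m : ℕ) : Type := EuclideanSpace ℝ (Fin m)

/-- Smooth (`C^∞`) maps between open subsets of Euclidean spaces. -/
def SmoothMap {m n : ℕ} {U : Opens (Euc m)} {V : Opens (Euc n)} (f : U → V) : Prop :=
  ContMDiff 𝓘(ℝ, Euc m) 𝓘(ℝ, Euc n) ∞ f

/-- Smooth embeddings between open subsets of `ℝ^m`.  As source and target have the same dimension,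
a smooth embedding is the same thing as an injective local diffeomorphism. -/
structure IsSmoothEmb {m : ℕ} {U V : Opens (Euc m)} (f : U → V) : Prop where
  injective : Injective f
  localDiffeo : IsLocalDiffeomorph 𝓘(ℝ, Euc m) 𝓘(ℝ, Euc m) ∞ f

/-- An `m`-dimensional orbifold chart `(Ũ, G, π)` of a space `Z`.  The open set `U ⊆ Z` of which it
is a chart is `range proj`; it is open and connected because `proj` is open and continuous.
The finite group `G` acts effectively on `Ũ`, so it is given as a group of
transformations of `Ũ`.  A continuous map `π : Ũ → Z` which is open and whose fibres are exactly
the `G`-orbits is the same thing as a `G`-invariant continuous map with open image `U` inducing a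
homeomorphism `G \ Ũ ≃ U`. -/
structure OrbifoldChart (m : ℕ) (Z : Type u) [TopologicalSpace Z] where
  /-- the domain `Ũ` -/
  dom : Opens (Euc m)
  dom_connected : IsConnected (dom : Set (Euc m))
  /-- the group `G` -/
  G : Subgroup (Equiv.Perm dom)
  G_finite : Finite G
  G_smooth : ∀ g ∈ G, SmoothMap g
  /-- the projection `π` -/
  proj : dom → Z
  proj_cont : Continuous proj
  proj_open : IsOpenMap proj
  proj_eq_iff : ∀ x y, proj x = proj y ↔ ∃ g ∈ G, g x = y

section Charts

variable {m : ℕ} {Z : Type u} [TopologicalSpace Z]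

/-- Embeddings of orbifold charts: smooth embeddings over `Z`. -/
structure ChartEmb (C D : OrbifoldChart m Z) where
  toFun : C.dom → D.dom
  isEmb : IsSmoothEmb toFun
  comm : ∀ x, D.proj (toFun x) = C.proj x

/-- Compatibility of two orbifold charts. -/
def Compatible (C D : OrbifoldChart m Z) : Prop :=
  ∀ z ∈ range C.proj ∩ range D.proj, ∃ C₀ : OrbifoldChart m Z, z ∈ range C₀.proj ∧
    Nonempty (ChartEmb C₀ C) ∧ Nonempty (ChartEmb C₀ D)

variable (m Z) in
/-- An orbifold atlas on `Z` with charts of dimension `m`. -/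
structure OrbifoldAtlas where
  charts : Set (OrbifoldChart m Z)
  cover : ∀ z : Z, ∃ C ∈ charts, z ∈ range C.proj
  compat : ∀ C ∈ charts, ∀ D ∈ charts, Compatible C D

/-- `C` is a chart of the orbifold structure defined by the atlas `A`. -/
def OrbifoldAtlas.HasChart (A : OrbifoldAtlas m Z) (C : OrbifoldChart m Z) : Prop :=
  ∀ D ∈ A.charts, Compatible C D

end Charts

/-! ### Smooth maps, isomorphisms, quotients and coverings of orbifolds -/

section Maps

variable {m n : ℕ} {Y : Type u} {Z : Type v} [TopologicalSpace Y] [TopologicalSpace Z]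

/-- Smooth maps between orbifolds: continuous maps having smooth local lifts to charts. -/
def OrbSmooth (A : OrbifoldAtlas m Y) (B : OrbifoldAtlas n Z) (f : Y → Z) : Prop :=
  Continuous f ∧ ∀ y : Y, ∃ C : OrbifoldChart m Y, ∃ D : OrbifoldChart n Z,
    A.HasChart C ∧ B.HasChart D ∧ y ∈ range C.proj ∧ f y ∈ range D.proj ∧
    ∃ F : C.dom → D.dom, SmoothMap F ∧ ∀ x, D.proj (F x) = f (C.proj x)

/-- Isomorphisms of orbifolds: smooth maps with a smooth inverse. -/
def IsOrbIso (A : OrbifoldAtlas m Y) (B : OrbifoldAtlas n Z) (f : Y → Z) : Prop :=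
  OrbSmooth A B f ∧ ∃ f' : Z → Y, OrbSmooth B A f' ∧ LeftInverse f' f ∧ RightInverse f' f

/-- `B` defines the orbifold structure induced by that of `A` along the quotient map `q`: around
every point of the source there is a chart `(Ũ, H, π)` of `A` such that, for a suitable group `G`,
`(Ũ, G, q ∘ π)` is a chart of `B`.  (The orbifold structure of `B` is determined by this when `q` is
surjective.) -/
def IsInducedAtlas (A : OrbifoldAtlas m Y) (B : OrbifoldAtlas m Z) (q : Y → Z) : Prop :=
  ∀ y : Y, ∃ C : OrbifoldChart m Y, ∃ D : OrbifoldChart m Z,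
    A.HasChart C ∧ B.HasChart D ∧ y ∈ range C.proj ∧ D.dom = C.dom ∧
    ∀ v (h : v ∈ D.dom) (h' : v ∈ C.dom), D.proj ⟨v, h⟩ = q (C.proj ⟨v, h'⟩)

/-- Orbifold coverings (Thurston): every point of the base has a neighbourhood `U` with a chart
`(Ũ, G, π)` such that every connected component of the preimage of `U` has a chart
`(Ũ, G', π')` where `G'` is a subgroup of `G` and `p ∘ π' = π`. -/
def IsOrbCovering (A : OrbifoldAtlas m Y) (B : OrbifoldAtlas m Z) (p : Y → Z) : Prop :=
  Continuous p ∧ ∀ z : Z, ∃ D : OrbifoldChart m Z, B.HasChart D ∧ z ∈ range D.proj ∧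
    ∀ y : Y, p y ∈ range D.proj → ∃ C : OrbifoldChart m Y, A.HasChart C ∧
      range C.proj = connectedComponentIn (p ⁻¹' range D.proj) y ∧ C.dom = D.dom ∧
      (∀ v (h : v ∈ C.dom) (h' : v ∈ D.dom), p (C.proj ⟨v, h⟩) = D.proj ⟨v, h'⟩) ∧
      ∀ g ∈ C.G, ∃ g' ∈ D.G, ∀ v (h : v ∈ C.dom) (h' : v ∈ D.dom),
        (g ⟨v, h⟩ : Euc m) = g' ⟨v, h'⟩

end Maps

/-- A universal orbifold covering: a connected orbifold covering `p : X → Z` which covers every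
connected orbifold covering `p' : Y → Z`. -/
def IsUniversalOrbCovering.{w, u₁, u₂} {m : ℕ} {X : Type u₁} {Z : Type u₂} [TopologicalSpace X]
    [TopologicalSpace Z] (B : OrbifoldAtlas m X) (A : OrbifoldAtlas m Z) (p : X → Z) : Prop :=
  ConnectedSpace X ∧ IsOrbCovering B A p ∧
    ∀ (Y : Type w) [TopologicalSpace Y] [T2Space Y] [SecondCountableTopology Y] [ConnectedSpace Y]
      (A' : OrbifoldAtlas m Y) (p' : Y → Z), IsOrbCovering A' A p' →
      ∃ p'' : X → Y, IsOrbCovering B A' p'' ∧ p' ∘ p'' = p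

/-! ### Restriction of charts -/

section Restrict

variable {m : ℕ} {Z : Type u} [TopologicalSpace Z]

theorem IsSmoothEmb.continuous {U V : Opens (Euc m)} {f : U → V} (hf : IsSmoothEmb f) :
    Continuous f := hf.localDiffeo.contMDiff.continuous

theorem IsSmoothEmb.isOpenEmbedding {U V : Opens (Euc m)} {f : U → V} (hf : IsSmoothEmb f) :
    IsOpenEmbedding f :=
  .of_continuous_injective_isOpenMap hf.continuous hf.injective hf.localDiffeo.isOpenMap

theorem IsSmoothEmb.id {U : Opens (Euc m)} : IsSmoothEmb (fun x : U => x) :=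
  ⟨injective_id, (Diffeomorph.refl 𝓘(ℝ, Euc m) U ∞).isLocalDiffeomorph⟩

theorem IsSmoothEmb.comp {U V W : Opens (Euc m)} {g : V → W} {f : U → V} (hg : IsSmoothEmb g)
    (hf : IsSmoothEmb f) : IsSmoothEmb (g ∘ f) :=
  ⟨hg.injective.comp hf.injective,
    fun x => IsLocalDiffeomorphAt.comp _ _ (hf.localDiffeo x) (hg.localDiffeo (f x))⟩

theorem isLocalDiffeomorphAt_congr {U V : Opens (Euc m)} {f g : U → V} {x : U}
    (hf : IsLocalDiffeomorphAt 𝓘(ℝ, Euc m) 𝓘(ℝ, Euc m) ∞ f x) (hfg : ∀ᶠ y in 𝓝 x, f y = g y) :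
    IsLocalDiffeomorphAt 𝓘(ℝ, Euc m) 𝓘(ℝ, Euc m) ∞ g x := by
  obtain ⟨Φ, hx, hΦ⟩ := hf
  obtain ⟨s, hs, hso, hxs⟩ := eventually_nhds_iff.1 hfg
  refine ⟨{ Φ.toOpenPartialHomeomorph.restrOpen s hso with
    contMDiffOn_toFun := Φ.contMDiffOn_toFun.mono inter_subset_left
    contMDiffOn_invFun := Φ.contMDiffOn_invFun.mono inter_subset_left }, ⟨hx, hxs⟩, ?_⟩
  intro y hy
  exact (hs y hy.2).symm.trans (hΦ hy.1)

theorem IsSmoothEmb.of_comp {U V W : Opens (Euc m)} {g : V → W} {f : U → V} (hg : IsSmoothEmb g)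
    (hgf : IsSmoothEmb (g ∘ f)) : IsSmoothEmb f := by
  refine ⟨hgf.injective.of_comp, fun x => ?_⟩
  have hfc : Continuous f := hg.isOpenEmbedding.isEmbedding.continuous_iff.2 hgf.continuous
  have h1 := hg.localDiffeo (f x)
  refine isLocalDiffeomorphAt_congr (IsLocalDiffeomorphAt.comp _ _ (hgf.localDiffeo x)
    h1.localInverse_isLocalDiffeomorphAt) ?_
  exact hfc.continuousAt.eventually h1.localInverse_eventuallyEq_left

theorem IsSmoothEmb.inclusion {U V : Opens (Euc m)} (h : U ≤ V) :
    IsSmoothEmb (Opens.inclusion h) := by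
  classical
  refine ⟨fun x y hxy => Subtype.ext (congrArg (fun z : V => (z : Euc m)) hxy), fun x => ?_⟩
  have hop : IsOpen {v : V | (v : Euc m) ∈ U} := U.isOpen.preimage continuous_subtype_val
  refine ⟨{ toFun := Opens.inclusion h
            invFun := fun v => if hv : (v : Euc m) ∈ U then ⟨v, hv⟩ else x
            source := univ
            target := {v : V | (v : Euc m) ∈ U}
            map_source' := fun y _ => y.2
            map_target' := fun _ _ => mem_univ _
            left_inv' := fun y _ => by
              have : ((Opens.inclusion h y : V) : Euc m) ∈ U := y.2
              rw [dif_pos this]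
            right_inv' := fun v hv => by
              have hv' : (v : Euc m) ∈ U := hv
              rw [dif_pos hv']; rfl
            open_source := isOpen_univ
            open_target := hop
            contMDiffOn_toFun := (contMDiff_inclusion h).contMDiffOn
            contMDiffOn_invFun := ?_ }, mem_univ _, fun _ _ => rfl⟩
  intro v hv
  refine ContMDiffAt.contMDiffWithinAt ?_
  rw [← ContMDiffAt.subtypeVal_comp_iff]
  refine (contMDiff_subtype_val (U := V) v).congr_of_eventuallyEq ?_
  filter_upwards [hop.mem_nhds hv] with w hw
  have hw' : (w : Euc m) ∈ U := hw
  simp [hw']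

/-- Every point of a chart has arbitrarily small invariant chart neighbourhoods. -/
theorem OrbifoldChart.exists_sub (C : OrbifoldChart m Z) (u : C.dom) {W : Set C.dom}
    (hW : IsOpen W) (hu : u ∈ W) :
    ∃ (C₀ : OrbifoldChart m Z) (ι : ChartEmb C₀ C), u ∈ range ι.toFun ∧ range ι.toFun ⊆ W := by
  have := C.G_finite
  have hcont : ∀ g ∈ C.G, Continuous g := fun g hg => (C.G_smooth g hg).continuous
  have hsep : ∀ g : C.G, ∃ N : Set C.dom, IsOpen N ∧ u ∈ N ∧
      (g.1 u ≠ u → ∀ x ∈ N, g.1 x ∉ N) := by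
    intro g
    by_cases hg : g.1 u = u
    · exact ⟨univ, isOpen_univ, mem_univ _, fun h => absurd hg h⟩
    · obtain ⟨P, Q, hP, hQ, h1, h2, hd⟩ := t2_separation hg
      refine ⟨Q ∩ g.1 ⁻¹' P, hQ.inter (hP.preimage (hcont _ g.2)), ⟨h2, h1⟩, fun _ x hx hx' => ?_⟩
      exact disjoint_left.1 hd hx.2 hx'.1
  choose N hNo huN hN using hsep
  set N' : Set C.dom := ⋂ g : C.G, {x | g.1 u = u → g.1 x ∈ W ∩ ⋂ k : C.G, N k} with hN'
  have hN'o : IsOpen N' := by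
    refine isOpen_iInter_of_finite fun g => ?_
    by_cases hg : g.1 u = u
    · simp only [hg, true_implies]
      exact (hW.inter (isOpen_iInter_of_finite hNo)).preimage (hcont _ g.2)
    · simp [hg]
  have huN' : u ∈ N' := by
    refine mem_iInter.2 fun g hg => ?_
    rw [hg]
    exact ⟨hu, mem_iInter.2 huN⟩
  have hN's : N' ⊆ W ∩ ⋂ k : C.G, N k := fun x hx => mem_iInter.1 hx ⟨1, C.G.one_mem⟩ rfl
  have hinvN : ∀ g ∈ C.G, g u = u → MapsTo g N' N' := by
    intro g hg hgu x hx
    refine mem_iInter.2 fun k hk => ?_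
    exact mem_iInter.1 hx (k * ⟨g, hg⟩) (by
      change k.1 (g u) = u
      rw [hgu, hk])
  set W' : Set C.dom := connectedComponentIn N' u with hW'
  have huW' : u ∈ W' := mem_connectedComponentIn huN'
  have : LocallyConnectedSpace C.dom := C.dom.isOpen.isOpenEmbedding_subtypeVal.locallyConnectedSpace
  have hW'o : IsOpen W' := hN'o.connectedComponentIn
  have hW's : W' ⊆ N' := connectedComponentIn_subset _ _
  have hW'c : IsConnected W' := isConnected_connectedComponentIn_iff.2 huN'
  have hinv : ∀ g ∈ C.G, g u = u → MapsTo g W' W' := by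
    intro g hg hgu
    rw [mapsTo_iff_image_subset]
    refine IsPreconnected.subset_connectedComponentIn ?_ ⟨u, huW', hgu⟩ ?_
    · exact hW'c.isPreconnected.image _ (hcont g hg).continuousOn
    · rintro _ ⟨x, hx, rfl⟩
      exact hinvN g hg hgu (hW's hx)
  have hstab : ∀ g ∈ C.G, ∀ x ∈ W', g x ∈ W' → g u = u := by
    intro g hg x hx hgx
    by_contra h
    exact hN ⟨g, hg⟩ h x (mem_iInter.1 (hN's (hW's hx)).2 _) (mem_iInter.1 (hN's (hW's hgx)).2 _)
  let U₀ : Opens (Euc m) :=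
    ⟨Subtype.val '' W', C.dom.isOpen.isOpenEmbedding_subtypeVal.isOpenMap _ hW'o⟩
  have hle : U₀ ≤ C.dom := by
    rintro _ ⟨x, _, rfl⟩
    exact x.2
  let e : U₀ → C.dom := Opens.inclusion hle
  have hemb : IsSmoothEmb e := IsSmoothEmb.inclusion hle
  have heW : ∀ x : U₀, e x ∈ W' := by
    rintro ⟨_, y, hy, rfl⟩
    exact hy
  have hWe : ∀ y ∈ W', ∃ x : U₀, e x = y := fun y hy => ⟨⟨y, y, hy, rfl⟩, rfl⟩
  let G₀ : Subgroup (Equiv.Perm U₀) :=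
    { carrier := {h | ∃ g ∈ C.G, ∀ x, e (h x) = g (e x)}
      one_mem' := ⟨1, C.G.one_mem, fun _ => rfl⟩
      mul_mem' := by
        rintro a b ⟨g, hg, h1⟩ ⟨k, hk, h2⟩
        refine ⟨g * k, C.G.mul_mem hg hk, fun x => ?_⟩
        rw [Equiv.Perm.mul_apply, Equiv.Perm.mul_apply, h1, h2]
      inv_mem' := by
        rintro a ⟨g, hg, h1⟩
        refine ⟨g⁻¹, C.G.inv_mem hg, fun x => ?_⟩
        rw [eq_comm, Equiv.Perm.inv_eq_iff_eq, ← h1]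
        exact congrArg e (a.apply_symm_apply x).symm }
  have hG₀ : ∀ h ∈ G₀, ∃ g ∈ C.G, ∀ x, e (h x) = g (e x) := fun _ h => h
  let C₀ : OrbifoldChart m Z :=
    { dom := U₀
      dom_connected := hW'c.image _ continuous_subtype_val.continuousOn
      G := G₀
      G_finite := by
        choose f hf hf' using hG₀
        refine Finite.of_injective (fun h : G₀ => (⟨f h.1 h.2, hf h.1 h.2⟩ : C.G)) ?_
        intro a b hab
        refine Subtype.ext (Equiv.ext fun x => hemb.injective ?_)
        rw [hf' a.1 a.2, hf' b.1 b.2]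
        exact congrArg (fun k : C.G => k.1 (e x)) hab
      G_smooth := by
        intro h hh
        obtain ⟨g, hg, h1⟩ := hG₀ h hh
        have h2 : SmoothMap (g ∘ e) := (C.G_smooth g hg).comp hemb.localDiffeo.contMDiff
        have h3 := (contMDiff_subtype_val (U := C.dom)).comp h2
        unfold SmoothMap
        rw [← ContMDiff.subtypeVal_comp_iff]
        refine h3.congr fun x => ?_
        exact congrArg Subtype.val (h1 x)
      proj := C.proj ∘ e
      proj_cont := C.proj_cont.comp hemb.continuous
      proj_open := C.proj_open.comp hemb.isOpenEmbedding.isOpenMap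
      proj_eq_iff := by
        intro x y
        constructor
        · intro hxy
          obtain ⟨g, hg, hgx⟩ := (C.proj_eq_iff _ _).1 hxy
          have hgu : g u = u := hstab g hg _ (heW x) (hgx ▸ heW y)
          have hgu' : g⁻¹ u = u := by rw [Equiv.Perm.inv_eq_iff_eq, hgu]
          choose f hf using fun x : U₀ => hWe _ (hinv g hg hgu (heW x))
          choose f' hf' using fun x : U₀ => hWe _ (hinv g⁻¹ (C.G.inv_mem hg) hgu' (heW x))
          refine ⟨⟨f, f', fun x => hemb.injective ?_, fun x => hemb.injective ?_⟩,
            ⟨g, hg, hf⟩, hemb.injective ((hf x).trans hgx)⟩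
          · rw [hf', hf]
            exact g.symm_apply_apply _
          · rw [hf, hf']
            exact g.apply_symm_apply _
        · rintro ⟨h, hh, rfl⟩
          obtain ⟨g, hg, h1⟩ := hG₀ h hh
          exact (C.proj_eq_iff _ _).2 ⟨g, hg, (h1 x).symm⟩ }
  refine ⟨C₀, ⟨e, hemb, fun _ => rfl⟩, hWe u huW', ?_⟩
  rintro _ ⟨x, rfl⟩
  exact (hN's (hW's (heW x))).1

end Restrict
/-! ### The groupoid of germs of coordinate transformations -/

namespace OrbifoldAtlas

variable {m : ℕ} {Z : Type u} [TopologicalSpace Z]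

/-- The space of objects `𝒢₀` of the groupoid of an atlas: the disjoint union of the domains of the
charts. -/
abbrev Obj (A : OrbifoldAtlas m Z) : Type u := Σ C : A.charts, C.1.dom

/-- A coordinate transformation `ψ ∘ φ⁻¹ : φ(Ũ₀) → ψ(Ũ₀)` between two charts of the atlas, given by
embeddings `φ`, `ψ` of a third chart of `Z` into these. -/
structure Transition (A : OrbifoldAtlas m Z) where
  i : A.charts
  j : A.charts
  C₀ : OrbifoldChart m Z
  φ : ChartEmb C₀ i.1
  ψ : ChartEmb C₀ j.1

variable {A : OrbifoldAtlas m Z}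

/-- The coordinate transformation `T` maps the point `T.s y` of its domain to `T.t y`. -/
def Transition.s (T : A.Transition) (y : T.C₀.dom) : A.Obj := ⟨T.i, T.φ.toFun y⟩

/-- The point to which `T` maps `T.s y`. -/
def Transition.t (T : A.Transition) (y : T.C₀.dom) : A.Obj := ⟨T.j, T.ψ.toFun y⟩

variable (A) in
/-- The arrows `𝒢₁`: germs of coordinate transformations. -/
structure Arrow where
  /-- the source of the arrow -/
  src : A.Obj
  /-- the germ at the source -/
  germ : Germ (𝓝 src) A.Obj
  isCoord : ∃ (T : A.Transition) (y : T.C₀.dom) (f : A.Obj → A.Obj),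
    T.s y = src ∧ germ = ↑f ∧ ∀ z, f (T.s z) = T.t z

/-- The target of an arrow. -/
def Arrow.tgt (g : A.Arrow) : A.Obj := g.germ.value

/-- The inverse coordinate transformation. -/
def Transition.symm (T : A.Transition) : A.Transition := ⟨T.j, T.i, T.C₀, T.ψ, T.φ⟩

theorem Transition.s_isOpenEmbedding (T : A.Transition) : IsOpenEmbedding T.s :=
  (IsOpenEmbedding.sigmaMk (i := T.i)).comp T.φ.isEmb.isOpenEmbedding

theorem Transition.t_isOpenEmbedding (T : A.Transition) : IsOpenEmbedding T.t :=
  T.symm.s_isOpenEmbedding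

/-- The germ of a coordinate transformation `T` at the point `T.s y`. -/
noncomputable def Transition.germAt (T : A.Transition) (y : T.C₀.dom) : A.Arrow where
  src := T.s y
  germ := ↑(Function.extend T.s T.t id)
  isCoord := ⟨T, y, _, rfl, rfl, T.s_isOpenEmbedding.injective.extend_apply _ _⟩

/-- The topology of `𝒢₁` is the usual (étale) topology on germs: the germs of a coordinate
transformation at the points of an open subset of its domain form a basic open set. -/
instance : TopologicalSpace A.Arrow :=
  .generateFrom {S | ∃ (T : A.Transition) (V : Set T.C₀.dom), IsOpen V ∧ S = T.germAt '' V}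

theorem Transition.eventually_eq (T : A.Transition) (y : T.C₀.dom) {f f' : A.Obj → A.Obj}
    (hf : ∀ᶠ z in 𝓝 y, f (T.s z) = f' (T.s z)) : f =ᶠ[𝓝 (T.s y)] f' := by
  rw [EventuallyEq, ← T.s_isOpenEmbedding.map_nhds_eq y, eventually_map]
  exact hf

theorem Transition.germAt_eq (T : A.Transition) (y : T.C₀.dom) {f : A.Obj → A.Obj}
    (hf : ∀ z, f (T.s z) = T.t z) : (T.germAt y).germ = (f : Germ (𝓝 (T.s y)) A.Obj) := by
  refine Germ.coe_eq.2 (T.eventually_eq y (Eventually.of_forall fun z => ?_))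
  rw [T.s_isOpenEmbedding.injective.extend_apply, hf]

theorem Arrow.ext' {g h : A.Arrow} (hs : g.src = h.src) (f f' : A.Obj → A.Obj)
    (hg : g.germ = (f : Germ (𝓝 g.src) A.Obj)) (hh : h.germ = (f' : Germ (𝓝 h.src) A.Obj))
    (hf : f =ᶠ[𝓝 g.src] f') : g = h := by
  rcases g with ⟨x, g, _⟩
  rcases h with ⟨y, h, _⟩
  dsimp only at hs hg hh hf
  subst hs hg hh
  congr 1
  exact Germ.coe_eq.2 hf

theorem Arrow.exists_germAt (g : A.Arrow) : ∃ (T : A.Transition) (y : T.C₀.dom), g = T.germAt y := by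
  obtain ⟨T, y, f, h1, h2, h3⟩ := g.isCoord
  exact ⟨T, y, Arrow.ext' h1.symm f f h2 (T.germAt_eq y h3) (EventuallyEq.refl _ _)⟩

@[simp] theorem Transition.germAt_src (T : A.Transition) (y : T.C₀.dom) :
    (T.germAt y).src = T.s y := rfl

@[simp] theorem Transition.germAt_tgt (T : A.Transition) (y : T.C₀.dom) :
    (T.germAt y).tgt = T.t y := by
  change Function.extend T.s T.t id (T.s y) = _
  rw [T.s_isOpenEmbedding.injective.extend_apply]

theorem Arrow.tgt_eq (g : A.Arrow) {f : A.Obj → A.Obj}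
    (hf : g.germ = (f : Germ (𝓝 g.src) A.Obj)) : g.tgt = f g.src := by
  rw [Arrow.tgt, hf]
  rfl

theorem Arrow.tendsto (g : A.Arrow) {x : A.Obj} (hx : g.tgt = x) : g.germ.Tendsto (𝓝 x) := by
  obtain ⟨T, y, rfl⟩ := g.exists_germAt
  rw [Transition.germAt_tgt] at hx
  subst hx
  change Tendsto (Function.extend T.s T.t id) (𝓝 (T.s y)) _
  rw [← T.s_isOpenEmbedding.map_nhds_eq y, tendsto_map'_iff, show Function.extend T.s T.t id ∘ T.s = T.t from
      funext fun z => T.s_isOpenEmbedding.injective.extend_apply _ _ z]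
  exact T.t_isOpenEmbedding.continuous.tendsto y

/-- The composition of two composable arrows (first `g`, then `h`). -/
def Arrow.comp' (g h : A.Arrow) (e : g.tgt = h.src) : A.Arrow where
  src := g.src
  germ := h.germ.compTendsto' g.germ (g.tendsto e)
  isCoord := by
    obtain ⟨T, y, f, h1, h2, h3⟩ := g.isCoord
    obtain ⟨T', y', f', h1', h2', h3'⟩ := h.isCoord
    have e' : T.t y = T'.s y' := by
      rw [h1', ← e, g.tgt_eq h2, ← h1, h3]
    obtain ⟨C₁, ι, ⟨x, hx⟩, hι⟩ := T.C₀.exists_sub y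
      (T'.s_isOpenEmbedding.isOpen_range.preimage T.t_isOpenEmbedding.continuous) ⟨y', e'.symm⟩
    choose k hk using fun z : C₁.dom => hι ⟨z, rfl⟩
    have hij : T.j = T'.i := congrArg Sigma.fst e'
    have hk' : IsSmoothEmb k ∧ ∀ z, T'.C₀.proj (k z) = C₁.proj z := by
      rcases T with ⟨i, j, C₀, φ, ψ⟩
      rcases T' with ⟨i', j', C₀', φ', ψ'⟩
      dsimp only at hij
      subst hij
      have hk'' : ∀ z, φ'.toFun (k z) = ψ.toFun (ι.toFun z) := fun z =>
        eq_of_heq (Sigma.mk.inj_iff.1 (hk z)).2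
      refine ⟨φ'.isEmb.of_comp ?_, fun z => ?_⟩
      · rw [show φ'.toFun ∘ k = ψ.toFun ∘ ι.toFun from funext hk'']
        exact ψ.isEmb.comp ι.isEmb
      · rw [← φ'.comm, hk'', ψ.comm, ι.comm]
    refine ⟨⟨T.i, T'.j, C₁, ⟨T.φ.toFun ∘ ι.toFun, T.φ.isEmb.comp ι.isEmb, fun z => ?_⟩,
      ⟨T'.ψ.toFun ∘ k, T'.ψ.isEmb.comp hk'.1, fun z => ?_⟩⟩, x, f' ∘ f, ?_, ?_, fun z => ?_⟩
    · rw [Function.comp_apply, T.φ.comm, ι.comm]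
    · rw [Function.comp_apply, T'.ψ.comm, hk'.2]
    · rw [← h1, ← hx]
      rfl
    · simp only [h2, h2']
      rfl
    · change f' (f (T.s (ι.toFun z))) = T'.t (k z)
      rw [h3, ← h3', hk]

theorem Arrow.comp'_germ (g h : A.Arrow) (e : g.tgt = h.src) {f f' : A.Obj → A.Obj}
    (hf : g.germ = (f : Germ (𝓝 g.src) A.Obj)) (hf' : h.germ = (f' : Germ (𝓝 h.src) A.Obj)) :
    (g.comp' h e).germ = (↑(f' ∘ f) : Germ (𝓝 g.src) A.Obj) := by
  simp only [Arrow.comp', hf, hf']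
  rfl

theorem Arrow.exists_rep (g : A.Arrow) : ∃ f : A.Obj → A.Obj,
    g.germ = (f : Germ (𝓝 g.src) A.Obj) := by
  obtain ⟨T, y, f, h1, h2, h3⟩ := g.isCoord
  exact ⟨f, h2⟩

open Classical in
/-- The composition of arrows (first `g`, then `h`), with junk value `g` if the target of `g` is not
the source of `h`. -/
noncomputable def Arrow.comp (g h : A.Arrow) : A.Arrow :=
  if e : g.tgt = h.src then g.comp' h e else g

@[simp] theorem Arrow.comp_src (g h : A.Arrow) : (g.comp h).src = g.src := by
  unfold Arrow.comp
  split_ifs <;> rfl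

theorem Arrow.comp_tgt {g h : A.Arrow} (e : g.tgt = h.src) : (g.comp h).tgt = h.tgt := by
  obtain ⟨f, hf⟩ := g.exists_rep
  obtain ⟨f', hf'⟩ := h.exists_rep
  rw [Arrow.comp, dif_pos e, Arrow.tgt_eq _ (comp'_germ g h e hf hf'), h.tgt_eq hf', ← e,
    g.tgt_eq hf]
  rfl

theorem Arrow.comp_assoc {g h k : A.Arrow} (e : g.tgt = h.src) (e' : h.tgt = k.src) :
    (g.comp h).comp k = g.comp (h.comp k) := by
  have e1 : (g.comp h).tgt = k.src := by rw [comp_tgt e, e']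
  have e2 : g.tgt = (h.comp k).src := by rw [comp_src, e]
  obtain ⟨f, hf⟩ := g.exists_rep
  obtain ⟨f', hf'⟩ := h.exists_rep
  obtain ⟨f'', hf''⟩ := k.exists_rep
  have h1 : g.comp h = g.comp' h e := by rw [Arrow.comp, dif_pos e]
  have h2 : h.comp k = h.comp' k e' := by rw [Arrow.comp, dif_pos e']
  rw [h1] at e1 ⊢
  rw [h2] at e2 ⊢
  rw [Arrow.comp, dif_pos e1]
  conv_rhs => rw [Arrow.comp, dif_pos e2]
  exact Arrow.ext' rfl _ _ (comp'_germ _ _ e1 (comp'_germ g h e hf hf') hf'')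
    (comp'_germ _ _ e2 hf (comp'_germ h k e' hf' hf'')) (EventuallyEq.refl _ _)

/-- The identity coordinate transformation of a chart. -/
def Transition.refl (C : A.charts) : A.Transition :=
  ⟨C, C, C.1, ⟨fun x => x, .id, fun _ => rfl⟩, ⟨fun x => x, .id, fun _ => rfl⟩⟩

/-- The identity arrow at a point. -/
noncomputable def Arrow.refl (x : A.Obj) : A.Arrow := (Transition.refl x.1).germAt x.2

@[simp] theorem Arrow.refl_src (x : A.Obj) : (Arrow.refl x).src = x := rfl

@[simp] theorem Arrow.refl_tgt (x : A.Obj) : (Arrow.refl x).tgt = x :=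
  Transition.germAt_tgt _ _

theorem Arrow.refl_germ (x : A.Obj) : (Arrow.refl x).germ = (↑(fun y : A.Obj => y) : Germ (𝓝 x) A.Obj) :=
  (Transition.refl x.1).germAt_eq x.2 fun _ => rfl

theorem Arrow.refl_comp {g : A.Arrow} {x : A.Obj} (hx : x = g.src) : (Arrow.refl x).comp g = g := by
  subst hx
  obtain ⟨f, hf⟩ := g.exists_rep
  rw [Arrow.comp, dif_pos (Arrow.refl_tgt _)]
  exact Arrow.ext' rfl _ _ (comp'_germ _ _ _ (refl_germ _) hf) hf (EventuallyEq.refl _ _)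

theorem Arrow.comp_refl {g : A.Arrow} {x : A.Obj} (hx : g.tgt = x) : g.comp (Arrow.refl x) = g := by
  obtain ⟨f, hf⟩ := g.exists_rep
  have e : g.tgt = (Arrow.refl x).src := hx
  rw [Arrow.comp, dif_pos e]
  exact Arrow.ext' rfl _ _ (comp'_germ _ _ e hf (refl_germ _)) hf (EventuallyEq.refl _ _)

theorem Transition.germAt_comp_symm (T : A.Transition) (y : T.C₀.dom) :
    (T.germAt y).comp (T.symm.germAt y) = Arrow.refl (T.s y) := by
  have e : (T.germAt y).tgt = (T.symm.germAt y).src := T.germAt_tgt y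
  rw [Arrow.comp, dif_pos e]
  refine Arrow.ext' rfl _ _ (Arrow.comp'_germ _ _ e rfl rfl) (Arrow.refl_germ _)
    (T.eventually_eq y (Eventually.of_forall fun z => ?_))
  rw [Function.comp_apply, T.s_isOpenEmbedding.injective.extend_apply]
  exact T.symm.s_isOpenEmbedding.injective.extend_apply _ _ _

theorem Transition.symm_comp_germAt (T : A.Transition) (y : T.C₀.dom) :
    (T.symm.germAt y).comp (T.germAt y) = Arrow.refl (T.t y) :=
  T.symm.germAt_comp_symm y

theorem Arrow.exists_inv (g : A.Arrow) : ∃ g' : A.Arrow, g'.src = g.tgt ∧ g'.tgt = g.src ∧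
    g.comp g' = Arrow.refl g.src ∧ g'.comp g = Arrow.refl g.tgt := by
  obtain ⟨T, y, rfl⟩ := g.exists_germAt
  exact ⟨T.symm.germAt y, (T.germAt_tgt y).symm, T.symm.germAt_tgt y, T.germAt_comp_symm y,
    (T.symm_comp_germAt y).trans (congrArg _ (T.germAt_tgt y).symm)⟩

/-- The inverse of an arrow. -/
noncomputable def Arrow.inv (g : A.Arrow) : A.Arrow := g.exists_inv.choose

theorem Arrow.inv_src (g : A.Arrow) : g.inv.src = g.tgt := g.exists_inv.choose_spec.1

theorem Arrow.inv_tgt (g : A.Arrow) : g.inv.tgt = g.src := g.exists_inv.choose_spec.2.1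

theorem Arrow.comp_inv (g : A.Arrow) : g.comp g.inv = Arrow.refl g.src :=
  g.exists_inv.choose_spec.2.2.1

theorem Arrow.inv_comp (g : A.Arrow) : g.inv.comp g = Arrow.refl g.tgt :=
  g.exists_inv.choose_spec.2.2.2

theorem Arrow.proj_tgt (g : A.Arrow) : g.tgt.1.1.proj g.tgt.2 = g.src.1.1.proj g.src.2 := by
  obtain ⟨T, y, rfl⟩ := g.exists_germAt
  rw [T.germAt_tgt]
  exact (T.ψ.comm y).trans (T.φ.comm y).symm

/-! ### `𝒢`-paths and their homotopy classes -/

variable (A) in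
/-- Underlying data of `𝒢`-paths: `(b₁, …, b_k; g₀, …, g_k)` is recorded as the sequence
`g₀, b₁, g₁, …, b_k, g_k`, that is, as `cons g₀ b₁ (cons g₁ b₂ (… (arrow g_k)))`.  As `𝒢`-paths only
matter up to homotopy, which includes moving the points of the partition
`0 = t₀ < t₁ < ⋯ < t_k = 1`, each `b_i : [t_{i-1}, t_i] → 𝒢₀` is given by its affine
reparametrization by `[0, 1]`. -/
inductive RawPath : Type u
  | arrow (g : A.Arrow) : RawPath
  | cons (g : A.Arrow) (b : C(I, A.Obj)) (r : RawPath) : RawPath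

namespace RawPath

/-- `p.IsPath x y`: the data `p` fit together to a path from `x` to `y`, i.e.
`g₀ : x → b₁(0)`, `g_i : b_i(1) → b_{i+1}(0)` and `g_k : b_k(1) → y`. -/
def IsPath : RawPath A → A.Obj → A.Obj → Prop
  | arrow g, x, y => g.src = x ∧ g.tgt = y
  | cons g b r, x, y => g.src = x ∧ g.tgt = b 0 ∧ r.IsPath (b 1) y

/-- The condition `k ≥ 1`. -/
def IsProper : RawPath A → Prop
  | arrow _ => False
  | cons _ _ _ => True

/-- The first arrow `g₀`. -/
def first : RawPath A → A.Arrow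
  | arrow g => g
  | cons g _ _ => g

/-- The last arrow `g_k`. -/
def last : RawPath A → A.Arrow
  | arrow g => g
  | cons _ _ r => r.last

/-- Replacement of the first arrow `g₀` by `g₀h`. -/
noncomputable def preact (h : A.Arrow) : RawPath A → RawPath A
  | arrow g => arrow (h.comp g)
  | cons g b r => cons (h.comp g) b r

/-- The composition
`(b₁, …, b_k, b'₁, …, b'_{k'}; g₀, …, g'₀ g_k, …, g'_{k'})` of two `𝒢`-paths. -/
noncomputable def comp : RawPath A → RawPath A → RawPath A
  | arrow g, q => q.preact g
  | cons g b r, q => cons g b (r.comp q)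

/-- The inverse `𝒢`-path. -/
noncomputable def inv : RawPath A → RawPath A
  | arrow g => arrow g.inv
  | cons g b r =>
    r.inv.comp (cons (Arrow.refl (b 1)) (b.comp ⟨σ, unitInterval.continuous_symm⟩) (arrow g.inv))

/-- A family of `𝒢`-paths (with constant `k`) depending continuously on the parameter `s`. -/
inductive ContFamily : (I → RawPath A) → Prop
  | arrow (g : I → A.Arrow) : Continuous g → ContFamily fun s => .arrow (g s)
  | cons (g : I → A.Arrow) (b : I → C(I, A.Obj)) (r : I → RawPath A) : Continuous g →
      (Continuous fun q : I × I => b q.1 q.2) → ContFamily r →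
      ContFamily fun s => .cons (g s) (b s) (r s)

end RawPath

/-- The restriction of `b` to `[0, t]`, reparametrized by `[0, 1]`. -/
def leftPart (b : C(I, A.Obj)) (t : I) : C(I, A.Obj) := b.comp ⟨fun u => t * u, by fun_prop⟩

/-- The restriction of `b` to `[t, 1]`, reparametrized by `[0, 1]`: note that
`1 - (1 - t) (1 - u) = t + (1 - t) u`. -/
def rightPart (b : C(I, A.Obj)) (t : I) : C(I, A.Obj) :=
  b.comp ⟨fun u => σ (σ t * σ u), by fun_prop⟩

/-- A path lying in the source of a coordinate transformation `T`. -/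
def Transition.sPath (T : A.Transition) (β : C(I, T.C₀.dom)) : C(I, A.Obj) :=
  ⟨T.s ∘ β, T.s_isOpenEmbedding.continuous.comp β.continuous⟩

/-- The image under `T` of the path `T.sPath β`. -/
def Transition.tPath (T : A.Transition) (β : C(I, T.C₀.dom)) : C(I, A.Obj) :=
  ⟨T.t ∘ β, T.t_isOpenEmbedding.continuous.comp β.continuous⟩

/-- The elementary moves between `𝒢`-paths from `x` to `y`, which generate homotopy:
* subdivision of the partition at a new point, with an identity arrow there;
* replacement of `(b_i, g_{i-1}, g_i)` by `(h b_i, h g_{i-1}, g_i h⁻¹)` where `h` is a coordinate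
  transformation whose domain contains the path `b_i`;
* elementary homotopies, where the first and the last arrow are independent of the parameter.
The rule `cons` says that a move can be made in a later part of a path. -/
inductive Move : A.Obj → A.Obj → RawPath A → RawPath A → Prop
  | subdivide {x y : A.Obj} (g : A.Arrow) (b : C(I, A.Obj)) (r : RawPath A) (t : I) :
      0 < t → t < 1 → (RawPath.cons g b r).IsPath x y →
      Move x y (.cons g b r)
        (.cons g (leftPart b t) (.cons (Arrow.refl (b t)) (rightPart b t) r))
  | transform {x y : A.Obj} (g : A.Arrow) (r : RawPath A) (h : A.Transition)
      (β : C(I, h.C₀.dom)) : (RawPath.cons g (h.sPath β) r).IsPath x y →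
      Move x y (.cons g (h.sPath β) r)
        (.cons (g.comp (h.germAt (β 0))) (h.tPath β) (r.preact (h.symm.germAt (β 1))))
  | homotopy {x y : A.Obj} (c : I → RawPath A) : RawPath.ContFamily c → (∀ s, (c s).IsPath x y) →
      (∀ s, (c s).first = (c 0).first) → (∀ s, (c s).last = (c 0).last) → Move x y (c 0) (c 1)
  | cons {x y : A.Obj} (g : A.Arrow) (b : C(I, A.Obj)) (r r' : RawPath A) :
      g.src = x → g.tgt = b 0 → Move (b 1) y r r' → Move x y (.cons g b r) (.cons g b r')

/-- `𝒢`-paths from `x` to `y`. -/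
def GPath (x y : A.Obj) : Type u := {p : RawPath A // p.IsProper ∧ p.IsPath x y}

/-- Homotopy classes of `𝒢`-paths from `x` to `y`: the quotient by the equivalence relation generated
by the elementary moves. -/
def HClass (x y : A.Obj) : Type u := Quot fun p q : GPath x y => Move x y p.1 q.1

namespace RawPath

theorem IsPath.preact {g : A.Arrow} {p : RawPath A} {x y z : A.Obj} (hx : g.src = x)
    (hg : g.tgt = y) (hp : p.IsPath y z) : (p.preact g).IsPath x z := by
  cases p with
  | arrow h =>
    have e : g.tgt = h.src := hg.trans hp.1.symm
    exact ⟨(g.comp_src h).trans hx, (Arrow.comp_tgt e).trans hp.2⟩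
  | cons h b r =>
    have e : g.tgt = h.src := hg.trans hp.1.symm
    exact ⟨(g.comp_src h).trans hx, (Arrow.comp_tgt e).trans hp.2.1, hp.2.2⟩

theorem IsPath.comp {p q : RawPath A} {x y z : A.Obj} (hp : p.IsPath x y) (hq : q.IsPath y z) :
    (p.comp q).IsPath x z := by
  induction p generalizing x with
  | arrow g => exact hq.preact hp.1 hp.2
  | cons g b r ih => exact ⟨hp.1, hp.2.1, ih hp.2.2⟩

theorem IsPath.first_src {p : RawPath A} {x y : A.Obj} (hp : p.IsPath x y) : p.first.src = x := by
  cases p <;> exact hp.1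

theorem IsPath.inv {p : RawPath A} {x y : A.Obj} (hp : p.IsPath x y) : p.inv.IsPath y x := by
  induction p generalizing x with
  | arrow g => exact ⟨g.inv_src.trans hp.2, g.inv_tgt.trans hp.1⟩
  | cons g b r ih =>
    refine (ih hp.2.2).comp ⟨rfl, ?_, ?_, g.inv_tgt.trans hp.1⟩
    · simp
    · rw [g.inv_src, hp.2.1]
      simp

theorem isProper_cons {g : A.Arrow} {b : C(I, A.Obj)} {r : RawPath A} : (cons g b r).IsProper :=
  trivial

theorem IsProper.preact {g : A.Arrow} {p : RawPath A} (hp : p.IsProper) :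
    (p.preact g).IsProper := by
  cases p <;> exact hp

theorem IsProper.comp {p q : RawPath A} (hp : p.IsProper) : (p.comp q).IsProper := by
  cases p
  · exact hp.elim
  · trivial

theorem IsProper.comp' {p q : RawPath A} (hq : q.IsProper) : (p.comp q).IsProper := by
  cases p
  · exact hq.preact
  · trivial

theorem IsProper.inv {p : RawPath A} (hp : p.IsProper) : p.inv.IsProper := by
  cases p
  · exact hp.elim
  · exact IsProper.comp' trivial

theorem preact_preact {g h : A.Arrow} {p : RawPath A} {y z : A.Obj} (e : g.tgt = h.src)
    (hh : h.tgt = y) (hp : p.IsPath y z) : (p.preact h).preact g = p.preact (g.comp h) := by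
  cases p with
  | arrow k => exact congrArg arrow (Arrow.comp_assoc e (hh.trans hp.1.symm)).symm
  | cons k b r => exact congrArg (cons · b r) (Arrow.comp_assoc e (hh.trans hp.1.symm)).symm

theorem preact_refl {p : RawPath A} {x y : A.Obj} (hp : p.IsPath x y) :
    p.preact (Arrow.refl x) = p := by
  cases p with
  | arrow k => exact congrArg arrow (Arrow.refl_comp hp.1.symm)
  | cons k b r => exact congrArg (cons · b r) (Arrow.refl_comp hp.1.symm)

theorem preact_comp {g : A.Arrow} {p q : RawPath A} {x y z : A.Obj} (e : g.tgt = x)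
    (hp : p.IsPath x y) (hq : q.IsPath y z) : (p.comp q).preact g = (p.preact g).comp q := by
  cases p with
  | arrow h => exact preact_preact (e.trans hp.1.symm) hp.2 hq
  | cons h b r => rfl

theorem comp_assoc {p q r : RawPath A} {x y z w : A.Obj} (hp : p.IsPath x y) (hq : q.IsPath y z)
    (hr : r.IsPath z w) : (p.comp q).comp r = p.comp (q.comp r) := by
  induction p generalizing x with
  | arrow g => exact (preact_comp hp.2 hq hr).symm
  | cons g b s ih => exact congrArg (cons g b) (ih hp.2.2)

theorem last_preact {g : A.Arrow} {p q : RawPath A} (h : p.last = q.last) (h' : p.first = q.first)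
    (h'' : p.IsProper ↔ q.IsProper) : (p.preact g).last = (q.preact g).last := by
  cases p <;> cases q
  · exact congrArg (fun k => Arrow.comp g k) h
  · exact absurd trivial h''.2
  · exact absurd trivial h''.1
  · exact h

theorem first_preact {g : A.Arrow} (p : RawPath A) : (p.preact g).first = g.comp p.first := by
  cases p <;> rfl

theorem ContFamily.isProper {c : I → RawPath A} (hc : ContFamily c) (s : I) :
    (c s).IsProper ↔ (c 0).IsProper := by
  cases hc <;> exact Iff.rfl

theorem ContFamily.const (p : RawPath A) : ContFamily fun _ => p := by
  induction p with
  | arrow g => exact .arrow (fun _ => g) continuous_const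
  | cons g b r ih =>
    exact .cons (fun _ => g) (fun _ => b) (fun _ => r) continuous_const
      (b.continuous.comp continuous_snd) ih

theorem ContFamily.preact {c : I → RawPath A} (hc : ContFamily c)
    (h : ∀ s, (c s).first = (c 0).first) (g : A.Arrow) : ContFamily fun s => (c s).preact g := by
  cases hc with
  | arrow k hk =>
    refine .arrow (fun s => g.comp (k s)) ?_
    have : k = fun _ => k 0 := funext h
    rw [this]
    exact continuous_const
  | cons k b r hk hb hr =>
    refine .cons (fun s => g.comp (k s)) b r ?_ hb hr
    have : k = fun _ => k 0 := funext h
    rw [this]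
    exact continuous_const

theorem ContFamily.comp {c : I → RawPath A} (hc : ContFamily c)
    (h : ∀ s, (c s).last = (c 0).last) (q : RawPath A) : ContFamily fun s => (c s).comp q := by
  induction hc with
  | arrow k hk =>
    have : k = fun _ => k 0 := funext h
    rw [this]
    exact .const (q.preact (k 0))
  | cons k b r hk hb hr ih => exact .cons k b (fun s => (r s).comp q) hk hb (ih h)

theorem first_comp {p p' q : RawPath A} (h : p.first = p'.first) (h' : p.IsProper ↔ p'.IsProper) :
    (p.comp q).first = (p'.comp q).first := by
  cases p <;> cases p'
  · exact congrArg (fun k => (preact k q).first) h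
  · exact absurd trivial h'.2
  · exact absurd trivial h'.1
  · exact h

theorem ContFamily.last_comp {c : I → RawPath A} (hc : ContFamily c)
    (h : ∀ s, (c s).last = (c 0).last) (q : RawPath A) (s : I) :
    ((c s).comp q).last = ((c 0).comp q).last := by
  induction hc with
  | arrow k hk => exact congrArg (fun k => (RawPath.preact k q).last) (h s)
  | cons k b r hk hb hr ih => exact ih h

end RawPath

theorem Move.isPath {x y : A.Obj} {p q : RawPath A} (h : Move x y p q) : p.IsPath x y := by
  induction h with
  | subdivide g b r t _ _ h => exact h
  | transform g r T β h => exact h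
  | homotopy c _ h => exact h 0
  | cons g b r r' h1 h2 _ ih => exact ⟨h1, h2, ih⟩

theorem Move.isProper_iff {x y : A.Obj} {p q : RawPath A} (h : Move x y p q) :
    p.IsProper ↔ q.IsProper := by
  cases h with
  | homotopy c hc _ => exact (hc.isProper 1).symm
  | _ => exact Iff.rfl

theorem Move.isPath_right {x y : A.Obj} {p q : RawPath A} (h : Move x y p q) : q.IsPath x y := by
  induction h with
  | subdivide g b r t _ _ h =>
    refine ⟨h.1, ?_, ?_, ?_, ?_⟩
    · rw [h.2.1]
      simp [leftPart]
    · simp [leftPart]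
    · simp [rightPart]
    · have h3 := h.2.2
      simpa [rightPart] using h3
  | transform g r T β h =>
    have e : g.tgt = (T.germAt (β 0)).src := h.2.1
    exact ⟨(g.comp_src _).trans h.1, (Arrow.comp_tgt e).trans (T.germAt_tgt _),
      h.2.2.preact rfl (T.symm.germAt_tgt _)⟩
  | homotopy c _ h => exact h 1
  | cons g b r r' h1 h2 _ ih => exact ⟨h1, h2, ih⟩

theorem Move.preact {x y z : A.Obj} {p q : RawPath A} (h : Move y z p q) (g : A.Arrow)
    (hg : g.src = x) (hg' : g.tgt = y) : Move x z (p.preact g) (q.preact g) := by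
  cases h with
  | subdivide k b r t h0 h1 h => exact .subdivide _ b r t h0 h1 (h.preact hg hg')
  | transform k r T β h =>
    have e : (k.comp (T.germAt (β 0))) = k.comp (T.germAt (β 0)) := rfl
    have h3 := Move.transform _ r T β (h.preact hg hg')
    rwa [Arrow.comp_assoc (hg'.trans h.1.symm) h.2.1] at h3
  | homotopy c hc h hf hl =>
    refine .homotopy (fun s => (c s).preact g) (hc.preact hf g) (fun s => (h s).preact hg hg')
      (fun s => ?_) (fun s => ?_)
    · rw [RawPath.first_preact, RawPath.first_preact, hf s]
    · exact RawPath.last_preact (hl s) (hf s) (hc.isProper s)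
  | cons k b r r' h1 h2 h =>
    refine .cons _ b r r' ((g.comp_src k).trans hg) ?_ h
    rw [Arrow.comp_tgt (hg'.trans h1.symm), h2]

theorem Move.comp_left {x y z : A.Obj} {p q q' : RawPath A} (hp : p.IsPath x y)
    (h : Move y z q q') : Move x z (p.comp q) (p.comp q') := by
  induction p generalizing x with
  | arrow g => exact h.preact g hp.1 hp.2
  | cons g b r ih => exact .cons g b _ _ hp.1 hp.2.1 (ih hp.2.2)

theorem Move.comp_right {x y z : A.Obj} {p p' q : RawPath A} (h : Move x y p p')
    (hq : q.IsPath y z) : Move x z (p.comp q) (p'.comp q) := by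
  induction h with
  | subdivide g b r t h0 h1 h => exact .subdivide g b (r.comp q) t h0 h1 (h.comp hq)
  | transform g r T β h =>
    have h3 := Move.transform g (r.comp q) T β (h.comp hq)
    rwa [RawPath.preact_comp (T.symm.germAt_tgt _) h.2.2 hq] at h3
  | homotopy c hc h hf hl =>
    exact .homotopy (fun s => (c s).comp q) (hc.comp hl q) (fun s => (h s).comp hq)
      (fun s => RawPath.first_comp (hf s) (hc.isProper s)) (hc.last_comp hl q)
  | cons g b r r' h1 h2 h ih => exact .cons g b _ _ h1 h2 (ih hq)

namespace HClass

/-- The homotopy class of a `𝒢`-path. -/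
def mk {x y : A.Obj} (p : RawPath A) (h : p.IsProper) (h' : p.IsPath x y) : HClass x y :=
  Quot.mk _ ⟨p, h, h'⟩

theorem ind {x y : A.Obj} {motive : HClass x y → Prop} (h : ∀ p h h', motive (mk p h h'))
    (c : HClass x y) : motive c := by
  rcases c with ⟨p, h1, h2⟩
  exact h p h1 h2

/-- The composition of homotopy classes of `𝒢`-paths, `[c] [c'] = [c c']`. -/
noncomputable def mul {x y z : A.Obj} : HClass x y → HClass y z → HClass x z :=
  Quot.map₂ (fun p q => ⟨p.1.comp q.1, p.2.1.comp, p.2.2.comp q.2.2⟩)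
    (fun p _ _ h => Move.comp_left p.2.2 h) (fun _ _ q h => Move.comp_right h q.2.2)

theorem mk_mul_mk {x y z : A.Obj} {p q : RawPath A} (hp : p.IsProper) (hp' : p.IsPath x y)
    (hq : q.IsProper) (hq' : q.IsPath y z) :
    (mk p hp hp').mul (mk q hq hq') = mk (p.comp q) hp.comp (hp'.comp hq') := rfl

theorem mk_congr {x y : A.Obj} {p q : RawPath A} {hp hp' hq hq'} (hpq : p = q) :
    (mk p hp hp' : HClass x y) = mk q hq hq' := by
  subst hpq
  rfl

theorem sound {x y : A.Obj} {p q : RawPath A} {hp hp' hq hq'} (h : Move x y p q) :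
    (mk p hp hp' : HClass x y) = mk q hq hq' := Quot.sound h

theorem mul_assoc {x y z w : A.Obj} (a : HClass x y) (b : HClass y z) (c : HClass z w) :
    (a.mul b).mul c = a.mul (b.mul c) := by
  induction a using ind with | _ p hp hp'
  induction b using ind with | _ q hq hq'
  induction c using ind with | _ r hr hr'
  rw [mk_mul_mk, mk_mul_mk, mk_mul_mk, mk_mul_mk]
  exact mk_congr (RawPath.comp_assoc hp' hq' hr')

/-- The homotopy class of a path in `𝒢₀`. -/
noncomputable def ofPath {x y : A.Obj} (b : Path x y) : HClass x y :=
  mk (.cons (Arrow.refl x) b (.arrow (Arrow.refl y))) trivial (by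
    refine ⟨rfl, ?_, ?_, ?_⟩ <;> simp)

/-- The homotopy class of the `𝒢`-path `(b_y; id, g)`, where `b_y` is the constant path at the source
`y` of the arrow `g`. -/
noncomputable def ofArrow (g : A.Arrow) : HClass g.src g.tgt :=
  mk (.cons (Arrow.refl g.src) (.const I g.src) (.arrow g)) trivial (by
    refine ⟨rfl, ?_, ?_, ?_⟩ <;> simp)

/-- The homotopy class of the constant path. -/
noncomputable def one (x : A.Obj) : HClass x x := ofPath (Path.refl x)

end HClass

/-- Homotopy of `𝒢`-paths. -/
def Htp (x y : A.Obj) (p q : RawPath A) : Prop :=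
  ∃ (hp : p.IsProper) (hp' : p.IsPath x y) (hq : q.IsProper) (hq' : q.IsPath x y),
    HClass.mk p hp hp' = HClass.mk q hq hq'

namespace Htp

theorem of_eq {x y : A.Obj} {p q : RawPath A} (hp : p.IsProper) (hp' : p.IsPath x y) (h : p = q) :
    Htp x y p q := by
  subst h
  exact ⟨hp, hp', hp, hp', rfl⟩

theorem of_move {x y : A.Obj} {p q : RawPath A} (hp : p.IsProper) (h : Move x y p q) :
    Htp x y p q :=
  ⟨hp, h.isPath, h.isProper_iff.1 hp, h.isPath_right, Quot.sound h⟩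

theorem symm {x y : A.Obj} {p q : RawPath A} (h : Htp x y p q) : Htp x y q p := by
  obtain ⟨h1, h2, h3, h4, h⟩ := h
  exact ⟨h3, h4, h1, h2, h.symm⟩

theorem trans {x y : A.Obj} {p q r : RawPath A} (h : Htp x y p q) (h' : Htp x y q r) :
    Htp x y p r := by
  obtain ⟨h1, h2, h3, h4, h⟩ := h
  obtain ⟨h1', h2', h3', h4', h'⟩ := h'
  exact ⟨h1, h2, h3', h4', h.trans h'⟩

theorem cons {g : A.Arrow} {b : C(I, A.Obj)} {x y : A.Obj} {p q : RawPath A}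
    (h1 : g.src = x) (h2 : g.tgt = b 0) (h : Htp (b 1) y p q) :
    Htp x y (.cons g b p) (.cons g b q) := by
  obtain ⟨hp, hp', hq, hq', h⟩ := h
  have h4 : ∀ {r : RawPath A}, r.IsPath (b 1) y →
      (RawPath.cons g b (.arrow (Arrow.refl (b 1)))).comp r = .cons g b r := fun hr =>
    congrArg (RawPath.cons g b) (RawPath.preact_refl hr)
  have hc : (RawPath.cons g b (.arrow (Arrow.refl (b 1)))).IsPath x (b 1) :=
    ⟨h1, h2, rfl, Arrow.refl_tgt _⟩
  have h3 := congrArg (HClass.mul (HClass.mk (.cons g b (.arrow (Arrow.refl (b 1)))) trivial hc)) h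
  have h5 : Htp x y ((RawPath.cons g b (.arrow (Arrow.refl (b 1)))).comp p)
      ((RawPath.cons g b (.arrow (Arrow.refl (b 1)))).comp q) := ⟨trivial, hc.comp hp', trivial, hc.comp hq', h3⟩
  rwa [h4 hp', h4 hq'] at h5

/-- Two consecutive paths without an arrow between can be joined and then deformed. -/
theorem join {g : A.Arrow} {b b₁ b₂ b' : C(I, A.Obj)} {r : RawPath A} {x y : A.Obj} {z : A.Obj}
    (φ : C(I × I, I)) (h0 : ∀ s, φ (s, 0) = φ (0, 0)) (h1 : ∀ s, φ (s, 1) = φ (0, 1))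
    (e1 : ∀ t : I, b₁ t = b (φ (0, ⟨1 / 2, by norm_num, by norm_num⟩ * t)))
    (e2 : ∀ t : I, b₂ t = b (φ (0, σ (σ ⟨1 / 2, by norm_num, by norm_num⟩ * σ t))))
    (e' : ∀ t, b' t = b (φ (1, t))) (hz : z = b₁ 1) (hq' : (RawPath.cons g b' r).IsPath x y) :
    Htp x y (.cons g b₁ (.cons (Arrow.refl z) b₂ r)) (.cons g b' r) := by
  have ha : b₁ = leftPart (b.comp (φ.comp ⟨fun t => (0, t), by fun_prop⟩))
      ⟨1 / 2, by norm_num, by norm_num⟩ := ContinuousMap.ext e1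
  have hb : b₂ = rightPart (b.comp (φ.comp ⟨fun t => (0, t), by fun_prop⟩))
      ⟨1 / 2, by norm_num, by norm_num⟩ := ContinuousMap.ext e2
  have hc : b' = b.comp (φ.comp ⟨fun t => (1, t), by fun_prop⟩) := ContinuousMap.ext e'
  have hz' : z = b.comp (φ.comp ⟨fun t => (0, t), by fun_prop⟩) ⟨1 / 2, by norm_num, by norm_num⟩ := by
    rw [hz, e1, mul_one]
    rfl
  subst hc
  have h3 : ∀ s : I, (RawPath.cons g (b.comp (φ.comp ⟨fun t => (s, t), by fun_prop⟩)) r).IsPath x y :=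
    fun s => by
      refine ⟨hq'.1, ?_, ?_⟩
      · refine hq'.2.1.trans ?_
        change b (φ (1, 0)) = b (φ (s, 0))
        rw [h0, h0 s]
      · have h4 := hq'.2.2
        change r.IsPath (b (φ (1, 1))) y at h4
        change r.IsPath (b (φ (s, 1))) y
        rwa [h1 s, ← h1 1]
  have hM1 := Move.subdivide g (b.comp (φ.comp ⟨fun t => (0, t), by fun_prop⟩)) r
    ⟨1 / 2, by norm_num, by norm_num⟩ (by rw [← Subtype.coe_lt_coe]; norm_num)
    (by rw [← Subtype.coe_lt_coe]; norm_num) (h3 0)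
  rw [← ha, ← hb, ← hz'] at hM1
  have hM2 := Move.homotopy (x := x) (y := y)
    (fun s => RawPath.cons g (b.comp (φ.comp ⟨fun t => (s, t), by fun_prop⟩)) r)
    (.cons (fun _ => g) (fun s => b.comp (φ.comp ⟨fun t => (s, t), by fun_prop⟩)) (fun _ => r)
      continuous_const (b.continuous.comp φ.continuous) (.const r)) h3 (fun _ => rfl) (fun _ => rfl)
  exact (of_move RawPath.isProper_cons hM1).symm.trans (of_move RawPath.isProper_cons hM2)

theorem projIcc_eq {x : ℝ} {u : I} (h : x = u) : projIcc (0 : ℝ) 1 zero_le_one x = u := by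
  subst h
  exact projIcc_val _ _

theorem absorb_right {g : A.Arrow} {b : C(I, A.Obj)} {r : RawPath A} {x y z : A.Obj} (hz : z = b 0)
    (h : (RawPath.cons g b r).IsPath x y) :
    Htp x y (.cons g (.const I z) (.cons (Arrow.refl z) b r)) (.cons g b r) := by
  refine join (b := b) ⟨fun q => projIcc 0 1 zero_le_one
    ((1 - q.1) * max 0 (2 * q.2 - 1 : ℝ) + q.1 * q.2), by fun_prop⟩ ?_ ?_ ?_ ?_ ?_ rfl h
  · intro s
    simp
  · intro s
    simp only [ContinuousMap.coe_mk]
    congr 1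
    norm_num
  · intro t
    rw [ContinuousMap.const_apply, hz]
    congr 1
    refine (projIcc_eq ?_).symm
    have := t.2.2
    have h : (2 * (1 / 2 * (t : ℝ)) - 1) ≤ 0 := by linarith
    simp only [Icc.coe_zero, Icc.coe_mul, sub_zero, one_mul, zero_mul, add_zero]
    exact max_eq_left h
  · intro t
    congr 1
    refine (projIcc_eq ?_).symm
    have h : (2 * (1 - (1 - 1 / 2) * (1 - (t : ℝ))) - 1) = t := by ring
    simp only [Icc.coe_zero, Icc.coe_mul, sub_zero, one_mul, zero_mul, add_zero,
      unitInterval.coe_symm_eq]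
    rw [h]
    exact max_eq_right t.2.1
  · intro t
    congr 1
    refine (projIcc_eq ?_).symm
    simp

theorem absorb_left {g : A.Arrow} {b : C(I, A.Obj)} {r : RawPath A} {x y z : A.Obj} (hz : z = b 1)
    (h : (RawPath.cons g b r).IsPath x y) :
    Htp x y (.cons g b (.cons (Arrow.refl z) (.const I z) r)) (.cons g b r) := by
  refine join (b := b) ⟨fun q => projIcc 0 1 zero_le_one
    ((1 - q.1) * min 1 (2 * q.2 : ℝ) + q.1 * q.2), by fun_prop⟩ ?_ ?_ ?_ ?_ ?_ hz h
  · intro s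
    simp
  · intro s
    simp only [ContinuousMap.coe_mk]
    congr 1
    norm_num
  · intro t
    congr 1
    refine (projIcc_eq ?_).symm
    have h : (2 * (1 / 2 * (t : ℝ))) = t := by ring
    simp only [Icc.coe_zero, Icc.coe_mul, sub_zero, one_mul, zero_mul, add_zero]
    rw [h]
    exact min_eq_right t.2.2
  · intro t
    rw [ContinuousMap.const_apply, hz]
    congr 1
    refine (projIcc_eq ?_).symm
    have := t.2.1
    have h : 1 ≤ (2 * (1 - (1 - 1 / 2) * (1 - (t : ℝ)))) := by linarith
    simp only [Icc.coe_zero, Icc.coe_mul, sub_zero, one_mul, zero_mul, add_zero,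
      unitInterval.coe_symm_eq]
    exact min_eq_left h
  · intro t
    congr 1
    refine (projIcc_eq ?_).symm
    simp

theorem cancel {g : A.Arrow} {b : C(I, A.Obj)} {r : RawPath A} {x y z : A.Obj} (hz : z = b 1)
    (h : (RawPath.cons g (.const I (b 0)) r).IsPath x y) :
    Htp x y (.cons g b (.cons (Arrow.refl z) (b.comp ⟨σ, unitInterval.continuous_symm⟩) r))
      (.cons g (.const I (b 0)) r) := by
  refine join (b := b) ⟨fun q => projIcc 0 1 zero_le_one
    ((1 - q.1) * min (2 * q.2 : ℝ) (2 - 2 * q.2)), by fun_prop⟩ ?_ ?_ ?_ ?_ ?_ hz h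
  · intro s
    simp
  · intro s
    simp
  · intro t
    congr 1
    refine (projIcc_eq ?_).symm
    have := t.2.2
    have h : 2 * (1 / 2 * (t : ℝ)) ≤ 2 - 2 * (1 / 2 * (t : ℝ)) := by linarith
    simp only [Icc.coe_zero, Icc.coe_mul, sub_zero, one_mul]
    rw [min_eq_left h]
    ring
  · intro t
    change b (σ t) = _
    congr 1
    refine (projIcc_eq ?_).symm
    have := t.2.1
    have h : 2 - (2 * (1 - (1 - 1 / 2) * (1 - (t : ℝ)))) ≤ 2 * (1 - (1 - 1 / 2) * (1 - (t : ℝ))) := by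
      linarith
    simp only [Icc.coe_zero, Icc.coe_mul, sub_zero, one_mul, unitInterval.coe_symm_eq]
    rw [min_eq_right h]
    ring
  · intro t
    rw [ContinuousMap.const_apply]
    congr 1
    refine (projIcc_eq ?_).symm
    simp

/-- A constant first path can be removed. -/
theorem slide {g : A.Arrow} {q : RawPath A} {x y z : A.Obj} (hq : q.IsProper) (hz : q.IsPath z y)
    (h1 : g.src = x) (h2 : g.tgt = z) : Htp x y (.cons g (.const I z) q) (q.preact g) := by
  cases q with
  | arrow h => exact hq.elim
  | cons h b r =>
    have hzs := hz.1
    have hzb := hz.2.1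
    have hzr := hz.2.2
    obtain ⟨T, u, rfl⟩ := h.exists_germAt
    subst hzs
    have hM : Move x y (.cons g (.const I (T.s u)) (.cons (T.germAt u) b r))
        (.cons (g.comp (T.germAt u)) (.const I (T.t u))
          (.cons ((T.symm.germAt u).comp (T.germAt u)) b r)) :=
      Move.transform g (.cons (T.germAt u) b r) T (.const I u) ⟨h1, h2, hz⟩
    rw [T.symm_comp_germAt] at hM
    have htu : T.t u = b 0 := by rw [← hzb, T.germAt_tgt]
    have hsrc : (g.comp (T.germAt u)).src = x := by rw [Arrow.comp_src, h1]
    have htgt : (g.comp (T.germAt u)).tgt = b 0 := by rw [Arrow.comp_tgt h2, hzb]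
    exact (of_move RawPath.isProper_cons hM).trans (absorb_right htu ⟨hsrc, htgt, hzr⟩)

theorem mul_one_aux (p : RawPath A) {g : A.Arrow} {b : C(I, A.Obj)} {x y : A.Obj}
    (h : (RawPath.cons g b p).IsPath x y) :
    Htp x y (.cons g b (p.comp (.cons (Arrow.refl y) (.const I y) (.arrow (Arrow.refl y)))))
      (.cons g b p) := by
  induction p generalizing g b x with
  | arrow k =>
    have hk1 := h.2.2.1
    have hk2 := h.2.2.2
    obtain ⟨T, u, rfl⟩ := k.exists_germAt
    rw [T.germAt_tgt] at hk2
    rw [T.germAt_src] at hk1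
    subst hk2
    have hb1 : b 1 = T.s u := hk1.symm
    have e1 : (T.germAt u).comp (Arrow.refl (T.t u)) = T.germAt u := Arrow.comp_refl (T.germAt_tgt u)
    have hM : Move (b 1) (T.t u)
        (.cons (T.germAt u) (.const I (T.t u)) (.arrow (Arrow.refl (T.t u))))
        (.cons ((T.germAt u).comp (T.symm.germAt u)) (.const I (T.s u))
          (.arrow ((T.germAt u).comp (Arrow.refl (T.t u))))) := by
      rw [hb1]
      exact Move.transform (T.germAt u) (.arrow (Arrow.refl (T.t u))) T.symm (.const I u)
        ⟨rfl, T.germAt_tgt u, rfl, Arrow.refl_tgt _⟩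
    rw [T.germAt_comp_symm, e1] at hM
    change Htp x (T.t u) (.cons g b (.cons ((T.germAt u).comp (Arrow.refl (T.t u)))
      (.const I (T.t u)) (.arrow (Arrow.refl (T.t u))))) _
    rw [e1]
    exact (of_move RawPath.isProper_cons (Move.cons g b _ _ h.1 h.2.1 hM)).trans (absorb_left hk1 h)
  | cons g' b' r ih => exact Htp.cons h.1 h.2.1 (ih h.2.2)

theorem mul_inv_aux (r : RawPath A) {q : RawPath A} {x y z : A.Obj} (hr : r.IsPath x y)
    (hq : q.IsProper) (hq' : q.IsPath x z) : Htp x z (r.comp (r.inv.comp q)) q := by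
  induction r generalizing x q with
  | arrow g =>
    have h1 := hr.1
    subst h1
    have e : (q.preact g.inv).preact g = q := by
      rw [RawPath.preact_preact g.inv_src.symm g.inv_tgt hq', g.comp_inv, RawPath.preact_refl hq']
    change Htp g.src z ((q.preact g.inv).preact g) q
    rw [e]
    exact of_eq hq hq' rfl
  | cons g b r ih =>
    have h1 := hr.1
    subst h1
    have hbσ0 : (b.comp ⟨σ, unitInterval.continuous_symm⟩) 0 = b 1 := by simp
    have hbσ1 : (b.comp ⟨σ, unitInterval.continuous_symm⟩) 1 = b 0 := by simp
    have hg' : g.inv.src = b 0 := by rw [g.inv_src, hr.2.1]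
    have hqi : (q.preact g.inv).IsPath (b 0) z := hq'.preact hg' g.inv_tgt
    have hq'p : (RawPath.cons (Arrow.refl (b 1)) (b.comp ⟨σ, unitInterval.continuous_symm⟩)
        (q.preact g.inv)).IsPath (b 1) z :=
      ⟨rfl, (Arrow.refl_tgt _).trans hbσ0.symm, by rw [hbσ1]; exact hqi⟩
    have e1 : (RawPath.cons g b r).comp ((RawPath.cons g b r).inv.comp q) =
        .cons g b (r.comp (r.inv.comp (.cons (Arrow.refl (b 1))
          (b.comp ⟨σ, unitInterval.continuous_symm⟩) (q.preact g.inv)))) := by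
      refine congrArg (fun s => RawPath.cons g b (r.comp s)) ?_
      exact RawPath.comp_assoc (y := b 1) (hr.2.2.inv) (z := g.src)
        ⟨rfl, (Arrow.refl_tgt _).trans hbσ0.symm, by rw [hbσ1]; exact ⟨hg', g.inv_tgt⟩⟩ hq'
    have e2 : (q.preact g.inv).preact g = q := by
      rw [RawPath.preact_preact g.inv_src.symm g.inv_tgt hq', g.comp_inv, RawPath.preact_refl hq']
    rw [e1]
    have h3 := slide hq.preact hqi rfl hr.2.1
    rw [e2] at h3
    exact (Htp.cons rfl hr.2.1 (ih hr.2.2 RawPath.isProper_cons hq'p)).trans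
      ((cancel rfl ⟨rfl, hr.2.1, hqi⟩).trans h3)

end Htp

namespace HClass

theorem one_mul {x y : A.Obj} (c : HClass x y) : (one x).mul c = c := by
  induction c using ind with | _ p hp hp'
  have h1 := Htp.slide (x := x) hp hp' rfl (Arrow.refl_tgt x)
  rw [RawPath.preact_refl hp'] at h1
  have h2 : (RawPath.cons (Arrow.refl x) (.const I x) (.arrow (Arrow.refl x))).comp p =
      .cons (Arrow.refl x) (.const I x) p :=
    congrArg (RawPath.cons _ _) (RawPath.preact_refl hp')
  rw [← h2] at h1
  obtain ⟨_, _, _, _, h⟩ := h1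
  exact h

theorem mul_one {x y : A.Obj} (c : HClass x y) : c.mul (one y) = c := by
  induction c using ind with | _ p hp hp'
  cases p with
  | arrow k => exact hp.elim
  | cons g b r =>
    obtain ⟨_, _, _, _, h⟩ := Htp.mul_one_aux r hp'
    exact h

theorem mk_mul_inv {x y : A.Obj} (p : RawPath A) (hp hp') :
    (mk p hp hp' : HClass x y).mul (mk p.inv hp.inv hp'.inv) = one x := by
  rw [← mul_one (mul _ _), mul_assoc]
  have h1 : (RawPath.cons (Arrow.refl x) (.const I x) (.arrow (Arrow.refl x))).IsPath x x := by
    refine ⟨rfl, ?_, ?_, ?_⟩ <;> simp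
  obtain ⟨_, _, _, _, h⟩ := Htp.mul_inv_aux p hp' RawPath.isProper_cons h1
  exact h

/-- The inverse of a homotopy class, represented by the inverse `𝒢`-path of a representative. -/
noncomputable def inv {x y : A.Obj} (c : HClass x y) : HClass y x :=
  mk c.out.1.inv c.out.2.1.inv c.out.2.2.inv

theorem mul_inv {x y : A.Obj} (c : HClass x y) : c.mul c.inv = one x := by
  conv_lhs => arg 1; rw [show c = mk c.out.1 c.out.2.1 c.out.2.2 from (Quot.out_eq c).symm]
  exact mk_mul_inv _ _ _

theorem inv_mul {x y : A.Obj} (c : HClass x y) : c.inv.mul c = one y := by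
  have h4 := c.inv.mul_inv
  have h5 : c = c.inv.inv := by
    calc c = c.mul (c.inv.mul c.inv.inv) := by rw [h4, mul_one]
      _ = c.inv.inv := by rw [← mul_assoc, mul_inv, one_mul]
  rwa [← h5] at h4

/-- The homotopy class of an inverse `𝒢`-path is the inverse. -/
theorem inv_mk {x y : A.Obj} (p : RawPath A) (hp hp') :
    (mk p hp hp' : HClass x y).inv = mk p.inv hp.inv hp'.inv := by
  rw [← mul_one (inv _), ← mk_mul_inv p hp hp', ← mul_assoc, inv_mul, one_mul]

end HClass

/-! ### The orbifold fundamental group and the universal covering space -/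

/-- The orbifold fundamental group `π₁^orb(Z, x₀)`: homotopy classes of `𝒢`-loops based at `x₀`, with
the composition of `𝒢`-paths. -/
def Pi1 (A : OrbifoldAtlas m Z) (x₀ : A.Obj) : Type u := HClass x₀ x₀

noncomputable instance (x₀ : A.Obj) : Group (A.Pi1 x₀) :=
  letI : Mul (A.Pi1 x₀) := ⟨HClass.mul⟩
  letI : Inv (A.Pi1 x₀) := ⟨HClass.inv⟩
  letI : One (A.Pi1 x₀) := ⟨HClass.one x₀⟩
  Group.ofRightAxioms HClass.mul_assoc HClass.mul_one HClass.mul_inv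

theorem Pi1.mul_def {x₀ : A.Obj} (a b : A.Pi1 x₀) : a * b = HClass.mul a b := rfl

theorem Pi1.one_def {x₀ : A.Obj} : (1 : A.Pi1 x₀) = HClass.one x₀ := rfl

/-- The set `𝒢̂₀` of homotopy classes of `𝒢`-paths starting at `x₀`. -/
structure PathSpace (A : OrbifoldAtlas m Z) (x₀ : A.Obj) : Type u where
  /-- the ending point -/
  pt : A.Obj
  /-- the homotopy class -/
  cls : HClass x₀ pt

instance OrbifoldChart.pathConnectedSpace (C : OrbifoldChart m Z) : PathConnectedSpace C.dom :=
  isPathConnected_iff_pathConnectedSpace.1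
    (C.dom.isOpen.isConnected_iff_isPathConnected.1 C.dom_connected)

/-- A path in a chart, as a path in `𝒢₀`. -/
def chartPath (C : A.charts) {u v : C.1.dom} (b : Path u v) :
    Path (⟨C, u⟩ : A.Obj) (⟨C, v⟩ : A.Obj) where
  toFun t := ⟨C, b t⟩
  continuous_toFun := (IsOpenEmbedding.sigmaMk (i := C)).continuous.comp b.continuous
  source' := congrArg _ b.source
  target' := congrArg _ b.target

/-- The sheet of `𝒢̂₀` through `[c]`, where `c` ends at the point `u` of the chart `C`: the point `v` of
the chart is sent to `[c] [b]`, where `b` is a path from `u` to `v` in the chart.  When the chart is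
simply connected, this does not depend on the choice of `b`. -/
noncomputable def sheet {x₀ : A.Obj} {C : A.charts} {u : C.1.dom}
    (c : HClass x₀ (⟨C, u⟩ : A.Obj)) (v : C.1.dom) : A.PathSpace x₀ :=
  ⟨⟨C, v⟩, c.mul (HClass.ofPath (chartPath C (PathConnectedSpace.somePath u v)))⟩

/-- The topology of `𝒢̂₀`: each of the sheets, which are in bijection with a chart, carries the topology
of the chart, and `𝒢̂₀` is the disjoint union of the sheets.  That is, a set is open if and only if its
inverse image under each of the maps `sheet c` is open. -/
noncomputable instance (x₀ : A.Obj) : TopologicalSpace (A.PathSpace x₀) :=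
  ⨆ (C : A.charts) (u : C.1.dom) (c : HClass x₀ (⟨C, u⟩ : A.Obj)),
    .coinduced (sheet c) inferInstance

/-- Two elements of `𝒢̂₀` are in the same orbit of the groupoid `𝒢̂` if they are `[c]` and `[c] [c_{y,g}]`
for an arrow `g` of `𝒢` whose source `y` is the ending point of `c`. -/
inductive OrbitRel (x₀ : A.Obj) : A.PathSpace x₀ → A.PathSpace x₀ → Prop
  | intro (g : A.Arrow) (c : HClass x₀ g.src) :
      OrbitRel x₀ ⟨g.src, c⟩ ⟨g.tgt, c.mul (HClass.ofArrow g)⟩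

/-- The orbit space `X` of the groupoid `𝒢̂`. -/
def UnivCover (A : OrbifoldAtlas m Z) (x₀ : A.Obj) : Type u := Quot (OrbitRel (A := A) x₀)

/-- `X` carries the quotient topology. -/
noncomputable instance (x₀ : A.Obj) : TopologicalSpace (A.UnivCover x₀) :=
  inferInstanceAs (TopologicalSpace (Quot (OrbitRel x₀)))

/-- The quotient map `𝒢̂₀ → X`. -/
noncomputable def UnivCover.mk {x₀ : A.Obj} (c : A.PathSpace x₀) : A.UnivCover x₀ := Quot.mk _ c

/-- The orbifold fundamental group acts on `𝒢̂₀` by composition at the starting point. -/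
noncomputable instance (x₀ : A.Obj) : MulAction (A.Pi1 x₀) (A.PathSpace x₀) where
  smul γ c := ⟨c.pt, HClass.mul γ c.cls⟩
  one_smul c := congrArg (PathSpace.mk c.pt) (HClass.one_mul c.cls)
  mul_smul γ γ' c := congrArg (PathSpace.mk c.pt) (HClass.mul_assoc γ γ' c.cls)

theorem OrbitRel.smul {x₀ : A.Obj} {c c' : A.PathSpace x₀} (h : OrbitRel x₀ c c') (γ : A.Pi1 x₀) :
    OrbitRel x₀ (γ • c) (γ • c') := by
  cases h with
  | intro g c =>
    have h1 : ∀ d, (HClass.mul γ c).mul (HClass.ofArrow g) = d →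
        OrbitRel x₀ ⟨g.src, HClass.mul γ c⟩ ⟨g.tgt, d⟩ := by
      rintro d rfl
      exact .intro g _
    exact h1 _ (HClass.mul_assoc γ c (HClass.ofArrow g))

/-- The action of the orbifold fundamental group on `X`, induced by the one on `𝒢̂₀`. -/
noncomputable instance (x₀ : A.Obj) : MulAction (A.Pi1 x₀) (A.UnivCover x₀) where
  smul γ := Quot.map (γ • ·) fun _ _ h => h.smul γ
  one_smul := by
    rintro ⟨c⟩
    exact congrArg UnivCover.mk (one_smul (A.Pi1 x₀) c)
  mul_smul γ γ' := by
    rintro ⟨c⟩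
    exact congrArg UnivCover.mk (mul_smul γ γ' c)

/-- The projection `p : X → Z`, which sends the orbit of `[c]` to the image in `Z` of the ending point
of `c`. -/
def UnivCover.proj {x₀ : A.Obj} : A.UnivCover x₀ → Z :=
  Quot.lift (fun c => c.pt.1.1.proj c.pt.2) fun _ _ h => by
    cases h with
    | intro g c => exact g.proj_tgt.symm

/-- The quotient `Γ \ X`, with its quotient topology. -/
noncomputable abbrev DeckQuotient (A : OrbifoldAtlas m Z) (x₀ : A.Obj) : Type u :=
  MulAction.orbitRel.Quotient (A.Pi1 x₀) (A.UnivCover x₀)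

/-- The quotient map `X → Γ \ X`. -/
noncomputable def DeckQuotient.mk {x₀ : A.Obj} (x : A.UnivCover x₀) : A.DeckQuotient x₀ := Quotient.mk _ x

/-- The map `Γ \ X → Z` induced by `p`. -/
noncomputable def DeckQuotient.proj {x₀ : A.Obj} : A.DeckQuotient x₀ → Z :=
  Quotient.lift UnivCover.proj fun x y h => by
    obtain ⟨γ, rfl⟩ := h
    rcases y with ⟨c⟩
    rfl

/-- The canonical orbifold structure on `X`: the restrictions of the quotient map `𝒢̂₀ → X` to the
sheets of `𝒢̂₀`, each identified with a chart of `Z`, are charts.  As these cover `X`, they determine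
the orbifold structure. -/
def IsCanonicalAtlas {x₀ : A.Obj} (B : OrbifoldAtlas m (A.UnivCover x₀)) : Prop :=
  ∀ (C : A.charts) (u : C.1.dom) (c : HClass x₀ (⟨C, u⟩ : A.Obj)),
    ∃ D ∈ B.charts, D.dom = C.1.dom ∧
      ∀ v (h : v ∈ D.dom) (h' : v ∈ C.1.dom), D.proj ⟨v, h⟩ = UnivCover.mk (sheet c ⟨v, h'⟩)

end OrbifoldAtlas

end Orbi

/-! Rigidity of charts underlies everything. A map of finite order whose derivative at a fixed point
is the identity is the identity nearby, so an element of a chart group is determined by its value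
and derivative at one point. Hence two embeddings over `Z` of a connected open set into a chart
differ by an element of its group (`OrbifoldChart.exists_eq_of_proj_eq`), arrows between points of
one chart are germs of group elements (`Arrow.exists_deck`), and points with trivial stabilizer are
dense (`OrbifoldChart.exists_regular`).

Since the charts are simply connected, the class of a path inside a chart depends only on its ends,
and the germ of a coordinate transformation can be slid along its domain
(`HClass.inChart_mul_germAt`). Two sheets with a common point in `X` therefore agree locally up to a
coordinate transformation, and over the same chart they differ by a group element. So each sheet map
is open, and it is a chart whose group consists of the elements of `G` that preserve it. Points of
`X` are separated in `Z` or inside a small chart neighbourhood, and second countability holds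
because there are only countably many sheets.

A sheet map determines the class defining it (`sheetMap_injective`). This makes the action of `Γ`
effective and, as `G` is finite, properly discontinuous. The group `Γ` is transitive on the fibres
of the open map `p`, so `Γ \ X` is homeomorphic to `Z` and receives its orbifold structure. The
images of the sheets over one chart are equal or disjoint, so they are the components of the
preimage, and `p` is a covering.

For the universal property, an étale lift along an orbifold covering `q : Y → Z` is determined by
its germ, though not by one value (`IsOrbCovering.lift_unique`). The germs of lifts of a chart form
a covering space of it, so over a simply connected chart each germ extends
(`IsOrbCovering.exists_lift_of_germ`). Arrows carry lifts of the source chart to lifts of the target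
chart, while paths within a chart leave them unchanged. This transport is invariant under homotopy
(`ChartLift.PathRel.of_move`). Evaluating the lift transported along `c` at the end point of `c`
defines a map `X → Y` which is étale on the sheets, hence a covering (`isOrbCovering_of_etale`). -/

namespace Orbi

/-! ### Rigidity of finite group actions and of embeddings of charts -/

/-- A self-map of finite order near a fixed point at which its derivative is the identity is the
identity near this point. -/
theorem eventually_eq_id_of_iterate {E : Type*} [NormedAddCommGroup E] [NormedSpace ℝ E]
    {k : E → E} {p : E} (hk : HasStrictFDerivAt k (ContinuousLinearMap.id ℝ E) p) (hp : k p = p)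
    {n : ℕ} (hn : 0 < n) (hkn : ∀ᶠ x in 𝓝 p, k^[n] x = x) : ∀ᶠ x in 𝓝 p, k x = x := by
  have h1 : ∀ j, HasStrictFDerivAt k^[j] (ContinuousLinearMap.id ℝ E) p := fun j => by
    have h := hk.iterate hp j
    rwa [← ContinuousLinearMap.one_def, one_pow, ContinuousLinearMap.one_def] at h
  -- The sum of the iterates has derivative `n • id` at `p` and takes the same value at `k x` and
  -- `x` when `k^[n] x = x`. Strict differentiability at the pair `(k x, x)` gives `n * ‖k x - x‖ ≤
  -- 1/2 * ‖k x - x‖`, so `k x = x`; any positive constant below `1` would do.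
  have h2 : HasStrictFDerivAt (fun x => ∑ j ∈ Finset.range n, k^[j] x)
      (∑ j ∈ Finset.range n, ContinuousLinearMap.id ℝ E) p :=
    HasStrictFDerivAt.fun_sum fun j _ => h1 j
  have h3 := h2.isLittleO.def (c := 1 / 2) (by norm_num)
  have h4 : Tendsto (fun x => (k x, x)) (𝓝 p) (𝓝 (p, p)) := by
    have : Tendsto k (𝓝 p) (𝓝 p) := by
      have := hk.continuousAt.tendsto
      rwa [hp] at this
    exact this.prodMk_nhds tendsto_id
  filter_upwards [h4.eventually h3, hkn] with x hx hxn
  have e : ∑ j ∈ Finset.range n, k^[j] (k x) = ∑ j ∈ Finset.range n, k^[j] x := by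
    have := Finset.sum_range_succ' (fun j => k^[j] x) n
    rw [Finset.sum_range_succ, hxn] at this
    simpa using this.symm
  rw [e, sub_self, zero_sub, norm_neg] at hx
  rw [Finset.sum_const, Finset.card_range, ← Nat.cast_smul_eq_nsmul ℝ,
    smul_apply, ContinuousLinearMap.id_apply, norm_smul, Real.norm_natCast] at hx
  have hn' : (1 : ℝ) ≤ n := by exact_mod_cast hn
  have h5 := norm_nonneg (k x - x)
  have h6 : ‖k x - x‖ = 0 := by nlinarith
  exact sub_eq_zero.1 (norm_eq_zero.1 h6)

variable {m : ℕ}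

open Classical in
/-- The extension by zero of a map between open subsets of `ℝ^m`. -/
noncomputable def zeroExt {U V : Opens (Euc m)} (f : U → V) : Euc m → Euc m :=
  fun x => if h : x ∈ U then f ⟨x, h⟩ else 0

theorem zeroExt_coe {U V : Opens (Euc m)} (f : U → V) (x : U) : zeroExt f x = f x :=
  dif_pos x.2

theorem SmoothMap.contDiffAt {U V : Opens (Euc m)} {f : U → V} (hf : SmoothMap f) (x : U) :
    ContDiffAt ℝ ∞ (zeroExt f) (x : Euc m) := by
  rw [← contMDiffAt_iff_contDiffAt, ← contMDiffAt_subtype_iff]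
  refine ((contMDiff_subtype_val (U := V)).comp hf).contMDiffAt.congr_of_eventuallyEq ?_
  exact Eventually.of_forall fun y => zeroExt_coe f y

theorem zeroExt_comp {U V W : Opens (Euc m)} (g : V → W) (f : U → V) (x : U) :
    zeroExt (g ∘ f) =ᶠ[𝓝 (x : Euc m)] zeroExt g ∘ zeroExt f := by
  filter_upwards [U.isOpen.mem_nhds x.2] with y hy
  rw [Function.comp_apply, zeroExt_coe f ⟨y, hy⟩, zeroExt_coe, zeroExt_coe _ ⟨y, hy⟩]
  rfl

theorem fderiv_zeroExt_comp {U V W : Opens (Euc m)} {g : V → W} {f : U → V} (hg : SmoothMap g)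
    (hf : SmoothMap f) (x : U) : fderiv ℝ (zeroExt (g ∘ f)) (x : Euc m) =
      (fderiv ℝ (zeroExt g) (f x : Euc m)).comp (fderiv ℝ (zeroExt f) (x : Euc m)) := by
  rw [(zeroExt_comp g f x).fderiv_eq]
  have h1 := (hg.contDiffAt (f x)).differentiableAt (by simp)
  rw [← zeroExt_coe f x] at h1 ⊢
  exact fderiv_comp _ h1 ((hf.contDiffAt x).differentiableAt (by simp))

theorem fderiv_zeroExt_id {U : Opens (Euc m)} (x : U) :
    fderiv ℝ (zeroExt (fun y : U => y)) (x : Euc m) = ContinuousLinearMap.id ℝ (Euc m) := by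
  have : zeroExt (fun y : U => y) =ᶠ[𝓝 (x : Euc m)] id := by
    filter_upwards [U.isOpen.mem_nhds x.2] with y hy
    exact zeroExt_coe _ ⟨y, hy⟩
  rw [this.fderiv_eq, fderiv_id]

/-- Two smooth maps which agree on an open set have the same derivative at the points of its
closure. -/
theorem fderiv_zeroExt_eq {U V V' : Opens (Euc m)} {f : U → V} {f' : U → V'} (hf : SmoothMap f)
    (hf' : SmoothMap f') {x : U}
    (hx : x ∈ closure (interior {y | (f y : Euc m) = f' y})) :
    fderiv ℝ (zeroExt f) (x : Euc m) = fderiv ℝ (zeroExt f') (x : Euc m) := by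
  have hc : ∀ {V : Opens (Euc m)} {f : U → V}, SmoothMap f →
      Continuous fun y : U => fderiv ℝ (zeroExt f) (y : Euc m) := fun {V f} hf =>
    continuous_iff_continuousAt.2 fun y =>
      (((hf.contDiffAt y).fderiv_right (m := 0) (by simp)).continuousAt).comp
        continuous_subtype_val.continuousAt
  refine closure_minimal (s := interior {y | (f y : Euc m) = f' y})
    (t := {y : U | fderiv ℝ (zeroExt f) (y : Euc m) = fderiv ℝ (zeroExt f') (y : Euc m)})
    (fun y hy => ?_) (isClosed_eq (hc hf) (hc hf')) hx
  refine Filter.EventuallyEq.fderiv_eq ?_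
  have h1 := U.isOpen.isOpenEmbedding_subtypeVal.map_nhds_eq y
  rw [EventuallyEq, ← h1, eventually_map]
  filter_upwards [mem_interior_iff_mem_nhds.1 hy] with z hz
  rw [zeroExt_coe, zeroExt_coe]
  exact hz

theorem OrbifoldChart.smooth_emb {Z : Type u} [TopologicalSpace Z] (C : OrbifoldChart m Z)
    {g : Equiv.Perm C.dom} (hg : g ∈ C.G) : IsSmoothEmb g :=
  ⟨g.injective, (Diffeomorph.mk g (C.G_smooth g hg)
    (C.G_smooth g⁻¹ (C.G.inv_mem hg))).isLocalDiffeomorph⟩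

namespace OrbifoldChart

variable {Z : Type u} [TopologicalSpace Z] (C : OrbifoldChart m Z)

instance : PreconnectedSpace C.dom :=
  isPreconnected_iff_preconnectedSpace.1 C.dom_connected.isPreconnected

instance : Nonempty C.dom := C.dom_connected.nonempty.to_subtype

theorem proj_apply {g : Equiv.Perm C.dom} (hg : g ∈ C.G) (x : C.dom) : C.proj (g x) = C.proj x :=
  ((C.proj_eq_iff _ _).2 ⟨g, hg, rfl⟩).symm

/-- An element of the group of a chart is determined by its value and derivative at a point. -/
theorem eq_one_of_fderiv {g : Equiv.Perm C.dom} (hg : g ∈ C.G) {p : C.dom} (hp : g p = p)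
    (hd : fderiv ℝ (zeroExt g) (p : Euc m) = ContinuousLinearMap.id ℝ (Euc m)) : g = 1 := by
  have := C.G_finite
  have key : ∀ q : C.dom, g q = q →
      fderiv ℝ (zeroExt g) (q : Euc m) = ContinuousLinearMap.id ℝ (Euc m) → ∀ᶠ x in 𝓝 q, g x = x := by
    intro q hq hd
    have hs : HasStrictFDerivAt (zeroExt g) (ContinuousLinearMap.id ℝ (Euc m)) (q : Euc m) := by
      rw [← hd]
      exact ((C.G_smooth g hg).contDiffAt q).hasStrictFDerivAt (by simp)
    have hfin : IsOfFinOrder (⟨g, hg⟩ : C.G) := isOfFinOrder_of_finite _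
    have hpow : g ^ orderOf (⟨g, hg⟩ : C.G) = 1 :=
      congrArg Subtype.val (pow_orderOf_eq_one (⟨g, hg⟩ : C.G))
    have hit : ∀ n (x : C.dom), (zeroExt g)^[n] (x : Euc m) = (g ^ n) x := by
      intro n
      induction n with
      | zero => exact fun x => rfl
      | succ n ih =>
        intro x
        rw [Function.iterate_succ_apply, zeroExt_coe, ih, pow_succ, Equiv.Perm.mul_apply]
    have h1 := eventually_eq_id_of_iterate hs (by rw [zeroExt_coe, hq]) hfin.orderOf_pos (by
      filter_upwards [C.dom.isOpen.mem_nhds q.2] with x hx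
      rw [hit _ ⟨x, hx⟩, hpow]
      rfl)
    have h2 := C.dom.isOpen.isOpenEmbedding_subtypeVal.map_nhds_eq q
    rw [← h2, eventually_map] at h1
    filter_upwards [h1] with x hx
    exact Subtype.ext ((zeroExt_coe g x).symm.trans hx)
  -- The interior of the fixed set is also closed: at its limit points `g` still fixes the point
  -- with identity derivative, and by `key` such a point is interior.
  have hcl : IsClosed (interior {x : C.dom | g x = x}) := by
    refine isClosed_of_closure_subset fun q hq => ?_
    have hq' : q ∈ closure (interior {y : C.dom | (g y : Euc m) = y}) := by
      simpa only [Subtype.ext_iff] using hq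
    have hgq : g q = q := by
      have hc : IsClosed {x : C.dom | g x = x} :=
        isClosed_eq (C.G_smooth g hg).continuous continuous_id
      exact hc.closure_subset_iff.2 interior_subset hq
    have h1 := fderiv_zeroExt_eq (f' := fun y : C.dom => y) (C.G_smooth g hg)
      IsSmoothEmb.id.localDiffeo.contMDiff hq'
    rw [fderiv_zeroExt_id] at h1
    exact mem_interior_iff_mem_nhds.2 (key q hgq h1)
  have huniv := IsClopen.eq_univ ⟨hcl, isOpen_interior⟩
    ⟨p, mem_interior_iff_mem_nhds.2 (key p hp hd)⟩
  refine Equiv.ext fun x => ?_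
  have : x ∈ interior {x : C.dom | g x = x} := huniv ▸ mem_univ x
  exact (interior_subset this : x ∈ {x : C.dom | g x = x})

/-- Two elements of the group of a chart which agree on a nonempty open set are equal. -/
theorem eq_of_eventuallyEq {g g' : Equiv.Perm C.dom} (hg : g ∈ C.G) (hg' : g' ∈ C.G) {p : C.dom}
    (h : ∀ᶠ x in 𝓝 p, g x = g' x) : g = g' := by
  have h1 : g⁻¹ * g' = 1 := by
    have h2 : ∀ᶠ x in 𝓝 p, (g⁻¹ * g') x = x := by
      filter_upwards [h] with x hx
      rw [Equiv.Perm.mul_apply, ← hx]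
      exact g.symm_apply_apply x
    refine C.eq_one_of_fderiv (C.G.mul_mem (C.G.inv_mem hg) hg') h2.self_of_nhds ?_
    rw [← fderiv_zeroExt_id p]
    refine fderiv_zeroExt_eq (C.G_smooth _ (C.G.mul_mem (C.G.inv_mem hg) hg'))
      IsSmoothEmb.id.localDiffeo.contMDiff (subset_closure (mem_interior_iff_mem_nhds.2 ?_))
    filter_upwards [h2] with x hx
    exact congrArg Subtype.val hx
  exact (inv_mul_eq_one.1 h1)

instance opens_baire (U : Opens (Euc m)) : BaireSpace U :=
  have : LocallyCompactSpace U := U.isOpen.locallyCompactSpace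
  inferInstance

/-- The points with trivial stabilizer are dense. -/
theorem exists_regular {W : Set C.dom} (hW : IsOpen W) (hne : W.Nonempty) :
    ∃ x ∈ W, ∀ g ∈ C.G, g x = x → g = 1 := by
  have := C.G_finite
  -- A nontrivial element fixes no nonempty open set pointwise, so each of these finitely many sets
  -- is open and dense.
  have hd : Dense (⋂ g : C.G, {x : C.dom | g.1 x = x → g.1 = 1}) := by
    refine dense_iInter_of_isOpen (fun g => ?_) (fun g => ?_)
    · by_cases h : g.1 = 1
      · simp [h]
      · simp only [h, imp_false]
        exact (isClosed_eq (C.G_smooth g.1 g.2).continuous continuous_id).isOpen_compl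
    · by_cases h : g.1 = 1
      · simp [h]
      · simp only [h, imp_false]
        refine interior_eq_empty_iff_dense_compl.1 ?_
        rw [eq_empty_iff_forall_notMem]
        intro p hp
        exact h (C.eq_of_eventuallyEq g.2 C.G.one_mem (mem_interior_iff_mem_nhds.1 hp))
  obtain ⟨x, hx, hx'⟩ := hd.inter_open_nonempty W hW hne
  exact ⟨x, hx, fun g hg => mem_iInter.1 hx' ⟨g, hg⟩⟩

/-- The finitely many closed sets `F g` on which `θ` agrees with `g ∘ e` cover `U`, so the union of
their interiors is dense. At a common point of the closures of two of these interiors the group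
elements share value and derivative (`e` is an inclusion and does not affect derivatives), hence
coincide. The closures are thus disjoint, finite in number and cover `U`, so each is clopen and one
of them is everything. -/
theorem exists_eq_of_inclusion {U : Opens (Euc m)} [PreconnectedSpace U] [Nonempty U]
    {e θ : U → C.dom} (he : ∀ x, (e x : Euc m) = x) (hes : IsSmoothEmb e) (hθ : SmoothMap θ)
    (h : ∀ x, C.proj (θ x) = C.proj (e x)) :
    ∃ g ∈ C.G, ∀ x, θ x = g (e x) := by
  have := C.G_finite
  set F : C.G → Set U := fun g => {x | g.1 (e x) = θ x} with hF
  have hFc : ∀ g, IsClosed (F g) := fun g =>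
    isClosed_eq ((C.G_smooth g.1 g.2).continuous.comp hes.continuous) hθ.continuous
  have hFu : ⋃ g, F g = univ := eq_univ_of_forall fun x => by
    obtain ⟨g, hg, hgx⟩ := (C.proj_eq_iff _ _).1 (h x).symm
    exact mem_iUnion.2 ⟨⟨g, hg⟩, hgx⟩
  have hdense : Dense (⋃ g, interior (F g)) := dense_iUnion_interior_of_closed hFc hFu
  have hsm : ∀ g : C.G, SmoothMap (g.1 ∘ e) := fun g =>
    (C.G_smooth g.1 g.2).comp hes.localDiffeo.contMDiff
  have huniq : ∀ p g g', p ∈ closure (interior (F g)) → p ∈ closure (interior (F g')) → g = g' := by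
    intro p g g' hg hg'
    have hval : ∀ k, p ∈ closure (interior (F k)) → k.1 (e p) = θ p := fun k hk =>
      (hFc k).closure_subset_iff.2 interior_subset hk
    have hder : ∀ k, p ∈ closure (interior (F k)) →
        fderiv ℝ (zeroExt (k.1 ∘ e)) (p : Euc m) = fderiv ℝ (zeroExt θ) (p : Euc m) := by
      intro k hk
      refine fderiv_zeroExt_eq (hsm k) hθ ?_
      simpa only [hF, Subtype.ext_iff, Function.comp_apply] using hk
    have hder' := (hder g hg).trans (hder g' hg').symm
    have hkG : g.1⁻¹ * g'.1 ∈ C.G := C.G.mul_mem (C.G.inv_mem g.2) g'.2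
    have hfix : (g.1⁻¹ * g'.1) (e p) = e p := by
      rw [Equiv.Perm.mul_apply, Equiv.Perm.inv_eq_iff_eq, hval g hg, hval g' hg']
    have hd1 : fderiv ℝ (zeroExt e) (p : Euc m) = ContinuousLinearMap.id ℝ (Euc m) := by
      have : zeroExt e =ᶠ[𝓝 (p : Euc m)] id := by
        filter_upwards [U.isOpen.mem_nhds p.2] with y hy
        rw [zeroExt_coe e ⟨y, hy⟩, he]
        rfl
      rw [this.fderiv_eq, fderiv_id]
    have hgd : ∀ k : C.G, fderiv ℝ (zeroExt (k.1 ∘ e)) (p : Euc m) =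
        fderiv ℝ (zeroExt k.1) (e p : Euc m) := by
      intro k
      rw [fderiv_zeroExt_comp (C.G_smooth _ k.2) hes.localDiffeo.contMDiff, hd1,
        ContinuousLinearMap.comp_id]
    rw [hgd, hgd] at hder'
    have h1 : g.1⁻¹ * g'.1 = 1 := by
      refine C.eq_one_of_fderiv hkG hfix ?_
      have e1 : ((g.1⁻¹ * g'.1 : Equiv.Perm C.dom) : C.dom → C.dom) = (g.1⁻¹ : Equiv.Perm C.dom) ∘ g'.1 := rfl
      have e2 : ((g.1⁻¹ : Equiv.Perm C.dom) ∘ g.1 : C.dom → C.dom) = fun x => x :=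
        funext fun x => g.1.symm_apply_apply x
      have hgi := C.G_smooth _ (C.G.inv_mem g.2)
      rw [e1, fderiv_zeroExt_comp hgi (C.G_smooth _ g'.2), ← hder', hval g' hg', ← hval g hg,
        ← fderiv_zeroExt_comp hgi (C.G_smooth _ g.2), e2, fderiv_zeroExt_id]
    exact Subtype.ext (inv_mul_eq_one.1 h1)
  have hcl : ⋃ g, closure (interior (F g)) = univ := by
    rw [← closure_iUnion_of_finite, hdense.closure_eq]
  have hint : ∀ p g, p ∈ closure (interior (F g)) → p ∈ interior (F g) := by
    intro p g hp
    set N : Set U := ⋂ k : {k // k ≠ g}, (closure (interior (F k)))ᶜ with hN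
    have hNo : IsOpen N := isOpen_iInter_of_finite fun k => isClosed_closure.isOpen_compl
    have hpN : p ∈ N := mem_iInter.2 fun k hk => k.2 (huniq p _ _ hk hp)
    refine mem_interior.2 ⟨N, fun x hx => ?_, hNo, hpN⟩
    have hx' : x ∈ ⋃ g, closure (interior (F g)) := hcl ▸ mem_univ x
    obtain ⟨k, hk⟩ := mem_iUnion.1 hx'
    have hkg : k = g := by
      by_contra hne
      exact mem_iInter.1 hx ⟨k, hne⟩ hk
    subst hkg
    exact (hFc k).closure_subset_iff.2 interior_subset hk
  obtain ⟨p⟩ := ‹Nonempty U›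
  obtain ⟨g, hg⟩ := mem_iUnion.1 (hcl ▸ mem_univ p : p ∈ ⋃ g, closure (interior (F g)))
  have hclopen : IsClopen (interior (F g)) :=
    ⟨isClosed_of_closure_subset fun q hq => hint q g hq, isOpen_interior⟩
  have huniv := hclopen.eq_univ ⟨p, hint p g hg⟩
  refine ⟨g.1, g.2, fun x => ?_⟩
  have hx : x ∈ interior (F g) := huniv ▸ mem_univ x
  exact (interior_subset hx : x ∈ F g).symm

end OrbifoldChart

/-- The image of a smooth embedding. -/
def IsSmoothEmb.image {U V : Opens (Euc m)} {f : U → V} (hf : IsSmoothEmb f) : Opens (Euc m) :=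
  ⟨range fun x => (f x : Euc m),
    (V.isOpen.isOpenEmbedding_subtypeVal.comp hf.isOpenEmbedding).isOpen_range⟩

/-- Two embeddings over `Z` of a connected open set into a chart differ by a unique element of the
group of this chart. -/
theorem OrbifoldChart.exists_eq_of_proj_eq {Z : Type u} [TopologicalSpace Z]
    (C : OrbifoldChart m Z) {U : Opens (Euc m)} [PreconnectedSpace U] [Nonempty U]
    {φ ψ : U → C.dom} (hφ : IsSmoothEmb φ) (hψ : IsSmoothEmb ψ)
    (h : ∀ x, C.proj (φ x) = C.proj (ψ x)) : ∃ g ∈ C.G, ∀ x, ψ x = g (φ x) := by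
  have hle : hφ.image ≤ C.dom := by
    rintro _ ⟨x, rfl⟩
    exact (φ x).2
  have hk : ∀ y : hφ.image, ∃ x, φ x = Opens.inclusion hle y := by
    rintro ⟨_, x, rfl⟩
    exact ⟨x, rfl⟩
  -- `k` inverts `φ` on its image; composing with `k` turns `φ` into the inclusion of an open set.
  choose k hk using hk
  have hks : IsSmoothEmb k := hφ.of_comp (by
    rw [show φ ∘ k = Opens.inclusion hle from funext hk]
    exact .inclusion hle)
  have hkφ : ∀ x, k ⟨φ x, x, rfl⟩ = x := fun x => hφ.injective (hk _)
  have hsurj : Surjective (fun x : U => (⟨φ x, x, rfl⟩ : hφ.image)) := by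
    rintro ⟨_, x, rfl⟩
    exact ⟨x, rfl⟩
  have hcont : Continuous (fun x : U => (⟨φ x, x, rfl⟩ : hφ.image)) :=
    Continuous.subtype_mk (continuous_subtype_val.comp hφ.continuous) _
  have : PreconnectedSpace hφ.image := ⟨by
    rw [← hsurj.range_eq]
    exact isPreconnected_range hcont⟩
  have : Nonempty hφ.image := .map (fun x : U => (⟨φ x, x, rfl⟩ : hφ.image)) ‹_›
  obtain ⟨g, hg, hgx⟩ := C.exists_eq_of_inclusion (e := Opens.inclusion hle) (θ := ψ ∘ k)
    (fun _ => rfl) (.inclusion hle) (hψ.comp hks).localDiffeo.contMDiff (fun x => by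
      rw [Function.comp_apply, ← h, hk])
  refine ⟨g, hg, fun x => ?_⟩
  have := hgx ⟨φ x, x, rfl⟩
  rw [Function.comp_apply, hkφ] at this
  exact this

end Orbi

namespace Orbi

/-! ### Étale maps from open subsets of `ℝ^m` to orbifolds -/

variable {m : ℕ}

theorem IsSmoothEmb.eventually {U V : Opens (Euc m)} {i : U → V} (hi : IsSmoothEmb i) {P : V → Prop}
    {u : U} (h : ∀ᶠ x in 𝓝 u, P (i x)) : ∀ᶠ v in 𝓝 (i u), P v := by
  rw [← hi.isOpenEmbedding.map_nhds_eq u]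
  exact h

/-- A point of an open set has arbitrarily small connected open neighbourhoods. -/
theorem exists_connected_nhds {U : Opens (Euc m)} (u : U) {S : Set U} (hS : S ∈ 𝓝 u) :
    ∃ (N : Opens (Euc m)) (j : N → U) (n : N), IsConnected (N : Set (Euc m)) ∧ IsSmoothEmb j ∧
      j n = u ∧ ∀ x, j x ∈ S := by
  have h1 : Subtype.val '' S ∈ 𝓝 (u : Euc m) :=
    U.isOpen.isOpenEmbedding_subtypeVal.image_mem_nhds.2 hS
  obtain ⟨r, hr, hrS⟩ := Metric.mem_nhds_iff.1 h1
  have hle : (⟨Metric.ball (u : Euc m) r, Metric.isOpen_ball⟩ : Opens (Euc m)) ≤ U := by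
    intro x hx
    obtain ⟨y, _, rfl⟩ := hrS hx
    exact y.2
  refine ⟨⟨Metric.ball (u : Euc m) r, Metric.isOpen_ball⟩, Opens.inclusion hle,
    ⟨u, Metric.mem_ball_self hr⟩, ⟨⟨u, Metric.mem_ball_self hr⟩, ?_⟩, .inclusion hle, rfl, fun x => ?_⟩
  · exact (convex_ball (u : Euc m) r).isPreconnected
  · obtain ⟨y, hy, hxy⟩ := hrS x.2
    rwa [← (Subtype.ext hxy : y = Opens.inclusion hle x)]

theorem preconnectedSpace_of_isConnected {N : Opens (Euc m)} (hN : IsConnected (N : Set (Euc m))) :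
    PreconnectedSpace N :=
  isPreconnected_iff_preconnectedSpace.1 hN.isPreconnected

/-- Two embeddings with a common value have a local fibre product. -/
theorem exists_pullback {N₁ N₂ V : Opens (Euc m)} {i₁ : N₁ → V} {i₂ : N₂ → V}
    (h₁ : IsSmoothEmb i₁) (h₂ : IsSmoothEmb i₂) {x₁ : N₁} {x₂ : N₂} (h : i₁ x₁ = i₂ x₂) :
    ∃ (N : Opens (Euc m)) (j₁ : N → N₁) (j₂ : N → N₂) (n : N), IsConnected (N : Set (Euc m)) ∧
      IsSmoothEmb j₁ ∧ IsSmoothEmb j₂ ∧ j₁ n = x₁ ∧ j₂ n = x₂ ∧ ∀ x, i₁ (j₁ x) = i₂ (j₂ x) := by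
  have hS : i₁ ⁻¹' range i₂ ∈ 𝓝 x₁ :=
    (h₂.isOpenEmbedding.isOpen_range.preimage h₁.continuous).mem_nhds ⟨x₂, h.symm⟩
  obtain ⟨N, j, n, hN, hj, hn, hr⟩ := exists_connected_nhds x₁ hS
  choose k hk using hr
  refine ⟨N, j, k, n, hN, hj, h₂.of_comp ?_, hn, h₂.injective ?_, fun x => (hk x).symm⟩
  · rw [show i₂ ∘ k = i₁ ∘ j from funext hk]
    exact h₁.comp hj
  · rw [hk, hn, h]

section Charts

variable {Z : Type u} [TopologicalSpace Z]

/-- The composition of an embedding of charts with an element of the group of the target. -/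
def ChartEmb.smul {C D : OrbifoldChart m Z} (φ : ChartEmb C D) {g : Equiv.Perm D.dom}
    (hg : g ∈ D.G) : ChartEmb C D where
  toFun := g ∘ φ.toFun
  isEmb := (D.smooth_emb hg).comp φ.isEmb
  comm x := (D.proj_apply hg _).trans (φ.comm x)

theorem ChartEmb.exists_apply_eq {C D : OrbifoldChart m Z} (φ : ChartEmb C D) {x : C.dom} {y : D.dom}
    (h : C.proj x = D.proj y) : ∃ φ' : ChartEmb C D, φ'.toFun x = y := by
  obtain ⟨g, hg, hgy⟩ := (D.proj_eq_iff _ _).1 ((φ.comm x).trans h)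
  exact ⟨φ.smul hg, hgy⟩

/-- Compatibility only provides embeddings around the common image in `Z`. Chart groups are
transitive on fibres, so composing with group elements makes both embeddings pass through the
prescribed points. -/
theorem Compatible.exists_chartEmb {C D : OrbifoldChart m Z} (h : Compatible C D) {c : C.dom}
    {d : D.dom} (hcd : C.proj c = D.proj d) :
    ∃ (C₀ : OrbifoldChart m Z) (φ : ChartEmb C₀ C) (ψ : ChartEmb C₀ D) (x : C₀.dom),
      φ.toFun x = c ∧ ψ.toFun x = d := by
  obtain ⟨C₀, ⟨x, hx⟩, ⟨φ⟩, ⟨ψ⟩⟩ := h (C.proj c) ⟨⟨c, rfl⟩, ⟨d, hcd.symm⟩⟩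
  obtain ⟨φ', hφ'⟩ := φ.exists_apply_eq hx
  obtain ⟨ψ', hψ'⟩ := ψ.exists_apply_eq (hx.trans hcd)
  exact ⟨C₀, φ', ψ', x, hφ', hψ'⟩

/-- A chart with a smaller group: a continuous open map `f` from the domain of a chart whose fibres are
the orbits of the subgroup of all elements of `G` which preserve `f`. -/
def OrbifoldChart.lift {W : Type v} [TopologicalSpace W] (C : OrbifoldChart m Z) (f : C.dom → W)
    (hc : Continuous f) (ho : IsOpenMap f)
    (hf : ∀ x y, f x = f y → ∃ g ∈ C.G, g x = y ∧ ∀ w, f (g w) = f w) : OrbifoldChart m W where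
  dom := C.dom
  dom_connected := C.dom_connected
  G :=
    { carrier := {g | g ∈ C.G ∧ ∀ w, f (g w) = f w}
      one_mem' := ⟨C.G.one_mem, fun _ => rfl⟩
      mul_mem' := fun {a b} ha hb => ⟨C.G.mul_mem ha.1 hb.1, fun w => (ha.2 _).trans (hb.2 w)⟩
      inv_mem' := fun {a} ha => ⟨C.G.inv_mem ha.1, fun w => by
        rw [← ha.2]
        exact congrArg f (a.apply_symm_apply w)⟩ }
  G_finite := by
    have := C.G_finite
    exact Finite.of_injective (fun g : {g | g ∈ C.G ∧ ∀ w, f (g w) = f w} => (⟨g.1, g.2.1⟩ : C.G))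
      fun a b hab => Subtype.ext (congrArg (fun k : C.G => k.1) hab)
  G_smooth g hg := C.G_smooth g hg.1
  proj := f
  proj_cont := hc
  proj_open := ho
  proj_eq_iff x y := by
    constructor
    · intro h
      obtain ⟨g, hg, hxy, hw⟩ := hf x y h
      exact ⟨g, ⟨hg, hw⟩, hxy⟩
    · rintro ⟨g, hg, rfl⟩
      exact (hg.2 x).symm

/-- `f` is étale at `u`: locally, it is an embedding into a chart followed by the projection of
this chart. -/
def EtaleAt (B : OrbifoldAtlas m Z) {U : Opens (Euc m)} (f : U → Z) (u : U) : Prop :=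
  ∃ (N : Opens (Euc m)) (i : N → U) (n : N), ∃ K ∈ B.charts, ∃ ι : N → K.dom,
    IsConnected (N : Set (Euc m)) ∧ IsSmoothEmb i ∧ i n = u ∧ IsSmoothEmb ι ∧
    ∀ x, K.proj (ι x) = f (i x)

namespace EtaleAt

variable {B : OrbifoldAtlas m Z} {U U' : Opens (Euc m)} {f f' : U → Z} {u : U}

theorem congr (h : EtaleAt B f u) (hf : ∀ᶠ x in 𝓝 u, f x = f' x) : EtaleAt B f' u := by
  obtain ⟨N, i, n, K, hK, ι, hN, hi, rfl, hι, hx⟩ := h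
  obtain ⟨N', j, n', hN', hj, rfl, hr⟩ := exists_connected_nhds n (hi.continuous.continuousAt hf)
  exact ⟨N', i ∘ j, n', K, hK, ι ∘ j, hN', hi.comp hj, rfl, hι.comp hj, fun x =>
    (hx (j x)).trans (hr x)⟩

theorem eventually (h : EtaleAt B f u) : ∀ᶠ x in 𝓝 u, EtaleAt B f x := by
  obtain ⟨N, i, n, K, hK, ι, hN, hi, rfl, hι, hx⟩ := h
  exact hi.eventually (Eventually.of_forall fun n' =>
    ⟨N, i, n', K, hK, ι, hN, hi, rfl, hι, hx⟩)

theorem comp {e : U' → U} (he : IsSmoothEmb e) {u' : U'} (h : EtaleAt B f (e u')) :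
    EtaleAt B (f ∘ e) u' := by
  obtain ⟨N, i, n, K, hK, ι, hN, hi, hn, hι, hx⟩ := h
  obtain ⟨N', j₁, j₂, n', hN', h1, h2, rfl, rfl, h5⟩ := exists_pullback hi he hn
  exact ⟨N', j₂, n', K, hK, ι ∘ j₁, hN', h2, rfl, hι.comp h1, fun x =>
    (hx (j₁ x)).trans (congrArg f (h5 x))⟩

theorem of_comp {e : U' → U} (he : IsSmoothEmb e) {u' : U'} (h : EtaleAt B (f ∘ e) u') :
    EtaleAt B f (e u') := by
  obtain ⟨N, i, n, K, hK, ι, hN, hi, rfl, hι, hx⟩ := h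
  exact ⟨N, e ∘ i, n, K, hK, ι, hN, he.comp hi, rfl, hι, hx⟩

theorem map_nhds_eq (h : EtaleAt B f u) : map f (𝓝 u) = 𝓝 (f u) := by
  obtain ⟨N, i, n, K, hK, ι, hN, hi, rfl, hι, hx⟩ := h
  have e : f ∘ i = K.proj ∘ ι := (funext hx).symm
  have e' : f (i n) = K.proj (ι n) := (hx n).symm
  rw [← hi.isOpenEmbedding.map_nhds_eq, Filter.map_map, e, ← Filter.map_map,
    hι.isOpenEmbedding.map_nhds_eq, e']
  exact le_antisymm (K.proj_cont.tendsto _) (K.proj_open.nhds_le _)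

theorem continuous (h : ∀ u, EtaleAt B f u) : Continuous f :=
  continuous_iff_continuousAt.2 fun u => (h u).map_nhds_eq.le

theorem isOpenMap (h : ∀ u, EtaleAt B f u) : IsOpenMap f :=
  IsOpenMap.of_nhds_le fun u => (h u).map_nhds_eq.ge

/-- An étale map factors locally through every chart around its value. -/
theorem exists_factor (h : EtaleAt B f u) {P : OrbifoldChart m Z} (hP : B.HasChart P) {d : P.dom}
    (hd : P.proj d = f u) : ∃ (N : Opens (Euc m)) (i : N → U) (n : N) (ι : N → P.dom),
      IsConnected (N : Set (Euc m)) ∧ IsSmoothEmb i ∧ i n = u ∧ IsSmoothEmb ι ∧ ι n = d ∧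
      ∀ x, P.proj (ι x) = f (i x) := by
  obtain ⟨N, i, n, K, hK, ι, hN, hi, rfl, hι, hx⟩ := h
  obtain ⟨C₀, φ, ψ, x, hxd, hxn⟩ := (hP K hK).exists_chartEmb (hd.trans (hx n).symm)
  obtain ⟨N', j₁, j₂, n', hN', h1, h2, rfl, rfl, h5⟩ := exists_pullback hι ψ.isEmb hxn.symm
  refine ⟨N', i ∘ j₁, n', φ.toFun ∘ j₂, hN', hi.comp h1, rfl, φ.isEmb.comp h2, hxd, fun x => ?_⟩
  rw [Function.comp_apply, φ.comm, ← ψ.comm, ← h5, hx]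
  rfl

theorem of_hasChart {P : OrbifoldChart m Z} (hP : B.HasChart P) (d : P.dom) :
    EtaleAt B P.proj d := by
  obtain ⟨K, hK, k, hk⟩ := B.cover (P.proj d)
  obtain ⟨C₀, φ, ψ, x, hxd, hxn⟩ := (hP K hK).exists_chartEmb hk.symm
  exact ⟨C₀.dom, φ.toFun, x, K, hK, ψ.toFun, C₀.dom_connected, φ.isEmb, hxd, ψ.isEmb, fun x => by
    rw [ψ.comm, φ.comm]⟩

/-- Two étale maps with a common value differ locally by a diffeomorphism. -/
theorem exists_common {f₂ : U' → Z} {u' : U'} (h : EtaleAt B f u) (h' : EtaleAt B f₂ u')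
    (e : f u = f₂ u') : ∃ (N : Opens (Euc m)) (i₁ : N → U) (i₂ : N → U') (n : N),
      IsConnected (N : Set (Euc m)) ∧ IsSmoothEmb i₁ ∧ IsSmoothEmb i₂ ∧ i₁ n = u ∧ i₂ n = u' ∧
      ∀ x, f (i₁ x) = f₂ (i₂ x) := by
  obtain ⟨N', i', n', K, hK, ι', hN', hi', rfl, hι', hx'⟩ := h'
  obtain ⟨N, i, n, ι, hN, hi, rfl, hι, hn, hx⟩ := h.exists_factor (B.compat K hK)
    ((hx' n').trans e.symm)
  obtain ⟨N₀, j₁, j₂, n₀, hN₀, h1, h2, rfl, rfl, h5⟩ := exists_pullback hι hι' hn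
  refine ⟨N₀, i ∘ j₁, i' ∘ j₂, n₀, hN₀, hi.comp h1, hi'.comp h2, rfl, rfl, fun x => ?_⟩
  rw [Function.comp_apply, ← hx, h5, hx', Function.comp_apply]

end EtaleAt

/-- If `K.proj` factors near a point through an embedding `ι` into `D`, then a small chart inside
`D` contained in the image of `ι` can be pulled back through `ι`; it is the common chart that
compatibility requires. Charts can thus be recognised by a local condition on the projection alone.
-/
theorem hasChart_of_etale {B : OrbifoldAtlas m Z} {K : OrbifoldChart m Z}
    (h : ∀ x, EtaleAt B K.proj x) : B.HasChart K := by
  intro D hD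
  rintro _ ⟨⟨x, rfl⟩, ⟨d, hd⟩⟩
  obtain ⟨N, i, n, ι, hN, hi, rfl, hι, rfl, hx⟩ := (h x).exists_factor (B.compat D hD) hd
  obtain ⟨C₁, κ, ⟨y, hy⟩, hr⟩ := D.exists_sub (ι n) hι.isOpenEmbedding.isOpen_range ⟨n, rfl⟩
  choose k hk using fun x => hr ⟨x, rfl⟩
  have hks : IsSmoothEmb k := hι.of_comp (by
    rw [show ι ∘ k = κ.toFun from funext hk]
    exact κ.isEmb)
  refine ⟨C₁, ⟨y, ?_⟩, ⟨⟨i ∘ k, hi.comp hks, fun w => ?_⟩⟩, ⟨κ⟩⟩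
  · rw [← κ.comm, hy, hx]
  · rw [Function.comp_apply, ← hx, hk, κ.comm]

end Charts

/-! ### Orbifold coverings: uniqueness and comparison of étale lifts -/

section Coverings

variable {Y : Type u} {Z : Type v} [TopologicalSpace Y] [TopologicalSpace Z]
  {A' : OrbifoldAtlas m Y} {A : OrbifoldAtlas m Z} {q : Y → Z}

/-- A component of the preimage of an evenly covered chart `D` is the image of a map `π` which is defined
on the same domain. -/
structure IsChartLift (A' : OrbifoldAtlas m Y) (q : Y → Z) (D : OrbifoldChart m Z) (π : D.dom → Y) :
    Prop where
  etale : ∀ d, EtaleAt A' π d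
  comm : ∀ d, q (π d) = D.proj d
  fibre : ∀ d d', π d = π d' → ∃ g ∈ D.G, g d = d' ∧ ∀ w, π (g w) = π w

/-- Components of the preimage are replaced by maps defined on the domain of `D` itself, which is
the form used for lifting. The condition on groups becomes the statement that points of one fibre of
`π` are related by an element of `D.G` preserving `π`. -/
theorem IsOrbCovering.exists_lift (hq : IsOrbCovering A' A q) (z : Z) :
    ∃ D : OrbifoldChart m Z, A.HasChart D ∧ z ∈ range D.proj ∧ ∀ y, q y ∈ range D.proj →
      ∃ π : D.dom → Y, IsChartLift A' q D π ∧ y ∈ range π := by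
  obtain ⟨D, hD, hz, h⟩ := hq.2 z
  refine ⟨D, hD, hz, fun y hy => ?_⟩
  obtain ⟨C, hC, hr, hdom, hp, hG⟩ := h y hy
  have het := EtaleAt.of_hasChart hC
  have hyr : y ∈ range C.proj := hr ▸ mem_connectedComponentIn hy
  clear hr hC
  rcases C with ⟨dom, _, G, _, _, π, _, _, hfib⟩
  dsimp only at hdom
  subst hdom
  refine ⟨π, ⟨het, fun d => hp d d.2 d.2, fun d d' hdd => ?_⟩, hyr⟩
  obtain ⟨g, hg, hgd⟩ := (hfib d d').1 hdd
  obtain ⟨g', hg', hgg⟩ := hG g hg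
  have e : ∀ w : D.dom, g w = g' w := fun w => Subtype.ext (hgg w w.2 w.2)
  refine ⟨g', hg', (e d).symm.trans hgd, fun w => ?_⟩
  rw [← e]
  exact ((hfib _ _).2 ⟨g, hg, rfl⟩).symm

/-- Both `f` and `π` are étale with a common value, so locally `f ∘ i = π ∘ ι` for embeddings `i`
and `ι`. Near the point, `φ ∘ i` and `ι` are embeddings with the same projection to `Z`, and
rigidity supplies `g`. -/
theorem IsChartLift.exists_eventually_eq {D : OrbifoldChart m Z} {π : D.dom → Y}
    (hπ : IsChartLift A' q D π) {U : Opens (Euc m)} {f : U → Y} {φ : U → D.dom}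
    (hφ : IsSmoothEmb φ) {u : U} (hf : EtaleAt A' f u) (hqf : ∀ᶠ x in 𝓝 u, q (f x) = D.proj (φ x))
    (hu : f u ∈ range π) : ∃ g ∈ D.G, ∀ᶠ x in 𝓝 u, f x = π (g (φ x)) := by
  obtain ⟨d, hd⟩ := hu
  obtain ⟨N, i, ι, n, hN, hi, hι, rfl, rfl, hx⟩ := hf.exists_common (hπ.etale d) hd.symm
  obtain ⟨N', j, n', hN', hj, rfl, hr⟩ := exists_connected_nhds n (hi.continuous.continuousAt hqf)
  have := preconnectedSpace_of_isConnected hN'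
  have : Nonempty N' := ⟨n'⟩
  obtain ⟨g, hg, hgx⟩ := D.exists_eq_of_proj_eq (hφ.comp (hi.comp hj)) (hι.comp hj) (fun x => by
    have h1 : q (f (i (j x))) = D.proj (φ (i (j x))) := hr x
    rw [Function.comp_apply, Function.comp_apply, Function.comp_apply, ← h1, hx, hπ.comm])
  refine ⟨g, hg, (hi.comp hj).eventually (u := n') (Eventually.of_forall fun x => ?_)⟩
  exact (hx (j x)).trans (congrArg π (hgx x))

/-- Uniqueness of étale lifts along a covering. -/
theorem IsOrbCovering.lift_unique [T2Space Y] (hq : IsOrbCovering A' A q) {U : Opens (Euc m)}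
    [PreconnectedSpace U] {f₁ f₂ : U → Y} (h₁ : ∀ x, EtaleAt A' f₁ x) (h₂ : ∀ x, EtaleAt A' f₂ x)
    (h : ∀ x, EtaleAt A (q ∘ f₁) x) (h12 : ∀ x, q (f₁ x) = q (f₂ x)) {u : U}
    (hu : ∀ᶠ x in 𝓝 u, f₁ x = f₂ x) : f₁ = f₂ := by
  have hcl : IsClosed (interior {x | f₁ x = f₂ x}) := by
    refine isClosed_of_closure_subset fun p hp => ?_
    have hfp : f₁ p = f₂ p :=
      (isClosed_eq (EtaleAt.continuous h₁) (EtaleAt.continuous h₂)).closure_subset_iff.2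
        interior_subset hp
    obtain ⟨D, hD, ⟨d, hd⟩, hlift⟩ := hq.exists_lift (q (f₁ p))
    obtain ⟨π, hπ, hy⟩ := hlift (f₁ p) ⟨d, hd⟩
    obtain ⟨N, i, φ, n, hN, hi, hφ, rfl, hn, hx⟩ :=
      (h p).exists_common (EtaleAt.of_hasChart hD d) hd.symm
    obtain ⟨g₁, hg₁, e₁⟩ := hπ.exists_eventually_eq hφ ((h₁ (i n)).comp hi)
      (Eventually.of_forall hx) hy
    obtain ⟨g₂, hg₂, e₂⟩ := hπ.exists_eventually_eq hφ ((h₂ (i n)).comp hi)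
      (Eventually.of_forall fun x => (h12 (i x)).symm.trans (hx x)) (by rwa [Function.comp_apply, ← hfp])
    obtain ⟨S, hS, hSo, hnS⟩ := eventually_nhds_iff.1 (e₁.and e₂)
    -- Near the limit point `f₁ = π g₁ φ` and `f₂ = π g₂ φ`. At a point `s` of agreement such that
    -- `φ s` has trivial stabilizer, some `k` preserving `π` satisfies `k g₁ (φ s) = g₂ (φ s)`.
    -- Hence `g₂ = k * g₁`, and the two maps agree on the whole neighbourhood.
    have hne : (φ '' (S ∩ i ⁻¹' interior {x | f₁ x = f₂ x})).Nonempty := by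
      obtain ⟨_, ⟨s, hs, rfl⟩, hs'⟩ := mem_closure_iff.1 hp (i '' S)
        (hi.isOpenEmbedding.isOpenMap S hSo) ⟨n, hnS, rfl⟩
      exact ⟨φ s, s, ⟨hs, hs'⟩, rfl⟩
    obtain ⟨_, ⟨s, ⟨hs, hs'⟩, rfl⟩, hreg⟩ := D.exists_regular (hφ.isOpenEmbedding.isOpenMap _
      (hSo.inter (isOpen_interior.preimage hi.continuous))) hne
    have hs12 : f₁ (i s) = f₂ (i s) := by
      have := interior_subset hs'
      exact this
    obtain ⟨k, hk, hkd, hkw⟩ := hπ.fibre (g₁ (φ s)) (g₂ (φ s))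
      ((hS s hs).1.symm.trans (hs12.trans (hS s hs).2))
    have hkg : g₂⁻¹ * (k * g₁) = 1 := by
      refine hreg _ (D.G.mul_mem (D.G.inv_mem hg₂) (D.G.mul_mem hk hg₁)) ?_
      rw [Equiv.Perm.mul_apply, Equiv.Perm.mul_apply, hkd]
      exact g₂.symm_apply_apply _
    have hkg' : g₂ = k * g₁ := inv_mul_eq_one.1 hkg
    refine mem_interior_iff_mem_nhds.2 (hi.eventually (u := n) ?_)
    filter_upwards [hSo.mem_nhds hnS] with x hx
    have h5 := hS x hx
    refine h5.1.trans (Eq.trans ?_ h5.2.symm)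
    rw [hkg', Equiv.Perm.mul_apply, hkw]
  have huniv := IsClopen.eq_univ ⟨hcl, isOpen_interior⟩ ⟨u, mem_interior_iff_mem_nhds.2 hu⟩
  refine funext fun x => ?_
  have hx : x ∈ interior {x | f₁ x = f₂ x} := huniv ▸ mem_univ x
  have := interior_subset hx
  exact this

/-- Two étale lifts of the projection of a chart with a common value differ by an element of the
group. -/
theorem IsOrbCovering.exists_eq_of_lift [T2Space Y] (hq : IsOrbCovering A' A q)
    {C : OrbifoldChart m Z} (hC : A.HasChart C) {f₁ f₂ : C.dom → Y} (h₁ : ∀ x, EtaleAt A' f₁ x)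
    (h₂ : ∀ x, EtaleAt A' f₂ x) (hf₁ : ∀ x, q (f₁ x) = C.proj x) (hf₂ : ∀ x, q (f₂ x) = C.proj x)
    {x y : C.dom} (hxy : f₁ x = f₂ y) : ∃ g ∈ C.G, g x = y ∧ ∀ w, f₂ (g w) = f₁ w := by
  obtain ⟨N, i₁, i₂, n, hN, hi₁, hi₂, rfl, rfl, hx⟩ := (h₁ x).exists_common (h₂ y) hxy
  have := preconnectedSpace_of_isConnected hN
  have : Nonempty N := ⟨n⟩
  obtain ⟨g, hg, hgx⟩ := C.exists_eq_of_proj_eq hi₁ hi₂ (fun x => by rw [← hf₁, ← hf₂, hx])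
  refine ⟨g, hg, (hgx n).symm, fun w => ?_⟩
  have e : q ∘ f₁ = C.proj := funext hf₁
  have h12 : f₁ = f₂ ∘ g := by
    refine hq.lift_unique h₁ (fun x => (h₂ _).comp (C.smooth_emb hg))
      (fun x => by rw [e]; exact EtaleAt.of_hasChart hC x) (fun x => ?_) (u := i₁ n)
      (hi₁.eventually (Eventually.of_forall fun x => ?_))
    · rw [hf₁, Function.comp_apply, hf₂, C.proj_apply hg]
    · rw [hx, hgx, Function.comp_apply]
  rw [h12]
  rfl

/-- An evenly covered neighbourhood lies in the image of `q` as soon as it meets it, so the image is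
clopen. -/
theorem IsOrbCovering.surjective [ConnectedSpace Z] [Nonempty Y] (hq : IsOrbCovering A' A q) :
    Surjective q := by
  have key : ∀ z, ∃ D : OrbifoldChart m Z, z ∈ range D.proj ∧
      (∀ y, q y ∈ range D.proj → range D.proj ⊆ range q) := by
    intro z
    obtain ⟨D, hD, hz, h⟩ := hq.exists_lift z
    refine ⟨D, hz, fun y hy => ?_⟩
    obtain ⟨π, hπ, _⟩ := h y hy
    rintro _ ⟨d, rfl⟩
    exact ⟨π d, hπ.comm d⟩
  have hclopen : IsClopen (range q) := by
    constructor
    · refine isOpen_compl_iff.1 (isOpen_iff_mem_nhds.2 fun z hz => ?_)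
      obtain ⟨D, hzD, h⟩ := key z
      refine mem_of_superset (D.proj_open.isOpen_range.mem_nhds hzD) ?_
      rintro w hw ⟨y, rfl⟩
      exact hz (h y hw hzD)
    · refine isOpen_iff_mem_nhds.2 ?_
      rintro _ ⟨y, rfl⟩
      obtain ⟨D, hzD, h⟩ := key (q y)
      exact mem_of_superset (D.proj_open.isOpen_range.mem_nhds hzD) (h y hzD)
  exact range_eq_univ.1 (hclopen.eq_univ (range_nonempty q))

end Coverings

end Orbi

namespace Orbi.OrbifoldAtlas

variable {m : ℕ} {Z : Type u} [TopologicalSpace Z] {A : OrbifoldAtlas m Z}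

/-! ### Calculus of homotopy classes of `𝒢`-paths -/

namespace HClass

theorem eq_of_htp {x y : A.Obj} {p q : RawPath A} {hp hp' hq hq'} (h : Htp x y p q) :
    (mk p hp hp' : HClass x y) = mk q hq hq' := by
  obtain ⟨_, _, _, _, h⟩ := h
  exact h

/-- The class of a `𝒢`-path, or of a single arrow. -/
noncomputable def ofRaw {x y : A.Obj} (r : RawPath A) (hr : r.IsPath x y) : HClass x y :=
  mk (.cons (Arrow.refl x) (.const I x) r) trivial ⟨rfl, Arrow.refl_tgt x, hr⟩

/-- The class of an arrow, with prescribed ends. -/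
noncomputable def ofArr (g : A.Arrow) {x y : A.Obj} (hs : g.src = x) (ht : g.tgt = y) : HClass x y :=
  ofRaw (.arrow g) ⟨hs, ht⟩

theorem ofRaw_eq_mk {x y : A.Obj} {r : RawPath A} (h : r.IsProper) (hr : r.IsPath x y) :
    ofRaw r hr = mk r h hr := by
  refine eq_of_htp ?_
  have h1 := Htp.slide (x := x) h hr rfl (Arrow.refl_tgt x)
  rwa [RawPath.preact_refl hr] at h1

theorem ofArr_mul_mk {g : A.Arrow} {x y z : A.Obj} (hs : g.src = x) (ht : g.tgt = y) {q : RawPath A}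
    (hq : q.IsProper) (hq' : q.IsPath y z) :
    (ofArr g hs ht).mul (mk q hq hq') = mk (q.preact g) hq.preact (hq'.preact hs ht) :=
  ofRaw_eq_mk hq.preact (hq'.preact hs ht)

/-- The move `transform`, applied to a constant path in the domain of a transition with germ `g`,
carries `g` across the constant path that separates it from `h`. -/
theorem ofArr_mul_ofArr {g h : A.Arrow} {x y z : A.Obj} (hs : g.src = x) (ht : g.tgt = y)
    (hs' : h.src = y) (ht' : h.tgt = z) :
    (ofArr g hs ht).mul (ofArr h hs' ht') = ofArr (g.comp h) ((g.comp_src h).trans hs)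
      ((Arrow.comp_tgt (ht.trans hs'.symm)).trans ht') := by
  refine (ofArr_mul_mk (q := .cons (Arrow.refl y) (.const I y) (.arrow h)) hs ht trivial
    ⟨rfl, Arrow.refl_tgt y, hs', ht'⟩).trans ?_
  obtain ⟨T, w, rfl⟩ := g.exists_germAt
  subst hs
  rw [T.germAt_tgt] at ht
  subst ht
  have e1 : (T.germAt w).comp (Arrow.refl (T.t w)) = T.germAt w := Arrow.comp_refl (T.germAt_tgt w)
  have e2 : (T.symm.germAt w).comp ((T.germAt w).comp h) = h := by
    rw [← Arrow.comp_assoc (T.symm.germAt_tgt w) ((T.germAt_tgt w).trans hs'.symm),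
      T.symm_comp_germAt, Arrow.refl_comp hs'.symm]
  have e3 : (Arrow.refl (T.s w)).comp (T.germAt w) = T.germAt w := Arrow.refl_comp rfl
  have hM := Move.transform (x := T.s w) (y := z) (Arrow.refl (T.s w))
    (.arrow ((T.germAt w).comp h)) T (.const I w)
    ⟨rfl, Arrow.refl_tgt _, (Arrow.comp_src _ _), (Arrow.comp_tgt ((T.germAt_tgt w).trans hs'.symm)).trans ht'⟩
  have h2 : Move (T.s w) z _ (.cons ((Arrow.refl (T.s w)).comp (T.germAt w)) (T.tPath (.const I w))
    (.arrow ((T.symm.germAt w).comp ((T.germAt w).comp h)))) := hM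
  rw [e2, e3] at h2
  have h3 : Move (T.s w) z (.cons (Arrow.refl (T.s w)) (.const I (T.s w)) (.arrow ((T.germAt w).comp h)))
      (.cons ((T.germAt w).comp (Arrow.refl (T.t w))) (.const I (T.t w)) (.arrow h)) := by
    rw [e1]
    exact h2
  obtain ⟨_, _, _, _, h4⟩ := Htp.of_move RawPath.isProper_cons h3
  exact h4.symm

theorem ofArr_congr {g h : A.Arrow} {x y : A.Obj} (e : g = h) (hs : g.src = x) (ht : g.tgt = y) :
    ofArr g hs ht = ofArr h (e ▸ hs) (e ▸ ht) := by
  subst e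
  rfl

theorem ofPath_mul_mk {x y z : A.Obj} (b : Path x y) {q : RawPath A} (hq : q.IsProper)
    (hq' : q.IsPath y z) : (ofPath b).mul (mk q hq hq') =
      mk (.cons (Arrow.refl x) b q) trivial ⟨rfl, by simp, by simpa using hq'⟩ := by
  obtain ⟨_, _, _, _, h⟩ := Htp.of_eq RawPath.isProper_cons
    (RawPath.IsPath.comp (y := y) (p := .cons (Arrow.refl x) b (.arrow (Arrow.refl y)))
      ⟨rfl, by simp, by simp, by simp⟩ hq')
    (congrArg (RawPath.cons (Arrow.refl x) (b : C(I, A.Obj))) (RawPath.preact_refl hq'))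
  exact h

theorem ofPath_mul_ofArr {x y z : A.Obj} (b : Path x y) {g : A.Arrow} (hs : g.src = y)
    (ht : g.tgt = z) : (ofPath b).mul (ofArr g hs ht) =
      mk (.cons (Arrow.refl x) b (.arrow g)) trivial ⟨rfl, by simp, by simpa using hs, ht⟩ := by
  refine (ofPath_mul_mk b (q := .cons (Arrow.refl y) (.const I y) (.arrow g)) trivial
    ⟨rfl, Arrow.refl_tgt y, hs, ht⟩).trans (eq_of_htp ?_)
  exact Htp.absorb_left (by simp) ⟨rfl, by simp, by simpa using hs, ht⟩

/-- Splits off one arrow and one path, which permits induction on the raw data in `induction_right`.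
-/
theorem ofRaw_cons {g : A.Arrow} {b : C(I, A.Obj)} {r : RawPath A} {x y : A.Obj}
    (h : (RawPath.cons g b r).IsPath x y) : ofRaw (.cons g b r) h =
      (ofArr g h.1 h.2.1).mul ((ofPath ⟨b, rfl, rfl⟩).mul (ofRaw r h.2.2)) := by
  rw [ofRaw_eq_mk RawPath.isProper_cons h]
  have e1 : (ofPath (⟨b, rfl, rfl⟩ : Path (b 0) (b 1))).mul (ofRaw r h.2.2) =
      mk (.cons (Arrow.refl (b 0)) b r) trivial ⟨rfl, by simp, h.2.2⟩ := by
    cases r with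
    | arrow k => exact ofPath_mul_ofArr _ h.2.2.1 h.2.2.2
    | cons k b' r =>
      rw [ofRaw_eq_mk RawPath.isProper_cons h.2.2]
      exact ofPath_mul_mk _ _ _
  rw [e1]
  refine Eq.trans ?_ (ofArr_mul_mk h.1 h.2.1 _ _).symm
  exact mk_congr (congrArg (fun k => RawPath.cons k b r) (Arrow.comp_refl h.2.1).symm)

/-- The class of the germ of a coordinate transformation. -/
noncomputable def _root_.Orbi.OrbifoldAtlas.Transition.cls (T : A.Transition) (y : T.C₀.dom) :
    HClass (T.s y) (T.t y) :=
  ofArr (T.germAt y) (T.germAt_src y) (T.germAt_tgt y)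

/-- Naturality: a coordinate transformation can be moved along a path in its domain. -/
theorem ofPath_mul_germAt (T : A.Transition) {y y' : T.C₀.dom} (β : Path y y') :
    (ofPath (β.map T.s_isOpenEmbedding.continuous)).mul (T.cls y') =
      (T.cls y).mul (ofPath (β.map T.t_isOpenEmbedding.continuous)) := by
  rw [Transition.cls, ofPath_mul_ofArr]
  refine Eq.trans ?_ (ofArr_mul_mk _ _ _ _).symm
  have hM := Move.transform (x := T.s y) (y := T.t y') (Arrow.refl (T.s y)) (.arrow (T.germAt y')) T β
    ⟨rfl, (Arrow.refl_tgt _).trans (congrArg T.s β.source.symm), congrArg T.s β.target.symm,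
      T.germAt_tgt y'⟩
  refine sound ?_
  have hb0 : (β : C(I, T.C₀.dom)) 0 = y := β.source
  have hb1 : (β : C(I, T.C₀.dom)) 1 = y' := β.target
  have h2 : Move (T.s y) (T.t y') _ (.cons ((Arrow.refl (T.s y)).comp (T.germAt ((β : C(I, T.C₀.dom)) 0)))
    (T.tPath β) (.arrow ((T.symm.germAt ((β : C(I, T.C₀.dom)) 1)).comp (T.germAt y')))) := hM
  rw [hb0, hb1, T.symm_comp_germAt,
    show (Arrow.refl (T.s y)).comp (T.germAt y) = _ from Arrow.refl_comp rfl,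
    ← Arrow.comp_refl (T.germAt_tgt y)] at h2
  exact h2

theorem leftPart_trans {x y z : A.Obj} (b : Path x y) (b' : Path y z) {h : I}
    (hh : (h : ℝ) = 1 / 2) : leftPart (b.trans b' : C(I, A.Obj)) h = b := by
  ext1 t
  change (b.trans b') (h * t) = b t
  have h1 : ((h * t : I) : ℝ) = 1 / 2 * t := by rw [Icc.coe_mul, hh]
  rw [Path.trans_apply, dif_pos (by rw [h1]; linarith [t.2.2])]
  refine congrArg b (Subtype.ext ?_)
  change 2 * ((h * t : I) : ℝ) = t
  rw [h1]
  ring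

theorem rightPart_trans {x y z : A.Obj} (b : Path x y) (b' : Path y z) {h : I}
    (hh : (h : ℝ) = 1 / 2) : rightPart (b.trans b' : C(I, A.Obj)) h = b' := by
  ext1 t
  change (b.trans b') (σ (σ h * σ t)) = b' t
  have h1 : ((σ (σ h * σ t) : I) : ℝ) = 1 / 2 + 1 / 2 * t := by
    simp only [unitInterval.coe_symm_eq, Icc.coe_mul, hh]
    ring
  rw [Path.trans_apply]
  split_ifs with h'
  -- Only `t = 0` falls into the first half, and there the two paths meet.
  · rw [h1] at h'
    have ht : t = 0 := Subtype.ext (le_antisymm (by rw [Icc.coe_zero]; linarith) t.2.1)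
    refine (congrArg b (Subtype.ext ?_)).trans
      (b.target.trans (b'.source.symm.trans (congrArg b' ht.symm)))
    change 2 * ((σ (σ h * σ t) : I) : ℝ) = 1
    rw [h1, ht, Icc.coe_zero]
    norm_num
  · refine congrArg b' (Subtype.ext ?_)
    change 2 * ((σ (σ h * σ t) : I) : ℝ) - 1 = t
    rw [h1]
    ring

theorem ofPath_trans {x y z : A.Obj} (b : Path x y) (b' : Path y z) :
    ofPath (b.trans b') = (ofPath b).mul (ofPath b') := by
  refine Eq.trans ?_ (ofPath_mul_mk b _ _).symm
  refine sound ?_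
  obtain ⟨h, hh⟩ : ∃ h : I, (h : ℝ) = 1 / 2 := ⟨⟨1 / 2, by norm_num, by norm_num⟩, rfl⟩
  have hM := Move.subdivide (x := x) (y := z) (Arrow.refl x) (b.trans b') (.arrow (Arrow.refl z))
    h (by rw [← Subtype.coe_lt_coe, hh]; norm_num) (by rw [← Subtype.coe_lt_coe, hh]; norm_num)
    ⟨rfl, by simp, by simp, by simp⟩
  have e3 : (b.trans b' : C(I, A.Obj)) h = y := by
    have := congrArg (fun f : C(I, A.Obj) => f 1) (leftPart_trans b b' hh)
    simpa [leftPart] using this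
  rw [leftPart_trans b b' hh, rightPart_trans b b' hh, e3] at hM
  exact hM

theorem ofPath_eq_of_homotopic {x y : A.Obj} {b b' : Path x y} (h : b.Homotopic b') :
    ofPath b = ofPath b' := by
  obtain ⟨F⟩ := h
  refine sound ?_
  have hM := Move.homotopy (x := x) (y := y)
    (fun s => RawPath.cons (Arrow.refl x) (F.eval s : C(I, A.Obj)) (.arrow (Arrow.refl y)))
    (.cons (fun _ => Arrow.refl x) (fun s => (F.eval s : C(I, A.Obj)))
      (fun _ => .arrow (Arrow.refl y)) continuous_const F.continuous (.const _))
    (fun s => ⟨rfl, by simp, by simp, by simp⟩) (fun _ => rfl) (fun _ => rfl)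
  simpa only [Path.Homotopy.eval_zero, Path.Homotopy.eval_one] using hM

/-- The class of a path from `u` to `v` in a chart. -/
noncomputable def inChart (C : A.charts) (u v : C.1.dom) : HClass (A := A) ⟨C, u⟩ ⟨C, v⟩ :=
  ofPath (chartPath C (PathConnectedSpace.somePath u v))

section SimplyConnected

variable [∀ C : A.charts, SimplyConnectedSpace C.1.dom]

theorem ofPath_chartPath (C : A.charts) {u v : C.1.dom} (b : Path u v) :
    ofPath (chartPath C b) = inChart C u v :=
  ofPath_eq_of_homotopic ((SimplyConnectedSpace.paths_homotopic b
    (PathConnectedSpace.somePath u v)).map ⟨_, (IsOpenEmbedding.sigmaMk (i := C)).continuous⟩)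

theorem inChart_mul (C : A.charts) (u v w : C.1.dom) :
    (inChart C u v).mul (inChart C v w) = inChart C u w := by
  rw [inChart, inChart, ← ofPath_trans, ← ofPath_chartPath C
    ((PathConnectedSpace.somePath u v).trans (PathConnectedSpace.somePath v w))]
  exact congrArg ofPath (Path.map_trans (PathConnectedSpace.somePath u v)
    (PathConnectedSpace.somePath v w) (IsOpenEmbedding.sigmaMk (i := C)).continuous).symm

theorem inChart_self (C : A.charts) (u : C.1.dom) : inChart C u u = one _ :=
  (ofPath_chartPath C (Path.refl u)).symm

theorem mul_inChart_self {x : A.Obj} {C : A.charts} {u : C.1.dom} (c : HClass x (⟨C, u⟩ : A.Obj)) :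
    c.mul (inChart C u u) = c := by
  rw [inChart_self, mul_one]

/-- A path in the domain of `T` is mapped into both charts, and simple connectedness there makes the
choice of path irrelevant. This identity is what makes neighbouring sheets fit together. -/
theorem inChart_mul_germAt (T : A.Transition) (y y' : T.C₀.dom) :
    (inChart T.i (T.φ.toFun y) (T.φ.toFun y')).mul (T.cls y') =
      (T.cls y).mul (inChart T.j (T.ψ.toFun y) (T.ψ.toFun y')) := by
  have h := ofPath_mul_germAt T (PathConnectedSpace.somePath y y')
  rw [← ofPath_chartPath T.i ((PathConnectedSpace.somePath y y').map T.φ.isEmb.continuous),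
    ← ofPath_chartPath T.j ((PathConnectedSpace.somePath y y').map T.ψ.isEmb.continuous)]
  exact h

/-- Every property of classes of `𝒢`-paths starting at `x₀` which is preserved by composition with
arrows and with paths in charts holds for all of them. -/
theorem induction_right {x₀ : A.Obj} {S : ∀ y, HClass x₀ y → Prop} (h1 : S x₀ (one x₀))
    (harr : ∀ (g : A.Arrow) (c : HClass x₀ g.src), S _ c → S g.tgt (c.mul (ofArrow g)))
    (hpath : ∀ (C : A.charts) (u v : C.1.dom) (c : HClass x₀ (⟨C, u⟩ : A.Obj)), S _ c →
      S _ (c.mul (inChart C u v))) {y : A.Obj} (c : HClass x₀ y) : S y c := by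
  have harr' : ∀ (g : A.Arrow) (x y : A.Obj) (hs : g.src = x) (ht : g.tgt = y) (c : HClass x₀ x),
      S x c → S y (c.mul (ofArr g hs ht)) := by
    rintro g _ _ rfl rfl c hc
    exact harr g c hc
  have key : ∀ (r : RawPath A) (x : A.Obj) (a : HClass x₀ x) (hr : r.IsPath x y), S x a →
      S y (a.mul (ofRaw r hr)) := by
    intro r
    induction r with
    | arrow g => exact fun x a hr ha => harr' g x y hr.1 hr.2 a ha
    | cons g b r ih =>
      intro x a hr ha
      rw [ofRaw_cons, ← mul_assoc, ← mul_assoc]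
      refine ih _ _ hr.2.2 ?_
      have h2 := harr' g x _ hr.1 hr.2.1 a ha
      generalize a.mul (ofArr g hr.1 hr.2.1) = a' at h2 ⊢
      clear ha hr
      -- The unit interval is connected, so the path stays in a single chart.
      obtain ⟨C, β, rfl⟩ := b.exists_lift_sigma
      have h3 := hpath C (β 0) (β 1) a' h2
      have h4 : inChart C (β 0) (β 1) = _ := (ofPath_chartPath C ⟨β, rfl, rfl⟩).symm
      rw [h4] at h3
      exact h3
  induction c using ind with | _ p hp hp'
  have h := key p x₀ (one x₀) hp' h1
  rwa [one_mul, ofRaw_eq_mk hp hp'] at h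

end SimplyConnected

theorem mul_inv_cancel_right {x y z : A.Obj} (a : HClass x y) (b : HClass y z) :
    (a.mul b).mul b.inv = a := by rw [mul_assoc, mul_inv, mul_one]

theorem inv_mul_cancel_right {x y z : A.Obj} (a : HClass x y) (b : HClass z y) :
    (a.mul b.inv).mul b = a := by rw [mul_assoc, inv_mul, mul_one]

theorem mul_right_cancel {x y z : A.Obj} {a a' : HClass x y} {b : HClass y z}
    (h : a.mul b = a'.mul b) : a = a' := by
  rw [← mul_inv_cancel_right a b, h, mul_inv_cancel_right]

end HClass

/-! ### Arrows -/

theorem exists_transition {C C' : A.charts} {u : C.1.dom} {u' : C'.1.dom}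
    (h : C.1.proj u = C'.1.proj u') : ∃ (T : A.Transition) (y : T.C₀.dom),
      T.s y = ⟨C, u⟩ ∧ T.t y = ⟨C', u'⟩ := by
  obtain ⟨C₀, φ, ψ, x, rfl, rfl⟩ := (A.compat C.1 C.2 C'.1 C'.2).exists_chartEmb h
  exact ⟨⟨C, C', C₀, φ, ψ⟩, x, rfl, rfl⟩

theorem exists_arrow {x y : A.Obj} (h : x.1.1.proj x.2 = y.1.1.proj y.2) :
    ∃ g : A.Arrow, g.src = x ∧ g.tgt = y := by
  obtain ⟨T, w, hs, ht⟩ := exists_transition h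
  exact ⟨T.germAt w, hs, (T.germAt_tgt w).trans ht⟩

/-- The coordinate transformation defined by an element of the group of a chart. -/
def Transition.deck (C : A.charts) {γ : Equiv.Perm C.1.dom} (hγ : γ ∈ C.1.G) : A.Transition :=
  ⟨C, C, C.1, ⟨fun x => x, .id, fun _ => rfl⟩, ⟨γ, C.1.smooth_emb hγ, fun x => C.1.proj_apply hγ x⟩⟩

/-- The two embeddings of the transition have the same target chart, so rigidity makes them differ
by an element of its group. -/
theorem Arrow.exists_deck {C : A.charts} {v v' : C.1.dom} {g : A.Arrow} (hs : g.src = ⟨C, v⟩)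
    (ht : g.tgt = ⟨C, v'⟩) : ∃ (γ : Equiv.Perm C.1.dom) (hγ : γ ∈ C.1.G), γ v = v' ∧
      g = (Transition.deck C hγ).germAt v := by
  obtain ⟨T, y, rfl⟩ := g.exists_germAt
  rw [T.germAt_tgt] at ht
  rcases T with ⟨i, j, C₀, φ, ψ⟩
  obtain rfl : i = C := congrArg Sigma.fst hs
  obtain rfl : j = i := congrArg Sigma.fst ht
  obtain rfl : φ.toFun y = v := eq_of_heq (Sigma.mk.inj_iff.1 hs).2
  obtain rfl : ψ.toFun y = v' := eq_of_heq (Sigma.mk.inj_iff.1 ht).2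
  obtain ⟨γ, hγ, h⟩ := j.1.exists_eq_of_proj_eq φ.isEmb ψ.isEmb fun x =>
    (φ.comm x).trans (ψ.comm x).symm
  refine ⟨γ, hγ, (h y).symm, ?_⟩
  refine Arrow.ext' rfl _ _ (Transition.germAt_eq _ y
    (f := Function.extend (Transition.deck j hγ).s (Transition.deck j hγ).t id) fun z => ?_) rfl
    (EventuallyEq.refl _ _)
  change Function.extend (Transition.deck j hγ).s (Transition.deck j hγ).t id
    ((Transition.deck j hγ).s (φ.toFun z)) = _
  refine ((Transition.deck j hγ).s_isOpenEmbedding.injective.extend_apply _ _ _).trans ?_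
  exact congrArg (Sigma.mk j) (h z).symm

/-- The images in `Z` of the end points that can be reached form a set containing every chart image
it meets; it is clopen, hence all of `Z`. -/
theorem nonempty_hclass [ConnectedSpace Z] (x₀ y : A.Obj) : Nonempty (HClass x₀ y) := by
  set S : Set Z := {z | ∃ x : A.Obj, x.1.1.proj x.2 = z ∧ Nonempty (HClass x₀ x)} with hS
  have harr : ∀ x x' : A.Obj, x.1.1.proj x.2 = x'.1.1.proj x'.2 → Nonempty (HClass x₀ x) →
      Nonempty (HClass x₀ x') := by
    rintro x x' h ⟨c⟩
    obtain ⟨g, hs, ht⟩ := exists_arrow h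
    exact ⟨c.mul (.ofArr g hs ht)⟩
  have key : ∀ (C : A.charts) (u v : C.1.dom), C.1.proj u ∈ S → Nonempty (HClass x₀ ⟨C, v⟩) := by
    rintro C u v ⟨x, hx, hc⟩
    obtain ⟨c⟩ := harr x ⟨C, u⟩ hx hc
    exact ⟨c.mul (.inChart C u v)⟩
  have hclopen : IsClopen S := by
    constructor
    · refine isOpen_compl_iff.1 (isOpen_iff_mem_nhds.2 fun z hz => ?_)
      obtain ⟨C, hC, v, rfl⟩ := A.cover z
      refine mem_of_superset (C.proj_open.isOpen_range.mem_nhds ⟨v, rfl⟩) ?_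
      rintro _ ⟨u, rfl⟩ hu
      exact hz ⟨⟨⟨C, hC⟩, v⟩, rfl, key ⟨C, hC⟩ u v hu⟩
    · refine isOpen_iff_mem_nhds.2 ?_
      rintro _ ⟨⟨C, u⟩, rfl, hc⟩
      refine mem_of_superset (C.1.proj_open.isOpen_range.mem_nhds ⟨u, rfl⟩) ?_
      rintro _ ⟨v, rfl⟩
      exact ⟨⟨C, v⟩, rfl, key C u v ⟨⟨C, u⟩, rfl, hc⟩⟩
  have huniv := hclopen.eq_univ ⟨_, x₀, rfl, ⟨.one x₀⟩⟩
  obtain ⟨x, hx, hc⟩ := huniv ▸ mem_univ (y.1.1.proj y.2)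
  exact harr x y hx hc

/-- After a fixed arrow `g₀`, any other one is obtained by composing with a germ at the end point of
`g₀` from the chart `C` to itself, and such germs come from the finite group of `C`. -/
theorem finite_arrows (x : A.Obj) (C : A.charts) : {g : A.Arrow | g.src = x ∧ g.tgt.1 = C}.Finite := by
  have hpt : ∀ g : A.Arrow, g.tgt.1 = C → ∃ v, g.tgt = ⟨C, v⟩ := by
    intro g ht
    rcases hg : g.tgt with ⟨C', v⟩
    rw [hg] at ht
    dsimp only at ht
    subst ht
    exact ⟨v, rfl⟩
  rcases eq_empty_or_nonempty {g : A.Arrow | g.src = x ∧ g.tgt.1 = C} with h | ⟨g₀, hs₀, ht₀⟩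
  · rw [h]
    exact finite_empty
  · obtain ⟨v₀, hv₀⟩ := hpt g₀ ht₀
    have := C.1.G_finite
    refine (finite_range fun γ : C.1.G =>
      g₀.comp ((Transition.deck C γ.2).germAt v₀)).subset ?_
    rintro g ⟨hs, ht⟩
    obtain ⟨v, hv⟩ := hpt g ht
    have e1 : g₀.inv.tgt = g.src := g₀.inv_tgt.trans (hs₀.trans hs.symm)
    obtain ⟨γ, hγ, _, h⟩ := Arrow.exists_deck (g := g₀.inv.comp g)
      (((g₀.inv.comp_src g)).trans (g₀.inv_src.trans hv₀)) ((Arrow.comp_tgt e1).trans hv)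
    refine ⟨⟨γ, hγ⟩, ?_⟩
    dsimp only
    rw [← h, ← Arrow.comp_assoc g₀.inv_src.symm e1, g₀.comp_inv, Arrow.refl_comp (hs₀.trans hs.symm)]

theorem UnivCover.proj_surjective [ConnectedSpace Z] {x₀ : A.Obj} :
    Surjective (UnivCover.proj (A := A) (x₀ := x₀)) := by
  intro z
  obtain ⟨C, hC, v, rfl⟩ := A.cover z
  obtain ⟨c⟩ := nonempty_hclass x₀ ⟨⟨C, hC⟩, v⟩
  exact ⟨UnivCover.mk ⟨_, c⟩, rfl⟩

end Orbi.OrbifoldAtlas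

namespace Orbi.OrbifoldAtlas

variable {m : ℕ} {Z : Type u} [TopologicalSpace Z] {A : OrbifoldAtlas m Z}

/-! ### The sheets of the universal covering -/

/-- Arrows have identities, inverses and composites, so the generated equivalence relation needs
only one arrow. -/
theorem UnivCover.mk_eq_iff {x₀ x y : A.Obj} {a : HClass x₀ x} {b : HClass x₀ y} :
    UnivCover.mk ⟨x, a⟩ = UnivCover.mk ⟨y, b⟩ ↔
      ∃ (g : A.Arrow) (hs : g.src = x) (ht : g.tgt = y), a.mul (.ofArr g hs ht) = b := by
  constructor
  · intro h
    have key : ∀ p q : A.PathSpace x₀, Relation.EqvGen (OrbitRel x₀) p q →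
        ∃ (g : A.Arrow) (hs : g.src = p.pt) (ht : g.tgt = q.pt), p.cls.mul (.ofArr g hs ht) = q.cls := by
      intro p q hpq
      induction hpq with
      | rel p q h =>
        cases h with
        | intro g c => exact ⟨g, rfl, rfl, rfl⟩
      | refl p => exact ⟨Arrow.refl p.pt, rfl, Arrow.refl_tgt _, p.cls.mul_one⟩
      | symm p q _ ih =>
        obtain ⟨g, hs, ht, h⟩ := ih
        refine ⟨g.inv, g.inv_src.trans ht, g.inv_tgt.trans hs, ?_⟩
        rw [← h, HClass.mul_assoc, HClass.ofArr_mul_ofArr]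
        rcases p with ⟨x, a⟩
        dsimp only at hs
        subst hs
        rw [HClass.ofArr_congr g.comp_inv]
        exact a.mul_one
      | trans p q r _ _ ih ih' =>
        obtain ⟨g, hs, ht, h⟩ := ih
        obtain ⟨g', hs', ht', h'⟩ := ih'
        refine ⟨g.comp g', (g.comp_src g').trans hs, (Arrow.comp_tgt (ht.trans hs'.symm)).trans ht', ?_⟩
        rw [← h', ← h, HClass.mul_assoc, HClass.ofArr_mul_ofArr]
    exact key _ _ (Quot.eqvGen_exact h)
  · rintro ⟨g, rfl, rfl, rfl⟩
    exact Quot.sound (.intro g a)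

/-- The restriction to a sheet of the quotient map `𝒢̂₀ → X`. -/
noncomputable def sheetMap {x₀ : A.Obj} {C : A.charts} {u : C.1.dom}
    (c : HClass x₀ (⟨C, u⟩ : A.Obj)) (v : C.1.dom) : A.UnivCover x₀ := UnivCover.mk (sheet c v)

theorem sheetMap_eq_mk {x₀ : A.Obj} {C : A.charts} {u : C.1.dom}
    (c : HClass x₀ (⟨C, u⟩ : A.Obj)) (v : C.1.dom) :
    sheetMap c v = UnivCover.mk ⟨⟨C, v⟩, c.mul (.inChart C u v)⟩ := rfl

theorem smul_sheetMap {x₀ : A.Obj} {C : A.charts} {u : C.1.dom} (γ : A.Pi1 x₀)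
    (c : HClass x₀ (⟨C, u⟩ : A.Obj)) (v : C.1.dom) :
    γ • sheetMap c v = sheetMap (HClass.mul γ c) v :=
  congrArg (fun d => UnivCover.mk ⟨⟨C, v⟩, d⟩) (HClass.mul_assoc γ c (.inChart C u v)).symm

theorem sheet_continuous {x₀ : A.Obj} {C : A.charts} {u : C.1.dom}
    (c : HClass x₀ (⟨C, u⟩ : A.Obj)) : Continuous (sheet c) :=
  continuous_iff_coinduced_le.2 (le_iSup_of_le C (le_iSup_of_le u (le_iSup_of_le c le_rfl)))

theorem sheetMap_continuous {x₀ : A.Obj} {C : A.charts} {u : C.1.dom}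
    (c : HClass x₀ (⟨C, u⟩ : A.Obj)) : Continuous (sheetMap c) :=
  continuous_quot_mk.comp (sheet_continuous c)

theorem UnivCover.isOpen_iff {x₀ : A.Obj} {s : Set (A.UnivCover x₀)} :
    IsOpen s ↔ ∀ (C : A.charts) (u : C.1.dom) (c : HClass x₀ (⟨C, u⟩ : A.Obj)),
      IsOpen (sheetMap c ⁻¹' s) := by
  refine ⟨fun h C u c => h.preimage (sheetMap_continuous c), fun h => ?_⟩
  change IsOpen (UnivCover.mk ⁻¹' s)
  refine isOpen_iSup_iff.2 fun C => isOpen_iSup_iff.2 fun u => isOpen_iSup_iff.2 fun c => ?_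
  exact isOpen_coinduced.2 (h C u c)

theorem UnivCover.continuous_iff {x₀ : A.Obj} {W : Type v} [TopologicalSpace W]
    {f : A.UnivCover x₀ → W} : Continuous f ↔
      ∀ (C : A.charts) (u : C.1.dom) (c : HClass x₀ (⟨C, u⟩ : A.Obj)), Continuous (f ∘ sheetMap c) := by
  refine ⟨fun h C u c => h.comp (sheetMap_continuous c), fun h => ⟨fun s hs => ?_⟩⟩
  exact UnivCover.isOpen_iff.2 fun C u c => hs.preimage (h C u c)

theorem UnivCover.proj_continuous {x₀ : A.Obj} : Continuous (UnivCover.proj (A := A) (x₀ := x₀)) :=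
  UnivCover.continuous_iff.2 fun C _ _ => C.1.proj_cont

/-- Compare the two maps at a point `v` with trivial stabilizer. The arrow relating the values is
the germ of a group element fixing `v`, hence an identity, and the class of the path to `v` cancels.
-/
theorem sheetMap_injective {x₀ : A.Obj} {C : A.charts} {u : C.1.dom} :
    Injective (sheetMap : HClass x₀ (⟨C, u⟩ : A.Obj) → _) := by
  intro c c' h
  obtain ⟨v, -, hv⟩ := C.1.exists_regular isOpen_univ ⟨u, trivial⟩
  obtain ⟨g, hs, ht, e⟩ := UnivCover.mk_eq_iff.1 (congrFun h v)
  obtain ⟨k, hk, hkv, rfl⟩ := Arrow.exists_deck hs ht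
  obtain rfl := hv k hk hkv
  have e' : (c.mul (.inChart C u v)).mul (HClass.one _) = c'.mul (.inChart C u v) := e
  -- The group element is `1`, so the class of the arrow has unfolded to the trivial class.
  rw [HClass.mul_one] at e'
  exact HClass.mul_right_cancel e'

/-- Elements acting alike carry the sheet of the trivial class at the base point to the same sheet
map, which determines them. -/
theorem faithfulSMul {x₀ : A.Obj} : FaithfulSMul (A.Pi1 x₀) (A.UnivCover x₀) := by
  refine ⟨fun {γ γ'} h => ?_⟩
  rcases x₀ with ⟨C, u⟩
  refine HClass.mul_right_cancel (b := HClass.one (⟨C, u⟩ : A.Obj)) (sheetMap_injective (funext fun v => ?_))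
  exact (smul_sheetMap γ _ v).symm.trans ((h _).trans (smul_sheetMap γ' _ v))

section SimplyConnected

variable [∀ C : A.charts, SimplyConnectedSpace C.1.dom] {x₀ : A.Obj}

theorem sheetMap_self {C : A.charts} {u : C.1.dom} (c : HClass x₀ (⟨C, u⟩ : A.Obj)) :
    sheetMap c u = UnivCover.mk ⟨⟨C, u⟩, c⟩ := by
  rw [sheetMap_eq_mk, HClass.mul_inChart_self]

theorem exists_sheetMap (x : A.UnivCover x₀) :
    ∃ (C : A.charts) (u : C.1.dom) (c : HClass x₀ (⟨C, u⟩ : A.Obj)), sheetMap c u = x := by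
  rcases x with ⟨⟨⟨C, u⟩, c⟩⟩
  exact ⟨C, u, c, sheetMap_self c⟩

/-- Composing with an arrow to `u` exchanges a sheet over another chart for one over `C` without
changing the point of `X`. Points of one fibre of the projection can thus be compared on sheets over
the same chart. -/
theorem exists_sheetMap_of_proj {x : A.UnivCover x₀} {C : A.charts} {u : C.1.dom}
    (h : x.proj = C.1.proj u) : ∃ c : HClass x₀ (⟨C, u⟩ : A.Obj), sheetMap c u = x := by
  obtain ⟨C', u', c', rfl⟩ := exists_sheetMap x
  obtain ⟨g, hs, ht⟩ := exists_arrow (x := ⟨C', u'⟩) (y := ⟨C, u⟩) h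
  refine ⟨c'.mul (.ofArr g hs ht), ?_⟩
  rw [sheetMap_self, sheetMap_self]
  exact (UnivCover.mk_eq_iff.2 ⟨g, hs, ht, rfl⟩).symm

theorem sheetMap_mul_inChart {C : A.charts} {u : C.1.dom} (c : HClass x₀ (⟨C, u⟩ : A.Obj))
    (w : C.1.dom) : sheetMap (c.mul (.inChart C u w)) = sheetMap c := by
  refine funext fun v => ?_
  rw [sheetMap_eq_mk, sheetMap_eq_mk, HClass.mul_assoc, HClass.inChart_mul]

/-- The two values are related by the germ at `y'`, which arises from the germ at `y` by sliding
along both charts. -/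
theorem sheetMap_mul_cls {C C' : A.charts} {C₀ : OrbifoldChart m Z} (φ : ChartEmb C₀ C.1)
    (ψ : ChartEmb C₀ C'.1) {y : C₀.dom} (c : HClass x₀ (⟨C, φ.toFun y⟩ : A.Obj)) (y' : C₀.dom) :
    sheetMap (u := ψ.toFun y) (c.mul (Transition.cls ⟨C, C', C₀, φ, ψ⟩ y)) (ψ.toFun y') =
      sheetMap c (φ.toFun y') := by
  rw [sheetMap_eq_mk, sheetMap_eq_mk]
  refine (UnivCover.mk_eq_iff.2 ⟨(Transition.mk C C' C₀ φ ψ).germAt y', rfl,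
    Transition.germAt_tgt ⟨C, C', C₀, φ, ψ⟩ y', ?_⟩).symm
  exact (HClass.mul_assoc c _ _).trans ((congrArg (HClass.mul c)
    (HClass.inChart_mul_germAt ⟨C, C', C₀, φ, ψ⟩ y y')).trans (HClass.mul_assoc c _ _).symm)

/-- Two sheets with a common point in `X` agree locally up to a coordinate transformation. -/
theorem exists_chartEmb_of_sheetMap_eq {C C' : A.charts} {u : C.1.dom} {u' : C'.1.dom}
    {c : HClass x₀ (⟨C, u⟩ : A.Obj)} {c' : HClass x₀ (⟨C', u'⟩ : A.Obj)} {v : C.1.dom}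
    {v' : C'.1.dom} (h : sheetMap c v = sheetMap c' v') :
    ∃ (C₀ : OrbifoldChart m Z) (φ : ChartEmb C₀ C.1) (ψ : ChartEmb C₀ C'.1) (y : C₀.dom),
      φ.toFun y = v ∧ ψ.toFun y = v' ∧ ∀ w, sheetMap c (φ.toFun w) = sheetMap c' (ψ.toFun w) := by
  obtain ⟨g, hs, ht, e⟩ := UnivCover.mk_eq_iff.1 h
  obtain ⟨T, y, rfl⟩ := g.exists_germAt
  have ht' := ht
  rw [T.germAt_tgt] at ht'
  rcases T with ⟨i, j, C₀, φ, ψ⟩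
  obtain rfl : i = C := congrArg Sigma.fst hs
  obtain rfl : j = C' := congrArg Sigma.fst ht'
  obtain rfl : φ.toFun y = v := eq_of_heq (Sigma.mk.inj_iff.1 hs).2
  obtain rfl : ψ.toFun y = v' := eq_of_heq (Sigma.mk.inj_iff.1 ht').2
  refine ⟨C₀, φ, ψ, y, rfl, rfl, fun w => ?_⟩
  have e' : _ = c'.mul (.inChart j u' (ψ.toFun y)) := e
  rw [← sheetMap_mul_inChart c (φ.toFun y), ← sheetMap_mul_inChart c' (ψ.toFun y), ← e']
  exact (sheetMap_mul_cls φ ψ _ w).symm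

/-- Two sheets over the same chart with a common point in `X` differ by an element of the group of
this chart. -/
theorem exists_deck_of_sheetMap_eq {C : A.charts} {u u' : C.1.dom}
    {c : HClass x₀ (⟨C, u⟩ : A.Obj)} {c' : HClass x₀ (⟨C, u'⟩ : A.Obj)} {v v' : C.1.dom}
    (h : sheetMap c v = sheetMap c' v') :
    ∃ γ ∈ C.1.G, γ v = v' ∧ ∀ w, sheetMap c' (γ w) = sheetMap c w := by
  obtain ⟨g, hs, ht, e⟩ := UnivCover.mk_eq_iff.1 h
  obtain ⟨γ, hγ, rfl, rfl⟩ := Arrow.exists_deck hs ht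
  refine ⟨γ, hγ, rfl, fun w => ?_⟩
  have e' : _ = c'.mul (.inChart C u' (γ v)) := e
  rw [← sheetMap_mul_inChart c v, ← sheetMap_mul_inChart c' (γ v), ← e']
  exact sheetMap_mul_cls (Transition.deck C hγ).φ (Transition.deck C hγ).ψ _ w

theorem sheetMap_isOpenMap {C : A.charts} {u : C.1.dom} (c : HClass x₀ (⟨C, u⟩ : A.Obj)) :
    IsOpenMap (sheetMap c) := by
  intro V hV
  refine UnivCover.isOpen_iff.2 fun C' u' c' => isOpen_iff_mem_nhds.2 ?_
  rintro v' ⟨v, hv, h⟩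
  obtain ⟨C₀, φ, ψ, y, rfl, rfl, hw⟩ := exists_chartEmb_of_sheetMap_eq h
  refine ψ.isEmb.eventually (P := fun v' => v' ∈ sheetMap c' ⁻¹' (sheetMap c '' V)) ?_
  filter_upwards [(hV.preimage φ.isEmb.continuous).mem_nhds hv] with w hwV
  exact ⟨φ.toFun w, hwV, hw w⟩

/-- The chart of `X` defined by a sheet. -/
noncomputable def sheetChart {C : A.charts} {u : C.1.dom} (c : HClass x₀ (⟨C, u⟩ : A.Obj)) :
    OrbifoldChart m (A.UnivCover x₀) :=
  C.1.lift (sheetMap c) (sheetMap_continuous c) (sheetMap_isOpenMap c) fun _ _ h =>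
    exists_deck_of_sheetMap_eq h

variable (A x₀) in
/-- The canonical atlas of `X`. -/
noncomputable def coverAtlas : OrbifoldAtlas m (A.UnivCover x₀) where
  charts := {D | ∃ (C : A.charts) (u : C.1.dom) (c : HClass x₀ (⟨C, u⟩ : A.Obj)), D = sheetChart c}
  cover x := by
    obtain ⟨C, u, c, rfl⟩ := exists_sheetMap x
    exact ⟨_, ⟨C, u, c, rfl⟩, ⟨u, rfl⟩⟩
  compat := by
    rintro _ ⟨C, u, c, rfl⟩ _ ⟨C', u', c', rfl⟩ _ ⟨⟨v, rfl⟩, ⟨v', h⟩⟩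
    obtain ⟨C₀, φ, ψ, y, hy, _, hw⟩ := exists_chartEmb_of_sheetMap_eq
      (show sheetMap c v = sheetMap c' v' from h.symm)
    -- `C₀` is a chart of `Z`, and its group may contain elements that do not preserve the sheet. A
    -- small chart inside the sheet chart, contained in the image of `φ`, takes its place.
    obtain ⟨C₁, κ, ⟨x, hx⟩, hr⟩ := (sheetChart c).exists_sub v
      φ.isEmb.isOpenEmbedding.isOpen_range ⟨y, hy⟩
    choose k hk using fun x => hr ⟨x, rfl⟩
    have hks : IsSmoothEmb k := φ.isEmb.of_comp (by
      rw [show φ.toFun ∘ k = κ.toFun from funext hk]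
      exact κ.isEmb)
    refine ⟨C₁, ⟨x, (κ.comm x).symm.trans (congrArg (sheetMap c) hx)⟩, ⟨κ⟩,
      ⟨⟨ψ.toFun ∘ k, ψ.isEmb.comp hks, fun w => ?_⟩⟩⟩
    rw [← κ.comm]
    refine (hw (k w)).symm.trans ?_
    rw [hk]
    rfl

theorem coverAtlas_isCanonical : IsCanonicalAtlas (A.coverAtlas x₀) :=
  fun C u c => ⟨sheetChart c, ⟨C, u, c, rfl⟩, rfl, fun _ _ _ => rfl⟩

theorem hasChart_sheetChart {C : A.charts} {u : C.1.dom} (c : HClass x₀ (⟨C, u⟩ : A.Obj)) :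
    (A.coverAtlas x₀).HasChart (sheetChart c) :=
  (A.coverAtlas x₀).compat _ ⟨C, u, c, rfl⟩

/-! ### `X` is Hausdorff and second countable -/

/-- Each of the finitely many elements moving `u` carries a suitable neighbourhood of `u` off
itself; these are intersected. -/
theorem _root_.Orbi.OrbifoldChart.exists_nhds_stabilizer {Z : Type u} [TopologicalSpace Z]
    (C : OrbifoldChart m Z) (u : C.dom) :
    ∃ V : Set C.dom, IsOpen V ∧ u ∈ V ∧ ∀ γ ∈ C.G, ∀ v ∈ V, γ v ∈ V → γ u = u := by
  have := C.G_finite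
  have hsep : ∀ g : C.G, ∃ N : Set C.dom, IsOpen N ∧ u ∈ N ∧ (g.1 u ≠ u → ∀ x ∈ N, g.1 x ∉ N) := by
    intro g
    by_cases hg : g.1 u = u
    · exact ⟨univ, isOpen_univ, mem_univ _, fun h => absurd hg h⟩
    · obtain ⟨P, Q, hP, hQ, h1, h2, hd⟩ := t2_separation hg
      refine ⟨Q ∩ g.1 ⁻¹' P, hQ.inter (hP.preimage (C.G_smooth _ g.2).continuous), ⟨h2, h1⟩,
        fun _ x hx hx' => disjoint_left.1 hd hx.2 hx'.1⟩
  choose N hNo huN hN using hsep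
  refine ⟨⋂ g, N g, isOpen_iInter_of_finite hNo, mem_iInter.2 huN, fun γ hγ v hv hv' => ?_⟩
  by_contra h
  exact hN ⟨γ, hγ⟩ h v (mem_iInter.1 hv _) (mem_iInter.1 hv' _)

/-- Points in different fibres are separated in `Z`. Points in one fibre lie over the same `u` on
sheets of the same chart. If the images of a small neighbourhood `V` of `u` met, the sheets would
differ by some `γ` with `γ v ∈ V` for a point `v ∈ V`; then `γ` fixes `u` and the points coincide.
-/
theorem UnivCover.t2Space [T2Space Z] : T2Space (A.UnivCover x₀) := by
  refine ⟨fun x x' hne => ?_⟩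
  by_cases h : x.proj = x'.proj
  · obtain ⟨C, u, c, rfl⟩ := exists_sheetMap x
    obtain ⟨c', rfl⟩ := exists_sheetMap_of_proj (C := C) (u := u) h.symm
    obtain ⟨V, hV, hu, hst⟩ := C.1.exists_nhds_stabilizer u
    refine ⟨_, _, sheetMap_isOpenMap c V hV, sheetMap_isOpenMap c' V hV, ⟨u, hu, rfl⟩, ⟨u, hu, rfl⟩,
      disjoint_left.2 ?_⟩
    rintro _ ⟨v, hv, rfl⟩ ⟨v', hv', h'⟩
    obtain ⟨γ, hγ, rfl, hw⟩ := exists_deck_of_sheetMap_eq h'.symm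
    refine hne ?_
    rw [← hw u, hst γ hγ v hv hv']
  · obtain ⟨P, Q, hP, hQ, h1, h2, hd⟩ := t2_separation h
    exact ⟨_, _, hP.preimage UnivCover.proj_continuous, hQ.preimage UnivCover.proj_continuous, h1, h2,
      hd.preimage _⟩

theorem _root_.Orbi.countable_reflTransGen {α : Type*} {R : α → α → Prop}
    (h : ∀ a, {b | R a b}.Countable) (a : α) : {b | Relation.ReflTransGen R a b}.Countable := by
  let F : Set α → Set α := fun S => ⋃ c ∈ S, {b | R c b}
  have h1 : ∀ n : ℕ, (F^[n] {a}).Countable := by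
    intro n
    induction n with
    | zero => exact countable_singleton a
    | succ n ih =>
      rw [Function.iterate_succ_apply']
      exact ih.biUnion fun c _ => h c
  refine (countable_iUnion h1).mono fun b hb => ?_
  have hb' : Relation.ReflTransGen R a b := hb
  induction hb' with
  | refl => exact mem_iUnion.2 ⟨0, rfl⟩
  | tail hab hbc ih =>
    obtain ⟨n, hn⟩ := mem_iUnion.1 (ih hab)
    refine mem_iUnion.2 ⟨n + 1, ?_⟩
    rw [Function.iterate_succ_apply']
    exact mem_biUnion hn hbc

/-- The sheets over the charts, each given by a class which ends at a base point of the chart. -/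
abbrev SheetIndex (x₀ : A.Obj) : Type u := Σ C : A.charts, HClass x₀ (⟨C, Classical.arbitrary C.1.dom⟩ : A.Obj)

/-- The sheet on which a class lies. -/
noncomputable def sheetIndex {y : A.Obj} (c : HClass x₀ y) : A.SheetIndex x₀ :=
  ⟨y.1, c.mul (.inChart y.1 y.2 _)⟩

theorem sheetIndex_mul_inChart {C : A.charts} {u : C.1.dom} (c : HClass x₀ (⟨C, u⟩ : A.Obj))
    (v : C.1.dom) : sheetIndex (c.mul (.inChart C u v)) = sheetIndex c := by
  rw [sheetIndex, sheetIndex, HClass.mul_assoc, HClass.inChart_mul]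

/-- Paths in charts do not change the sheet, so all sheets are reached from the first one by arrows.
Arrows starting in a countable dense set suffice, and there are countably many of them because only
finitely many lead from a given point to a given chart. -/
theorem countable_sheetIndex [Countable A.charts] : Countable (A.SheetIndex x₀) := by
  set Q : Set A.Arrow := {g | g.src.2 ∈ range (denseSeq g.src.1.1.dom)} with hQ
  have hQc : Q.Countable := by
    refine (countable_iUnion fun C : A.charts => countable_iUnion fun n : ℕ =>
      countable_iUnion fun C' : A.charts =>
        (finite_arrows (⟨C, denseSeq C.1.dom n⟩ : A.Obj) C').countable).mono ?_
    rintro g ⟨n, hn⟩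
    refine mem_iUnion.2 ⟨g.src.1, mem_iUnion.2 ⟨n, mem_iUnion.2 ⟨g.tgt.1, ?_, rfl⟩⟩⟩
    rw [hn]
  let R : A.SheetIndex x₀ → A.SheetIndex x₀ → Prop := fun a b =>
    ∃ (g : A.Arrow) (x y : A.Obj) (hs : g.src = x) (ht : g.tgt = y) (c : HClass x₀ x),
      a = sheetIndex c ∧ b = sheetIndex (c.mul (.ofArr g hs ht))
  have hR : ∀ a, {b | R a b}.Countable := by
    intro a
    refine (hQc.biUnion fun g _ => (?_ : {b | ∃ (x y : A.Obj) (hs : g.src = x) (ht : g.tgt = y)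
      (c : HClass x₀ x), a = sheetIndex c ∧ b = sheetIndex (c.mul (.ofArr g hs ht))}.Countable)).mono ?_
    -- The index `a` and the arrow `g` determine `c`: the path factor in `a` depends only on the
    -- source of `g` and can be cancelled.
    · refine Subsingleton.countable ?_
      rintro _ ⟨_, _, rfl, rfl, c, rfl, rfl⟩ _ ⟨_, _, rfl, rfl, c', h, rfl⟩
      have h1 := eq_of_heq (Sigma.mk.inj_iff.1 h).2
      rw [HClass.mul_right_cancel h1]
    · rintro _ ⟨g, x, z, hs, ht, c, rfl, rfl⟩
      obtain ⟨T, y, rfl⟩ := g.exists_germAt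
      have hs' : T.s y = x := hs
      have ht' : T.t y = z := (T.germAt_tgt y).symm.trans ht
      subst hs'
      subst ht'
      -- Slide the arrow along the domain of its transition until its source lies in the dense
      -- sequence; neither sheet changes.
      obtain ⟨n, y', hy'⟩ := (denseRange_denseSeq T.i.1.dom).exists_mem_open
        (s := range T.φ.toFun) T.φ.isEmb.isOpenEmbedding.isOpen_range ⟨_, y, rfl⟩
      refine mem_biUnion (x := T.germAt y') ⟨n, hy'.symm⟩
        ⟨T.s y', T.t y', rfl, T.germAt_tgt y', c.mul (.inChart T.i (T.φ.toFun y) (T.φ.toFun y')), ?_, ?_⟩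
      · exact (sheetIndex_mul_inChart _ _).symm
      · have h1 := congrArg (fun d => sheetIndex (HClass.mul c d)) (HClass.inChart_mul_germAt T y y')
        have h2 : sheetIndex (c.mul ((T.cls y).mul (.inChart T.j (T.ψ.toFun y) (T.ψ.toFun y')))) =
            sheetIndex (c.mul (T.cls y)) :=
          (congrArg sheetIndex (HClass.mul_assoc c _ _).symm).trans
            (sheetIndex_mul_inChart (c.mul (T.cls y)) _)
        refine (h1.trans h2).symm.trans (congrArg sheetIndex ?_)
        exact (HClass.mul_assoc _ _ _).symm
  have hall : ∀ {y : A.Obj} (c : HClass x₀ y),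
      Relation.ReflTransGen R (sheetIndex (HClass.one x₀)) (sheetIndex c) := by
    intro y c
    refine HClass.induction_right (S := fun y c => Relation.ReflTransGen R (sheetIndex (HClass.one x₀))
      (sheetIndex c)) .refl (fun g c hc => hc.tail ⟨g, _, _, rfl, rfl, c, rfl, rfl⟩) (fun C u v c hc => ?_) c
    rwa [sheetIndex_mul_inChart]
  refine countable_univ_iff.1 ((countable_reflTransGen hR (sheetIndex (HClass.one x₀))).mono ?_)
  rintro ⟨C, c⟩ _
  have h1 := hall c
  have h2 : sheetIndex c = ⟨C, c⟩ := congrArg (Sigma.mk C) (HClass.mul_inChart_self c)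
  rwa [h2] at h1

theorem UnivCover.secondCountableTopology [Countable A.charts] :
    SecondCountableTopology (A.UnivCover x₀) := by
  have := countable_sheetIndex (A := A) (x₀ := x₀)
  have hc : Continuous fun p : Σ a : A.SheetIndex x₀, a.1.1.dom => sheetMap p.1.2 p.2 :=
    continuous_sigma fun a => sheetMap_continuous a.2
  have ho : IsOpenMap fun p : Σ a : A.SheetIndex x₀, a.1.1.dom => sheetMap p.1.2 p.2 :=
    isOpenMap_sigma.2 fun a => sheetMap_isOpenMap a.2
  have hs : Surjective fun p : Σ a : A.SheetIndex x₀, a.1.1.dom => sheetMap p.1.2 p.2 := by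
    intro x
    obtain ⟨C, u, c, rfl⟩ := exists_sheetMap x
    exact ⟨⟨⟨C, c.mul (.inChart C u _)⟩, u⟩, congrFun (sheetMap_mul_inChart c _) u⟩
  exact (IsOpenQuotientMap.mk hs hc ho).isQuotientMap.secondCountableTopology ho

end SimplyConnected

end Orbi.OrbifoldAtlas

/-! ### Proper discontinuity, transport of atlases, and the quotient by `Γ` -/

namespace Orbi

theorem SmoothMap.id {m : ℕ} {U : Opens (Euc m)} : SmoothMap (fun x : U => x) := contMDiff_id

/-- An action on a Hausdorff space is properly discontinuous if this holds locally. -/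
theorem properlyDiscontinuousSMul_of_nhds {Γ X : Type*} [SMul Γ X] [TopologicalSpace X]
    (h : ∀ x y : X, ∃ U ∈ 𝓝 x, ∃ V ∈ 𝓝 y, {γ : Γ | ((γ • ·) '' U ∩ V).Nonempty}.Finite) :
    ProperlyDiscontinuousSMul Γ X := by
  refine ⟨fun {K L} hK hL => ?_⟩
  choose U hU V hV hfin using h
  -- For fixed `x`, finitely many sets `V x y` cover `L`, and the intersection of the corresponding
  -- `U x y` serves for all of `L`. Compactness of `K` then removes the dependence on `x`.
  have h1 : ∀ x : X, ∃ W ∈ 𝓝 x, {γ : Γ | ((γ • ·) '' W ∩ L).Nonempty}.Finite := by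
    intro x
    obtain ⟨t, -, ht⟩ := hL.elim_nhds_subcover (V x) fun y _ => hV x y
    refine ⟨⋂ y ∈ t, U x y, (biInter_finset_mem t).2 fun y _ => hU x y, ?_⟩
    refine (t.finite_toSet.biUnion fun y _ => hfin x y).subset ?_
    rintro γ ⟨_, ⟨a, ha, rfl⟩, hL'⟩
    obtain ⟨y, hy, hay⟩ := mem_iUnion₂.1 (ht hL')
    exact mem_biUnion (x := y) hy ⟨_, ⟨a, mem_iInter₂.1 ha y hy, rfl⟩, hay⟩
  choose W hW hWfin using h1
  obtain ⟨t, -, ht⟩ := hK.elim_nhds_subcover W fun y _ => hW y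
  refine (t.finite_toSet.biUnion fun y _ => hWfin y).subset ?_
  rintro γ ⟨_, ⟨a, ha, rfl⟩, hL'⟩
  obtain ⟨y, hy, hay⟩ := mem_iUnion₂.1 (ht ha)
  exact mem_biUnion (x := y) hy ⟨_, ⟨a, hay, rfl⟩, hL'⟩

/-- The image of an orbifold chart under a homeomorphism. -/
def OrbifoldChart.map {m : ℕ} {Y : Type u} {Z : Type v} [TopologicalSpace Y] [TopologicalSpace Z]
    (e : Y ≃ₜ Z) (C : OrbifoldChart m Y) : OrbifoldChart m Z where
  dom := C.dom
  dom_connected := C.dom_connected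
  G := C.G
  G_finite := C.G_finite
  G_smooth := C.G_smooth
  proj := e ∘ C.proj
  proj_cont := e.continuous.comp C.proj_cont
  proj_open := e.isOpenMap.comp C.proj_open
  proj_eq_iff x y := e.injective.eq_iff.trans (C.proj_eq_iff x y)

/-- The image of an orbifold atlas under a homeomorphism. -/
def OrbifoldAtlas.map {m : ℕ} {Y : Type u} {Z : Type v} [TopologicalSpace Y] [TopologicalSpace Z]
    (e : Y ≃ₜ Z) (A : OrbifoldAtlas m Y) : OrbifoldAtlas m Z where
  charts := OrbifoldChart.map e '' A.charts
  cover z := by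
    obtain ⟨C, hC, x, hx⟩ := A.cover (e.symm z)
    exact ⟨_, ⟨C, hC, rfl⟩, x, (congrArg e hx).trans (e.apply_symm_apply z)⟩
  compat := by
    rintro _ ⟨C, hC, rfl⟩ _ ⟨D, hD, rfl⟩ _ ⟨⟨c, rfl⟩, d, hd⟩
    obtain ⟨C₀, ⟨x, hx⟩, ⟨φ⟩, ⟨ψ⟩⟩ := A.compat C hC D hD (C.proj c) ⟨⟨c, rfl⟩, d, e.injective hd⟩
    exact ⟨C₀.map e, ⟨x, congrArg e hx⟩, ⟨φ.toFun, φ.isEmb, fun x => congrArg e (φ.comm x)⟩,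
      ⟨ψ.toFun, ψ.isEmb, fun x => congrArg e (ψ.comm x)⟩⟩

theorem OrbifoldAtlas.isOrbIso_map {m : ℕ} {Y : Type u} {Z : Type v} [TopologicalSpace Y]
    [TopologicalSpace Z] (e : Y ≃ₜ Z) (A : OrbifoldAtlas m Z) :
    IsOrbIso (A.map e.symm) A e := by
  refine ⟨⟨e.continuous, fun y => ?_⟩, e.symm, ⟨e.symm.continuous, fun z => ?_⟩, e.symm_apply_apply,
    e.apply_symm_apply⟩
  · obtain ⟨C, hC, x, hx⟩ := A.cover (e y)
    refine ⟨C.map e.symm, C, (A.map e.symm).compat _ ⟨C, hC, rfl⟩, A.compat C hC, ⟨x, ?_⟩, ⟨x, hx⟩,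
      fun x => x, .id, fun x => (e.apply_symm_apply _).symm⟩
    exact (congrArg e.symm hx).trans (e.symm_apply_apply y)
  · obtain ⟨C, hC, x, rfl⟩ := A.cover z
    exact ⟨C, C.map e.symm, A.compat C hC, (A.map e.symm).compat _ ⟨C, hC, rfl⟩, ⟨x, rfl⟩, ⟨x, rfl⟩,
      fun x => x, .id, fun x => rfl⟩

namespace OrbifoldAtlas

variable {m : ℕ} {Z : Type u} [TopologicalSpace Z] {A : OrbifoldAtlas m Z}
  [∀ C : A.charts, SimplyConnectedSpace C.1.dom] {x₀ : A.Obj}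

/-! ### The action of the fundamental group -/

theorem orbSmooth_smul (γ : A.Pi1 x₀) :
    OrbSmooth (A.coverAtlas x₀) (A.coverAtlas x₀) fun x => γ • x := by
  refine ⟨UnivCover.continuous_iff.2 fun C u c => ?_, fun x => ?_⟩
  · rw [show (fun x => γ • x) ∘ sheetMap c = _ from funext (smul_sheetMap γ c)]
    exact sheetMap_continuous _
  · obtain ⟨C, u, c, rfl⟩ := exists_sheetMap x
    exact ⟨sheetChart c, sheetChart (HClass.mul γ c), hasChart_sheetChart _, hasChart_sheetChart _,
      ⟨u, rfl⟩, ⟨u, (smul_sheetMap γ c u).symm⟩, fun x => x, .id, fun x => (smul_sheetMap γ c x).symm⟩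

/-- If `γ` makes the sheet of `c` meet the sheet of `c'` over the same chart, the translated sheet
map is that of `c'` composed with an element `k` of the finite chart group. As sheet maps determine
classes, `k` determines `γ`. -/
theorem properlyDiscontinuousSMul [T2Space Z] :
    ProperlyDiscontinuousSMul (A.Pi1 x₀) (A.UnivCover x₀) := by
  refine properlyDiscontinuousSMul_of_nhds fun x y => ?_
  by_cases h : x.proj = y.proj
  · obtain ⟨C, u, c, rfl⟩ := exists_sheetMap x
    obtain ⟨c', rfl⟩ := exists_sheetMap_of_proj (C := C) (u := u) h.symm
    refine ⟨_, (sheetMap_isOpenMap c).isOpen_range.mem_nhds ⟨u, rfl⟩, _,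
      (sheetMap_isOpenMap c').isOpen_range.mem_nhds ⟨u, rfl⟩, ?_⟩
    have := C.1.G_finite
    have h1 : ∀ γ : A.Pi1 x₀, (((γ • ·) '' range (sheetMap c)) ∩ range (sheetMap c')).Nonempty →
        ∃ k : C.1.G, sheetMap (HClass.mul γ c) = sheetMap c' ∘ k.1 := by
      rintro γ ⟨_, ⟨_, ⟨v, rfl⟩, rfl⟩, ⟨v', h'⟩⟩
      dsimp only at h'
      rw [smul_sheetMap] at h'
      obtain ⟨k, hk, -, hw⟩ := exists_deck_of_sheetMap_eq h'.symm
      exact ⟨⟨k, hk⟩, funext fun w => (hw w).symm⟩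
    choose! k hk using h1
    refine Set.Finite.of_injOn (f := k) (t := univ) (fun _ _ => trivial) ?_ finite_univ
    intro γ hγ γ' hγ' e
    have h2 : sheetMap (HClass.mul γ c) = sheetMap (HClass.mul γ' c) := by
      rw [hk γ hγ, hk γ' hγ', e]
    exact HClass.mul_right_cancel (sheetMap_injective h2)
  · obtain ⟨P, Q, hP, hQ, h1, h2, hd⟩ := t2_separation h
    refine ⟨_, (hP.preimage UnivCover.proj_continuous).mem_nhds h1, _,
      (hQ.preimage UnivCover.proj_continuous).mem_nhds h2, ?_⟩
    convert finite_empty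
    refine eq_empty_iff_forall_notMem.2 ?_
    rintro γ ⟨_, ⟨a, ha, rfl⟩, ha'⟩
    obtain ⟨C, u, c, rfl⟩ := exists_sheetMap a
    refine disjoint_left.1 hd ha ?_
    dsimp only at ha'
    rwa [smul_sheetMap] at ha'

/-! ### The quotient by the fundamental group -/

/-- Both points lie over the same `u`, on sheets of classes `c` and `c'` with the same ends; the
loop `c c'⁻¹` carries one to the other. -/
theorem exists_smul_eq_of_proj_eq {x y : A.UnivCover x₀} (h : x.proj = y.proj) :
    ∃ γ : A.Pi1 x₀, γ • y = x := by
  obtain ⟨C, u, c, rfl⟩ := exists_sheetMap x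
  obtain ⟨c', rfl⟩ := exists_sheetMap_of_proj (C := C) (u := u) h.symm
  refine ⟨c.mul c'.inv, ?_⟩
  refine (smul_sheetMap _ c' u).trans (congrFun (congrArg sheetMap ?_) u)
  exact HClass.inv_mul_cancel_right c c'

theorem proj_isOpenMap : IsOpenMap (UnivCover.proj (A := A) (x₀ := x₀)) := by
  intro V hV
  refine isOpen_iff_mem_nhds.2 ?_
  rintro _ ⟨x, hx, rfl⟩
  obtain ⟨C, u, c, rfl⟩ := exists_sheetMap x
  refine mem_of_superset ((C.1.proj_open _ (hV.preimage (sheetMap_continuous c))).mem_nhds ⟨u, hx, rfl⟩) ?_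
  rintro _ ⟨v, hv, rfl⟩
  exact ⟨_, hv, rfl⟩

variable [ConnectedSpace Z]

variable (A x₀) in
/-- The homeomorphism `Γ \ X ≃ Z` induced by `p`. -/
noncomputable def deckHomeo : A.DeckQuotient x₀ ≃ₜ Z :=
  (Equiv.ofBijective (DeckQuotient.proj (A := A) (x₀ := x₀)) ⟨by
      rintro ⟨x⟩ ⟨y⟩ h
      obtain ⟨γ, hγ⟩ := exists_smul_eq_of_proj_eq (x := x) (y := y) h
      exact Quotient.sound ⟨γ, hγ⟩, fun z => by
      obtain ⟨x, rfl⟩ := UnivCover.proj_surjective (A := A) (x₀ := x₀) z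
      exact ⟨DeckQuotient.mk x, rfl⟩⟩).toHomeomorphOfContinuousOpen
    (UnivCover.proj_continuous.quotient_lift _) fun V hV => by
      refine (congrArg IsOpen ?_).mpr
        (proj_isOpenMap (A := A) (x₀ := x₀) _ (hV.preimage continuous_quotient_mk'))
      refine Set.ext fun z => ⟨?_, ?_⟩
      · rintro ⟨⟨x⟩, hx, rfl⟩
        exact ⟨x, hx, rfl⟩
      · rintro ⟨x, hx, rfl⟩
        exact ⟨_, hx, rfl⟩

/-- The chart of the quotient has the domain of the sheet chart, but the full group of `C` instead
of the subgroup preserving the sheet. -/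
theorem isInducedAtlas_deckHomeo : IsInducedAtlas (A.coverAtlas x₀)
    (A.map (A.deckHomeo x₀).symm) DeckQuotient.mk := by
  intro x
  obtain ⟨C, u, c, rfl⟩ := exists_sheetMap x
  refine ⟨sheetChart c, C.1.map (A.deckHomeo x₀).symm, hasChart_sheetChart c,
    (A.map (A.deckHomeo x₀).symm).compat _ ⟨C.1, C.2, rfl⟩, ⟨u, rfl⟩, rfl, fun v h h' => ?_⟩
  exact (A.deckHomeo x₀).symm_apply_eq.2 rfl

end OrbifoldAtlas

end Orbi

/-! ### Connectedness of `X` and the covering property of `p` -/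

namespace Orbi

/-- The other members of the cover form an open set disjoint from `U`, so a connected subset of `S`
meeting `U` stays in `U`. -/
theorem connectedComponentIn_eq_of_cover {X : Type*} [TopologicalSpace X] {S : Set X} {𝒰 : Set (Set X)}
    (ho : ∀ U ∈ 𝒰, IsOpen U) (hc : ∀ U ∈ 𝒰, IsPreconnected U) (hs : ∀ U ∈ 𝒰, U ⊆ S)
    (hcov : ∀ x ∈ S, ∃ U ∈ 𝒰, x ∈ U)
    (heq : ∀ U ∈ 𝒰, ∀ V ∈ 𝒰, (U ∩ V).Nonempty → U = V) {U : Set X} (hU : U ∈ 𝒰) {y : X} (hy : y ∈ U) :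
    U = connectedComponentIn S y := by
  refine Subset.antisymm ((hc U hU).subset_connectedComponentIn hy (hs U hU)) ?_
  have hyS := hs U hU hy
  refine isPreconnected_connectedComponentIn.subset_left_of_subset_union (ho U hU)
    (v := ⋃₀ {V ∈ 𝒰 | V ≠ U}) (isOpen_sUnion fun V hV => ho V hV.1) ?_ ?_
    ⟨y, mem_connectedComponentIn hyS, hy⟩
  · refine disjoint_sUnion_right.2 fun V hV => ?_
    by_contra h
    exact hV.2 (heq _ hU _ hV.1 (not_disjoint_iff_nonempty_inter.1 h)).symm
  · intro x hx
    obtain ⟨V, hV, hxV⟩ := hcov x (connectedComponentIn_subset _ _ hx)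
    by_cases h : V = U
    · exact Or.inl (h ▸ hxV)
    · exact Or.inr ⟨V, ⟨hV, h⟩, hxV⟩

namespace OrbifoldAtlas

variable {m : ℕ} {Z : Type u} [TopologicalSpace Z] {A : OrbifoldAtlas m Z}
  [∀ C : A.charts, SimplyConnectedSpace C.1.dom] {x₀ : A.Obj}

/-- Arrows do not change the point of `X`, and paths in charts move it within the connected image of
a sheet. -/
theorem UnivCover.connectedSpace : ConnectedSpace (A.UnivCover x₀) := by
  refine connectedSpace_iff_connectedComponent.2
    ⟨UnivCover.mk ⟨x₀, .one x₀⟩, eq_univ_of_forall ?_⟩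
  rintro ⟨⟨y, c⟩⟩
  refine HClass.induction_right (S := fun y c => UnivCover.mk ⟨y, c⟩ ∈
    connectedComponent (UnivCover.mk ⟨x₀, .one x₀⟩)) mem_connectedComponent (fun g c hc => ?_)
    (fun C u v c hc => ?_) c
  · have h : (UnivCover.mk ⟨g.src, c⟩ : A.UnivCover x₀) = UnivCover.mk ⟨g.tgt, c.mul (.ofArrow g)⟩ :=
      UnivCover.mk_eq_iff.2 ⟨g, rfl, rfl, rfl⟩
    rwa [← h]
  · have hc' : sheetMap c u ∈ connectedComponent (UnivCover.mk ⟨x₀, .one x₀⟩) := by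
      rwa [sheetMap_self]
    rw [connectedComponent_eq hc']
    exact (isPreconnected_range (sheetMap_continuous c)).subset_connectedComponent ⟨u, rfl⟩ ⟨v, rfl⟩

/-- Every chart of the atlas is evenly covered. The images of the sheets over it are open and
connected, and two of them that meet are equal because the sheets differ by a group element; so they
are the components. -/
theorem UnivCover.isOrbCovering :
    IsOrbCovering (A.coverAtlas x₀) A (UnivCover.proj (A := A) (x₀ := x₀)) := by
  refine ⟨UnivCover.proj_continuous, fun z => ?_⟩
  obtain ⟨C, hC, v, rfl⟩ := A.cover z
  refine ⟨C, A.compat C hC, ⟨v, rfl⟩, ?_⟩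
  rintro y ⟨u, hu⟩
  obtain ⟨c, rfl⟩ := exists_sheetMap_of_proj (C := ⟨C, hC⟩) (u := u) hu.symm
  refine ⟨sheetChart c, hasChart_sheetChart c, ?_, rfl, fun _ _ _ => rfl, fun g hg =>
    ⟨g, hg.1, fun _ _ _ => rfl⟩⟩
  refine connectedComponentIn_eq_of_cover (𝒰 := {U | ∃ (u : C.dom) (c : HClass x₀ (⟨⟨C, hC⟩, u⟩ : A.Obj)),
    U = range (sheetMap c)}) ?_ ?_ ?_ ?_ ?_ ⟨u, c, rfl⟩ ⟨u, rfl⟩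
  · rintro _ ⟨u, c, rfl⟩
    exact (sheetMap_isOpenMap c).isOpen_range
  · rintro _ ⟨u, c, rfl⟩
    exact isPreconnected_range (sheetMap_continuous c)
  · rintro _ ⟨u, c, rfl⟩ _ ⟨v, rfl⟩
    exact ⟨v, rfl⟩
  · rintro x ⟨v, hv⟩
    obtain ⟨c, rfl⟩ := exists_sheetMap_of_proj (C := ⟨C, hC⟩) (u := v) hv.symm
    exact ⟨_, ⟨v, c, rfl⟩, ⟨v, rfl⟩⟩
  · rintro _ ⟨u, c, rfl⟩ _ ⟨u', c', rfl⟩ ⟨_, ⟨v, rfl⟩, v', h⟩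
    obtain ⟨γ, hγ, -, hw⟩ := exists_deck_of_sheetMap_eq h
    rw [← γ.surjective.range_comp (sheetMap c)]
    exact congrArg range (funext hw)

end OrbifoldAtlas

end Orbi

namespace Orbi

/-! ### The monodromy principle for germs -/

section Monodromy

variable {U : Type u} {Y : Type v} [TopologicalSpace U]

/-- Pairs of a map and a point at which its germ has the property `L`. -/
abbrev GermRep (L : (U → Y) → U → Prop) : Type max u v := Σ F : U → Y, {x : U // L F x}

/-- Equality of germs. -/
def germSetoid (L : (U → Y) → U → Prop) : Setoid (GermRep L) where
  r a b := a.2.1 = b.2.1 ∧ a.1 =ᶠ[𝓝 a.2.1] b.1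
  iseqv := ⟨fun _ => ⟨rfl, .refl _ _⟩, fun h => ⟨h.1.symm, h.1 ▸ h.2.symm⟩,
    fun h h' => ⟨h.1.trans h'.1, h.2.trans (h.1 ▸ h'.2)⟩⟩

/-- The étalé space of the germs with the property `L`. -/
abbrev GermSpace (L : (U → Y) → U → Prop) : Type max u v := Quotient (germSetoid L)

namespace GermSpace

variable {L : (U → Y) → U → Prop}

/-- The germ of `F` at `x`. -/
def mk (F : U → Y) (x : U) (h : L F x) : GermSpace L := Quotient.mk (germSetoid L) ⟨F, x, h⟩

theorem mk_eq_iff {F F' : U → Y} {x x' : U} {h : L F x} {h' : L F' x'} :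
    mk F x h = mk F' x' h' ↔ x = x' ∧ F =ᶠ[𝓝 x] F' := Quotient.eq

theorem exists_mk (e : GermSpace L) : ∃ F x h, mk F x h = e := by
  rcases e with ⟨F, x, h⟩
  exact ⟨F, x, h, rfl⟩

/-- The point at which a germ is defined. -/
def base : GermSpace L → U := Quotient.lift (fun a => a.2.1) fun _ _ h => h.1

theorem continuous_section (F : U → Y) :
    Continuous fun x : {x : U // L F x} => mk F x.1 x.2 := by
  have h : Continuous fun x : {x : U // L F x} => (⟨F, x⟩ : GermRep L) := @continuous_sigmaMk _ (fun F : U → Y => {x : U // L F x}) _ F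
  exact (continuous_quotient_mk' (s := germSetoid L)).comp h

theorem base_continuous : Continuous (base : GermSpace L → U) :=
  Continuous.quotient_lift (continuous_sigma fun _ => continuous_subtype_val) _

theorem isOpen_iff {S : Set (GermSpace L)} :
    IsOpen S ↔ ∀ F : U → Y, IsOpen {x : {x : U // L F x} | mk F x.1 x.2 ∈ S} := by
  rw [← isQuotientMap_quotient_mk'.isOpen_preimage, isOpen_sigma_iff]
  rfl

/-- Pulled back along the section of another map `F'`, this set becomes the set of points of `V` at
which `F` and `F'` have the same germ, an open condition. -/
theorem isOpen_section {F : U → Y} {V : Set U} (hV : IsOpen V)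
    (hFV : ∀ x ∈ V, L F x) : IsOpen {e : GermSpace L | ∃ x, ∃ h : x ∈ V, mk F x (hFV x h) = e} := by
  refine isOpen_iff.2 fun F' => ?_
  have h1 : IsOpen {x | x ∈ V ∧ F =ᶠ[𝓝 x] F'} :=
    hV.inter (isOpen_iff_mem_nhds.2 fun x hx => eventually_eventually_nhds.2 hx)
  convert h1.preimage (continuous_subtype_val (p := L F')) using 1
  ext x
  simp only [mem_ofPred_eq, mem_preimage, mk_eq_iff]
  constructor
  · rintro ⟨y, hy, rfl, h⟩
    exact ⟨hy, h⟩
  · rintro ⟨hy, h⟩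
    exact ⟨x, hy, rfl, h⟩

/-- With `J` discrete, the sections identify `N × J` with the part of the germ space above `N`:
surjectivity is extension of germs over `N`, injectivity is uniqueness of the extension. -/
theorem isEvenlyCovered {N : Set U} (hN : IsOpen N) {v : U} (hv : v ∈ N)
    {J : Type max u v} (s : J → U → Y) (hs : ∀ i, ∀ x ∈ N, L (s i) x)
    (hsurj : ∀ x ∈ N, ∀ F, L F x → ∃ i, s i =ᶠ[𝓝 x] F)
    (hinj : ∀ x ∈ N, ∀ i j, s i =ᶠ[𝓝 x] s j → i = j) :
    IsEvenlyCovered (base : GermSpace L → U) v (base ⁻¹' {v} : Set (GermSpace L)) := by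
  let _ : TopologicalSpace J := ⊥
  have : DiscreteTopology J := ⟨rfl⟩
  let f : N × J → (base ⁻¹' N : Set (GermSpace L)) := fun a => ⟨mk (s a.2) a.1 (hs a.2 a.1 a.1.2), a.1.2⟩
  have hf : Bijective f := by
    constructor
    · rintro ⟨x, i⟩ ⟨y, j⟩ h
      obtain ⟨h1, h2⟩ := mk_eq_iff.1 (congrArg Subtype.val h)
      obtain rfl := Subtype.ext h1
      rw [hinj x x.2 i j h2]
    · rintro ⟨e, he⟩
      obtain ⟨F, x, h, rfl⟩ := e.exists_mk
      obtain ⟨i, hi⟩ := hsurj x he F h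
      exact ⟨⟨⟨x, he⟩, i⟩, Subtype.ext (mk_eq_iff.2 ⟨rfl, hi⟩)⟩
  have hc : Continuous f := by
    refine Continuous.subtype_mk (continuous_prod_of_discrete_right.2 fun i => ?_) _
    exact (continuous_section (s i)).comp (continuous_subtype_val.subtype_mk fun x : N => hs i x x.2)
  have ho : IsOpenMap f := by
    refine IsOpenMap.of_nhds_le ?_
    rintro ⟨x, i⟩ S hS
    have h1 : {y : N | f (y, i) ∈ S} ∈ 𝓝 x :=
      (Continuous.prodMk_left i).continuousAt hS
    obtain ⟨V, hVS, hV, hxV⟩ := mem_nhds_iff.1 (hN.isOpenEmbedding_subtypeVal.image_mem_nhds.2 h1)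
    have hVN : ∀ y ∈ V, y ∈ N := by
      intro y hy
      obtain ⟨z, -, rfl⟩ := hVS hy
      exact z.2
    refine mem_of_superset (((isOpen_section hV fun y hy => hs i y (hVN y hy)).preimage
      continuous_subtype_val).mem_nhds ⟨x, hxV, rfl⟩) ?_
    rintro ⟨e, he⟩ ⟨y, hy, rfl⟩
    obtain ⟨z, hz, hzy⟩ := hVS hy
    obtain rfl : z = ⟨y, hVN y hy⟩ := Subtype.ext hzy
    exact hz
  suffices h : IsEvenlyCovered (base : GermSpace L → U) v J from h.to_isEvenlyCovered_preimage
  refine ⟨inferInstance, N, hv, hN,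
    hN.preimage base_continuous, ((Equiv.ofBijective f hf).toHomeomorphOfContinuousOpen hc ho).symm, ?_⟩
  intro e
  obtain ⟨a, rfl⟩ := hf.surjective e
  change ((Equiv.ofBijective f hf).symm (f a)).1.1 = _
  rw [Equiv.ofBijective_symm_apply_apply]
  rfl

/-- The value of a germ. -/
def value : GermSpace L → Y := Quotient.lift (fun a => a.1 a.2.1) fun a b h => by
  rw [← h.1]
  exact h.2.self_of_nhds

end GermSpace

/-- On a simply connected space, a germ extends to a global section if sections extend uniquely over
the sets of an open covering. -/
theorem exists_global_of_germ [SimplyConnectedSpace U] [LocallyPathConnectedSpace U]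
    {L : (U → Y) → U → Prop} (hL : ∀ F, IsOpen {x | L F x})
    (hcongr : ∀ F F' x, F =ᶠ[𝓝 x] F' → L F x → L F' x)
    (H : ∀ v, ∃ N : Set U, IsOpen N ∧ v ∈ N ∧
      (∀ w ∈ N, ∀ F, L F w → ∃ F', (∀ x ∈ N, L F' x) ∧ F' =ᶠ[𝓝 w] F) ∧
      ∀ F F', (∀ x ∈ N, L F x) → (∀ x ∈ N, L F' x) → ∀ w ∈ N, F =ᶠ[𝓝 w] F' → EqOn F F' N)
    {v : U} {F : U → Y} (hF : L F v) : ∃ F', (∀ x, L F' x) ∧ F' =ᶠ[𝓝 v] F := by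
  classical
  have hcov : IsCoveringMap (GermSpace.base : GermSpace L → U) := by
    intro x
    obtain ⟨N, hN, hx, h1, h2⟩ := H x
    -- Sections over `N` are normalized to be constant outside `N`, so that equal germs at a point
    -- of `N` give equal indices. The constant `F v` is merely an available element of `Y`.
    refine GermSpace.isEvenlyCovered hN hx
      (J := {F' : U → Y // (∀ x ∈ N, L F' x) ∧ ∀ x ∉ N, F' x = F v}) Subtype.val (fun i => i.2.1) ?_ ?_
    · intro w hw G hG
      obtain ⟨G', hG', hGG⟩ := h1 w hw G hG
      have h3 : ∀ y ∈ N, N.piecewise G' (fun _ => F v) =ᶠ[𝓝 y] G' := fun y hy =>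
        eventually_of_mem (hN.mem_nhds hy) fun z hz => N.piecewise_eq_of_mem _ _ hz
      exact ⟨⟨N.piecewise G' fun _ => F v, fun y hy => hcongr _ _ y (h3 y hy).symm (hG' y hy),
        fun y hy => N.piecewise_eq_of_notMem _ _ hy⟩, (h3 w hw).trans hGG⟩
    · intro w hw i j hij
      refine Subtype.ext (funext fun y => ?_)
      by_cases hy : y ∈ N
      · exact h2 _ _ i.2.1 j.2.1 w hw hij hy
      · rw [i.2.2 y hy, j.2.2 y hy]
  -- The identity of the simply connected space `U` lifts to the covering by germs, starting at the
  -- germ of `F`. The values of the germs `τ y` form the global section.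
  obtain ⟨τ, ⟨hτv, hτ⟩, -⟩ := hcov.existsUnique_continuousMap_lifts (.id U) v
    (GermSpace.mk F v hF) rfl
  have key : ∀ (x : U) (G : U → Y) (h : L G x), GermSpace.mk G x h = τ x →
      (fun y => (τ y).value) =ᶠ[𝓝 x] G := by
    intro x G h hx
    have h1 := (GermSpace.isOpen_section (hL G) (F := G) fun _ h => h).preimage τ.continuous
    filter_upwards [h1.mem_nhds ⟨x, h, hx⟩] with y hy
    obtain ⟨z, hz, hzy⟩ := hy
    have h2 : z = y := (congrArg GermSpace.base hzy).trans (congrFun hτ y)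
    subst h2
    rw [← hzy]
    rfl
  refine ⟨fun y => (τ y).value, fun x => ?_, key v F hF hτv.symm⟩
  obtain ⟨G, y, h, hy⟩ := (τ x).exists_mk
  have h2 : y = x := (congrArg GermSpace.base hy).trans (congrFun hτ x)
  subst h2
  exact hcongr _ _ _ (key y G h hy).symm h

end Monodromy

/-! ### Lifting charts along orbifold coverings -/

section Lift

variable {m : ℕ} {Y : Type u} {Z : Type v} [TopologicalSpace Y] [TopologicalSpace Z]
  {A' : OrbifoldAtlas m Y} {A : OrbifoldAtlas m Z} {q : Y → Z}

/-- A germ of étale lift of a chart extends to the whole chart if this is simply connected. -/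
theorem IsOrbCovering.exists_lift_of_germ [T2Space Y] (hq : IsOrbCovering A' A q)
    {C : OrbifoldChart m Z} [SimplyConnectedSpace C.dom] (hC : A.HasChart C) {v : C.dom}
    {f : C.dom → Y} (hf : EtaleAt A' f v) (hqf : ∀ᶠ x in 𝓝 v, q (f x) = C.proj x) :
    ∃ f' : C.dom → Y, (∀ x, EtaleAt A' f' x) ∧ (∀ x, q (f' x) = C.proj x) ∧ f' =ᶠ[𝓝 v] f := by
  have : LocallyPathConnectedSpace C.dom := C.dom.isOpen.locallyPathConnectedSpace
  suffices h : ∃ f' : C.dom → Y, (∀ x, EtaleAt A' f' x ∧ ∀ᶠ y in 𝓝 x, q (f' y) = C.proj y) ∧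
      f' =ᶠ[𝓝 v] f by
    obtain ⟨f', hf', h⟩ := h
    exact ⟨f', fun x => (hf' x).1, fun x => (hf' x).2.self_of_nhds, h⟩
  refine exists_global_of_germ
    (L := fun F u => EtaleAt A' F u ∧ ∀ᶠ x in 𝓝 u, q (F x) = C.proj x) ?_ ?_ ?_ ⟨hf, hqf⟩
  · exact fun F => isOpen_iff_mem_nhds.2 fun x hx => hx.1.eventually.and hx.2.eventually_nhds
  · intro F F' x h hF
    refine ⟨hF.1.congr h, ?_⟩
    filter_upwards [h, hF.2] with y hy hy'
    rwa [← hy]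
  intro v
  obtain ⟨D, hD, ⟨d, hd⟩, hlift⟩ := hq.exists_lift (C.proj v)
  -- A neighbourhood of the point that embeds into an evenly covered chart `D` as well. On it every
  -- germ of a lift has the form `π ∘ g ∘ φ`, which is defined on all of `N`.
  obtain ⟨N, i, φ, n, hN, hi, hφ, rfl, rfl, hx⟩ := (EtaleAt.of_hasChart hC v).exists_common
    (EtaleAt.of_hasChart hD d) hd.symm
  have := preconnectedSpace_of_isConnected hN
  refine ⟨range i, hi.isOpenEmbedding.isOpen_range, ⟨n, rfl⟩, ?_, ?_⟩
  · rintro _ ⟨w, rfl⟩ F ⟨hF, hqF⟩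
    have h1 : q (F (i w)) ∈ range D.proj := ⟨φ w, (hqF.self_of_nhds.trans (hx w)).symm⟩
    obtain ⟨π, hπ, hr⟩ := hlift _ h1
    have h2 : ∀ᶠ x in 𝓝 w, q (F (i x)) = D.proj (φ x) := by
      filter_upwards [hi.continuous.continuousAt hqF] with x hqx
      exact Eq.trans hqx (hx x)
    obtain ⟨g, hg, h3⟩ := hπ.exists_eventually_eq hφ (hF.comp hi) h2 hr
    have h4 : ∀ x, extend i (fun x => π (g (φ x))) F (i x) = π (g (φ x)) :=
      hi.injective.extend_apply _ _
    refine ⟨extend i (fun x => π (g (φ x))) F, ?_, ?_⟩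
    · rintro _ ⟨x, rfl⟩
      constructor
      · refine EtaleAt.of_comp hi ?_
        have h5 := EtaleAt.comp ((D.smooth_emb hg).comp hφ) (hπ.etale (g (φ x)))
        exact h5.congr (Eventually.of_forall fun y => (h4 y).symm)
      · refine hi.eventually (Eventually.of_forall fun y => ?_)
        rw [h4, hπ.comm, D.proj_apply hg, hx]
    · refine hi.eventually ?_
      filter_upwards [h3] with x h3x
      rw [h4]
      exact h3x.symm
  · rintro F F' hF hF' _ ⟨w, rfl⟩ h _ ⟨x, rfl⟩
    have hqF : ∀ x, q (F (i x)) = C.proj (i x) := fun x => (hF _ ⟨x, rfl⟩).2.self_of_nhds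
    have hqF' : ∀ x, q (F' (i x)) = C.proj (i x) := fun x => (hF' _ ⟨x, rfl⟩).2.self_of_nhds
    refine congrFun (hq.lift_unique (f₁ := F ∘ i) (f₂ := F' ∘ i) (fun x => (hF _ ⟨x, rfl⟩).1.comp hi)
      (fun x => (hF' _ ⟨x, rfl⟩).1.comp hi) (fun x => ?_) (fun x => (hqF x).trans (hqF' x).symm) (u := w)
      (hi.continuous.continuousAt h)) x
    exact ((EtaleAt.of_hasChart hC (i x)).comp hi).congr (Eventually.of_forall fun y => (hqF y).symm)

end Lift

end Orbi

namespace Orbi.OrbifoldAtlas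

/-! ### Transport of lifts along `𝒢`-paths -/

variable {m : ℕ} {Y : Type v} {Z : Type u} [TopologicalSpace Y] [TopologicalSpace Z]
  {A' : OrbifoldAtlas m Y} {A : OrbifoldAtlas m Z} {q : Y → Z} {y₀ : Y}

variable (A' A q y₀) in
/-- Lifts of the charts of an atlas along a map `q`, given by functions on `𝒢₀` with the value `y₀`
outside of the chart. -/
@[ext] structure ChartLift : Type max u v where
  chart : A.charts
  f : A.Obj → Y
  etale : ∀ v, EtaleAt A' (fun v => f ⟨chart, v⟩) v
  comm : ∀ v, q (f ⟨chart, v⟩) = chart.1.proj v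
  eq_of_ne : ∀ x : A.Obj, x.1 ≠ chart → f x = y₀

namespace ChartLift

theorem exists_of_lift {C : A.charts} {f : C.1.dom → Y} (hf : ∀ x, EtaleAt A' f x)
    (hqf : ∀ x, q (f x) = C.1.proj x) :
    ∃ F : ChartLift A' A q y₀, F.chart = C ∧ ∀ v, F.f ⟨C, v⟩ = f v := by
  let ι : C.1.dom → A.Obj := fun v => ⟨C, v⟩
  have hι : Injective ι := fun _ _ h => eq_of_heq (Sigma.mk.inj_iff.1 h).2
  have h : ∀ v, extend ι f (fun _ => y₀) (ι v) = f v := hι.extend_apply f _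
  refine ⟨⟨C, extend ι f fun _ => y₀, fun v => ?_, fun v => ?_, fun x hx => ?_⟩, rfl, h⟩
  · exact (hf v).congr (Eventually.of_forall fun w => (h w).symm)
  · exact (congrArg q (h v)).trans (hqf v)
  · refine extend_apply' _ _ _ ?_
    rintro ⟨v, rfl⟩
    exact hx rfl

theorem etale_of_eq (F : ChartLift A' A q y₀) {C : A.charts} (h : F.chart = C) (v : C.1.dom) :
    EtaleAt A' (fun v => F.f ⟨C, v⟩) v := by
  subst h
  exact F.etale v

theorem comm_of_eq (F : ChartLift A' A q y₀) {C : A.charts} (h : F.chart = C) (v : C.1.dom) :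
    q (F.f ⟨C, v⟩) = C.1.proj v := by
  subst h
  exact F.comm v

/-- `F` is the pull-back of `F'` by the arrow `g`. -/
def Rel (g : A.Arrow) (F F' : ChartLift A' A q y₀) : Prop :=
  F.chart = g.src.1 ∧ F'.chart = g.tgt.1 ∧ g.germ.map F'.f = (F.f : Germ (𝓝 g.src) Y)

theorem rel_germAt_iff {T : A.Transition} {y : T.C₀.dom} {F F' : ChartLift A' A q y₀} :
    Rel (T.germAt y) F F' ↔
      F.chart = T.i ∧ F'.chart = T.j ∧ ∀ᶠ z in 𝓝 y, F'.f (T.t z) = F.f (T.s z) := by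
  rw [Rel, T.germAt_tgt]
  refine and_congr Iff.rfl (and_congr Iff.rfl ?_)
  refine Germ.coe_eq.trans ?_
  rw [EventuallyEq, T.germAt_src, ← T.s_isOpenEmbedding.map_nhds_eq y, eventually_map]
  refine eventually_congr (Eventually.of_forall fun z => ?_)
  change F'.f (extend T.s T.t id (T.s z)) = _ ↔ _
  rw [T.s_isOpenEmbedding.injective.extend_apply]

theorem Rel.eq_tgt {g : A.Arrow} {F F' : ChartLift A' A q y₀} (h : Rel g F F') :
    F'.f g.tgt = F.f g.src := by
  obtain ⟨T, y, rfl⟩ := g.exists_germAt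
  rw [T.germAt_tgt]
  exact (rel_germAt_iff.1 h).2.2.self_of_nhds

theorem Rel.comp {g h : A.Arrow} (e : g.tgt = h.src) {F F' F'' : ChartLift A' A q y₀}
    (hg : Rel g F F') (hh : Rel h F' F'') : Rel (g.comp h) F F'' := by
  refine ⟨hg.1.trans (congrArg Sigma.fst (g.comp_src h).symm),
    hh.2.1.trans (congrArg Sigma.fst (Arrow.comp_tgt e).symm), ?_⟩
  rw [Arrow.comp, dif_pos e]
  obtain ⟨f, hf⟩ := g.exists_rep
  obtain ⟨f', hf'⟩ := h.exists_rep
  rw [Arrow.comp'_germ g h e hf hf']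
  have h1 := hg.2.2
  have h2 := hh.2.2
  have h3 := g.tendsto e
  rw [hf] at h1 h3
  rw [hf'] at h2
  refine Germ.coe_eq.2 (EventuallyEq.trans ?_ (Germ.coe_eq.1 h1))
  exact h3.eventually (Germ.coe_eq.1 h2)

theorem rel_refl {F : ChartLift A' A q y₀} {x : A.Obj} (h : F.chart = x.1) :
    Rel (Arrow.refl x) F F :=
  rel_germAt_iff.2 ⟨h, h, Eventually.of_forall fun _ => rfl⟩

section Covering

variable [T2Space Y] (hq : IsOrbCovering A' A q)

include hq

/-- On the connected chart a lift is determined by its germ, and elsewhere both functions are `y₀`.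
-/
theorem eq_of_eventually_eq {F F' : ChartLift A' A q y₀} {C : A.charts} (h : F.chart = C)
    (h' : F'.chart = C) {v : C.1.dom} (hv : ∀ᶠ w in 𝓝 v, F.f ⟨C, w⟩ = F'.f ⟨C, w⟩) : F = F' := by
  have h1 := hq.lift_unique (F.etale_of_eq h) (F'.etale_of_eq h') (fun x => ?_)
    (fun x => (F.comm_of_eq h x).trans (F'.comm_of_eq h' x).symm) hv
  · refine ChartLift.ext (h.trans h'.symm) (funext fun x => ?_)
    by_cases hx : x.1 = C
    · rcases x with ⟨C', w⟩
      obtain rfl : C' = C := hx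
      exact congrFun h1 w
    · rw [F.eq_of_ne x (h ▸ hx), F'.eq_of_ne x (h' ▸ hx)]
  · exact (EtaleAt.of_hasChart (A.compat C.1 C.2) x).congr
      (Eventually.of_forall fun w => (F.comm_of_eq h w).symm)

theorem Rel.unique {g : A.Arrow} {F F' F'' : ChartLift A' A q y₀} (h' : Rel g F F') (h'' : Rel g F F'') :
    F' = F'' := by
  obtain ⟨T, y, rfl⟩ := g.exists_germAt
  rw [rel_germAt_iff] at h' h''
  refine eq_of_eventually_eq hq h'.2.1 h''.2.1 (v := T.ψ.toFun y) (T.ψ.isEmb.eventually ?_)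
  filter_upwards [h'.2.2, h''.2.2] with z h1 h2
  exact h1.trans h2.symm

/-- Transferring `F` from the source to the target of a transition gives a germ of lift of the
target chart, which extends because this chart is simply connected. -/
theorem exists_rel [∀ C : A.charts, SimplyConnectedSpace C.1.dom] (g : A.Arrow)
    {F : ChartLift A' A q y₀} (h : F.chart = g.src.1) : ∃ F', Rel g F F' := by
  obtain ⟨T, y, rfl⟩ := g.exists_germAt
  have h1 : ∀ z, extend T.ψ.toFun (fun z => F.f (T.s z)) (fun _ => y₀) (T.ψ.toFun z) = F.f (T.s z) :=
    T.ψ.isEmb.injective.extend_apply _ _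
  have h5 : EtaleAt A' (fun v => F.f ⟨T.i, v⟩) (T.φ.toFun y) := F.etale_of_eq h _
  have h6 : EtaleAt A' (extend T.ψ.toFun (fun z => F.f (T.s z)) fun _ => y₀) (T.ψ.toFun y) :=
    EtaleAt.of_comp T.ψ.isEmb ((h5.comp T.φ.isEmb).congr (Eventually.of_forall fun z => (h1 z).symm))
  obtain ⟨f', h2, h3, h4⟩ := hq.exists_lift_of_germ (A.compat T.j.1 T.j.2) h6
    (T.ψ.isEmb.eventually (Eventually.of_forall fun z => by
      rw [h1]
      exact (F.comm_of_eq h _).trans ((T.φ.comm z).trans (T.ψ.comm z).symm)))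
  obtain ⟨F', hF', hf'⟩ := exists_of_lift (y₀ := y₀) h2 h3
  refine ⟨F', rel_germAt_iff.2 ⟨h, hF', ?_⟩⟩
  filter_upwards [T.ψ.isEmb.continuous.continuousAt h4] with z hz
  exact (hf' _).trans (hz.trans (h1 z))

/-- The domain of a transition is connected, so by uniqueness of lifts an agreement of germs at one
point spreads over all of it. -/
theorem rel_germAt_iff_forall {T : A.Transition} {y : T.C₀.dom} {F F' : ChartLift A' A q y₀} :
    Rel (T.germAt y) F F' ↔
      F.chart = T.i ∧ F'.chart = T.j ∧ ∀ z, F'.f (T.t z) = F.f (T.s z) := by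
  refine rel_germAt_iff.trans ⟨fun h => ⟨h.1, h.2.1, ?_⟩, fun h =>
    ⟨h.1, h.2.1, Eventually.of_forall h.2.2⟩⟩
  have e1 : ∀ z, q (F'.f (T.t z)) = T.C₀.proj z := fun z => (F'.comm_of_eq h.2.1 _).trans (T.ψ.comm z)
  have e2 : ∀ z, q (F.f (T.s z)) = T.C₀.proj z := fun z => (F.comm_of_eq h.1 _).trans (T.φ.comm z)
  refine congrFun (hq.lift_unique (f₁ := fun z => F'.f (T.t z)) (f₂ := fun z => F.f (T.s z))
    (fun z => (F'.etale_of_eq h.2.1 _).comp T.ψ.isEmb) (fun z => (F.etale_of_eq h.1 _).comp T.φ.isEmb)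
    (fun z => ?_) (fun z => (e1 z).trans (e2 z).symm) h.2.2)
  refine (EtaleAt.comp T.φ.isEmb (EtaleAt.of_hasChart (A.compat T.i.1 T.i.2) _)).congr
    (Eventually.of_forall fun z => ?_)
  exact (T.φ.comm z).trans (e1 z).symm

/-- The germs of one transition form an open set of arrows, on which the relation does not depend on
the point. It therefore holds on a clopen subset of the interval. -/
theorem Rel.of_continuous {g : I → A.Arrow} (hg : Continuous g) {F F' : ChartLift A' A q y₀} {s t : I}
    (h : Rel (g s) F F') : Rel (g t) F F' := by
  have key : ∀ s, ∀ᶠ t in 𝓝 s, Rel (g t) F F' ↔ Rel (g s) F F' := by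
    intro s
    obtain ⟨T, y, hy⟩ := (g s).exists_germAt
    have h1 : IsOpen (T.germAt '' univ) := isOpen_generateFrom_of_mem ⟨T, univ, isOpen_univ, rfl⟩
    filter_upwards [(h1.preimage hg).mem_nhds ⟨y, trivial, hy.symm⟩] with t ht
    obtain ⟨y', -, hy'⟩ := ht
    rw [hy, ← hy', rel_germAt_iff_forall hq, rel_germAt_iff_forall hq]
  have hclopen : IsClopen {s | Rel (g s) F F'} := by
    refine ⟨isOpen_compl_iff.1 (isOpen_iff_mem_nhds.2 fun s hs => ?_), isOpen_iff_mem_nhds.2 fun s hs => ?_⟩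
    · filter_upwards [key s] with t ht h'
      exact hs (ht.1 h')
    · filter_upwards [key s] with t ht
      exact ht.2 hs
  exact eq_univ_iff_forall.1 (hclopen.eq_univ ⟨s, h⟩) t

end Covering

end ChartLift

end Orbi.OrbifoldAtlas

/-! ### Homotopy invariance of the transport -/

namespace Orbi.OrbifoldAtlas

variable {m : ℕ} {Y : Type v} {Z : Type u} [TopologicalSpace Y] [TopologicalSpace Z]
  {A' : OrbifoldAtlas m Y} {A : OrbifoldAtlas m Z} {q : Y → Z} {y₀ : Y}

namespace ChartLift

/-- `F'` is obtained from `F` by transport along a `𝒢`-path. -/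
def PathRel : RawPath A → ChartLift A' A q y₀ → ChartLift A' A q y₀ → Prop
  | .arrow g, F, F' => Rel g F F'
  | .cons g _ r, F, F' => ∃ G, Rel g F G ∧ PathRel r G F'

theorem PathRel.chart_eq {p : RawPath A} {F F' : ChartLift A' A q y₀} {x y : A.Obj} (hp : p.IsPath x y)
    (h : PathRel p F F') : F.chart = x.1 := by
  cases p with
  | arrow g => exact h.1.trans (congrArg Sigma.fst hp.1)
  | cons g b r =>
    obtain ⟨G, h, -⟩ := h
    exact h.1.trans (congrArg Sigma.fst hp.1)

theorem PathRel.chart_eq_right {p : RawPath A} {F F' : ChartLift A' A q y₀} {x y : A.Obj}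
    (hp : p.IsPath x y) (h : PathRel p F F') : F'.chart = y.1 := by
  induction p generalizing x F with
  | arrow g => exact h.2.1.trans (congrArg Sigma.fst hp.2)
  | cons g b r ih =>
    obtain ⟨G, -, h⟩ := h
    exact ih hp.2.2 h

theorem PathRel.preact {g : A.Arrow} {p : RawPath A} {F G H : ChartLift A' A q y₀} {x y : A.Obj}
    (hp : p.IsPath x y) (hg : g.tgt = x) (h : Rel g F G) (h' : PathRel p G H) :
    PathRel (p.preact g) F H := by
  cases p with
  | arrow k => exact h.comp (hg.trans hp.1.symm) h'
  | cons k b r =>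
    obtain ⟨G', h1, h2⟩ := h'
    exact ⟨G', h.comp (hg.trans hp.1.symm) h1, h2⟩

theorem PathRel.comp {p p' : RawPath A} {F G H : ChartLift A' A q y₀} {x y z : A.Obj}
    (hp : p.IsPath x y) (hp' : p'.IsPath y z) (h : PathRel p F G) (h' : PathRel p' G H) :
    PathRel (p.comp p') F H := by
  induction p generalizing x F with
  | arrow g => exact PathRel.preact hp' hp.2 h h'
  | cons g b r ih =>
    obtain ⟨F', h1, h2⟩ := h
    exact ⟨F', h1, ih hp.2.2 h2⟩

theorem fst_eq_of_path (b : C(I, A.Obj)) (s t : I) : (b s).1 = (b t).1 := by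
  obtain ⟨C, β, rfl⟩ := b.exists_lift_sigma
  rfl

section Covering

variable [T2Space Y] (hq : IsOrbCovering A' A q)

include hq

theorem PathRel.unique {p : RawPath A} {F F' F'' : ChartLift A' A q y₀} (h' : PathRel p F F')
    (h'' : PathRel p F F'') : F' = F'' := by
  induction p generalizing F with
  | arrow g => exact Rel.unique hq h' h''
  | cons g b r ih =>
    obtain ⟨G, h1, h2⟩ := h'
    obtain ⟨G', h3, h4⟩ := h''
    obtain rfl := h1.unique hq h3
    exact ih h2 h4

theorem PathRel.of_contFamily {c : I → RawPath A} (hc : RawPath.ContFamily c) (s t : I)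
    {F F' : ChartLift A' A q y₀} (h : PathRel (c s) F F') : PathRel (c t) F F' := by
  induction hc generalizing F with
  | arrow g hg => exact Rel.of_continuous hq hg h
  | cons g b r hg hb hr ih =>
    obtain ⟨G, h1, h2⟩ := h
    exact ⟨G, h1.of_continuous hq hg, ih h2⟩

variable [∀ C : A.charts, SimplyConnectedSpace C.1.dom]

theorem exists_pathRel {p : RawPath A} {x y : A.Obj} (hp : p.IsPath x y) {F : ChartLift A' A q y₀}
    (h : F.chart = x.1) : ∃ F', PathRel p F F' := by
  induction p generalizing x F with
  | arrow g => exact exists_rel hq g (h.trans (congrArg Sigma.fst hp.1.symm))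
  | cons g b r ih =>
    obtain ⟨G, hG⟩ := exists_rel hq g (h.trans (congrArg Sigma.fst hp.1.symm))
    obtain ⟨F', hF'⟩ := ih hp.2.2 (hG.2.1.trans ((congrArg Sigma.fst hp.2.1).trans (fst_eq_of_path b 0 1)))
    exact ⟨F', G, hG, hF'⟩

/-- A subdivision only inserts an identity arrow, and a deformation is handled by
`PathRel.of_contFamily`. In the case of `transform`, the relation for the germ of `T` at `β 0` holds
on the whole domain, so its inverse may be applied at `β 1`. -/
theorem PathRel.of_move {x y : A.Obj} {p p' : RawPath A} (hM : Move x y p p')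
    {F F' : ChartLift A' A q y₀} (h : PathRel p F F') : PathRel p' F F' := by
  induction hM generalizing F with
  | subdivide g b r t _ _ hp =>
    obtain ⟨G, h1, h2⟩ := h
    exact ⟨G, h1, G, rel_refl (h1.2.1.trans ((congrArg Sigma.fst hp.2.1).trans (fst_eq_of_path b 0 t))), h2⟩
  | transform g r T β hp =>
    obtain ⟨G, h1, h2⟩ := h
    have e : g.tgt = (T.germAt (β 0)).src := hp.2.1
    obtain ⟨G', hG'⟩ := exists_rel hq (T.germAt (β 0)) (h1.2.1.trans (congrArg Sigma.fst e))
    refine ⟨G', h1.comp e hG', PathRel.preact hp.2.2 (T.symm.germAt_tgt (β 1)) ?_ h2⟩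
    have h3 := (rel_germAt_iff_forall hq).1 hG'
    exact (rel_germAt_iff_forall hq).2 ⟨h3.2.1, h3.1, fun z => (h3.2.2 z).symm⟩
  | homotopy c hc _ _ _ => exact PathRel.of_contFamily hq hc 0 1 h
  | cons g b r r' _ _ _ ih =>
    obtain ⟨G, h1, h2⟩ := h
    exact ⟨G, h1, ih h2⟩

/-- Moves are directed, but transport exists and is unique, so one implication yields the other. -/
theorem pathRel_iff_of_move {x y : A.Obj} {p p' : RawPath A} (hM : Move x y p p')
    {F F' : ChartLift A' A q y₀} : PathRel p F F' ↔ PathRel p' F F' := by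
  refine ⟨PathRel.of_move hq hM, fun h => ?_⟩
  obtain ⟨F'', h''⟩ := exists_pathRel hq hM.isPath (h.chart_eq hM.isPath_right)
  rwa [← (PathRel.of_move hq hM h'').unique hq h]

/-- Transport of lifts along homotopy classes of `𝒢`-paths. -/
theorem exists_transport {x₀ : A.Obj} {F₀ : ChartLift A' A q y₀} (h₀ : F₀.chart = x₀.1) :
    ∃ τ : ∀ y : A.Obj, HClass x₀ y → ChartLift A' A q y₀,
      (∀ y c, (τ y c).chart = y.1) ∧
      (∀ (g : A.Arrow) (c : HClass x₀ g.src), Rel g (τ _ c) (τ _ (c.mul (.ofArrow g)))) ∧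
      ∀ (C : A.charts) (u v : C.1.dom) (c : HClass x₀ (⟨C, u⟩ : A.Obj)),
        τ _ (c.mul (.inChart C u v)) = τ _ c := by
  have h1 : ∀ (y : A.Obj) (c : HClass x₀ y), ∃ F', ∀ p hp hp', c = HClass.mk p hp hp' → PathRel p F₀ F' := by
    intro y c
    -- Transport along a representative is invariant under moves, so it descends to homotopy
    -- classes.
    let R : HClass x₀ y → ChartLift A' A q y₀ → Prop := fun c F' =>
      Quot.lift (fun p : GPath x₀ y => PathRel p.1 F₀ F')
        (fun p p' h => propext (pathRel_iff_of_move hq h)) c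
    obtain ⟨F', hF'⟩ : ∃ F', R c F' := by
      induction c using HClass.ind with | _ p hp hp'
      exact exists_pathRel hq hp' h₀
    refine ⟨F', ?_⟩
    rintro p hp hp' rfl
    exact hF'
  choose τ hτ using h1
  have huniq : ∀ {y : A.Obj} (p : RawPath A) (hp) (hp' : p.IsPath x₀ y) F', PathRel p F₀ F' →
      τ _ (HClass.mk p hp hp') = F' := fun p hp hp' F' h => (hτ _ _ p hp hp' rfl).unique hq h
  have hmul : ∀ {y z : A.Obj} {p p' : RawPath A} (hp) (hp' : p.IsPath x₀ y) (h) (h' : p'.IsPath y z) (F'),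
      PathRel p' (τ _ (HClass.mk p hp hp')) F' →
        τ _ ((HClass.mk p hp hp').mul (HClass.mk p' h h')) = F' := fun hp hp' h h' F' hF' =>
    huniq _ hp.comp (hp'.comp h') _ (PathRel.comp hp' h' (hτ _ _ _ hp hp' rfl) hF')
  have hτc : ∀ y c, (τ y c).chart = y.1 := by
    intro y c
    induction c using HClass.ind with | _ p hp hp'
    exact (hτ _ _ p hp hp' rfl).chart_eq_right hp'
  refine ⟨τ, hτc, fun g c => ?_, fun C u v c => ?_⟩
  · obtain ⟨G, hG⟩ := exists_rel hq g (hτc _ c)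
    have h4 : τ _ (c.mul (.ofArrow g)) = G := by
      induction c using HClass.ind with | _ p hp hp'
      exact hmul hp hp' _ _ _ ⟨_, rel_refl (hτc _ _), hG⟩
    rwa [h4]
  · induction c using HClass.ind with | _ p hp hp'
    refine hmul hp hp' (p' := .cons (Arrow.refl _) (chartPath C (PathConnectedSpace.somePath u v))
      (.arrow (Arrow.refl _))) trivial ?_ _ ⟨_, rel_refl (hτc _ _), rel_refl (hτc _ _)⟩
    refine ⟨rfl, ?_, ?_, ?_⟩ <;> simp

end Covering

end ChartLift

end Orbi.OrbifoldAtlas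

namespace Orbi.OrbifoldAtlas

variable {m : ℕ} {Y : Type v} {Z : Type u} [TopologicalSpace Y] [TopologicalSpace Z]
  {A' : OrbifoldAtlas m Y} {A : OrbifoldAtlas m Z} {q : Y → Z}

/-! ### The universal property of `X` -/

/-- A point of `Y` above the chart exists by surjectivity of `q`; an evenly covered chart gives a
germ of lift there, which extends over the simply connected chart. -/
theorem exists_chartLift [T2Space Y] [Nonempty Y] [ConnectedSpace Z] (hq : IsOrbCovering A' A q)
    (C : A.charts) [SimplyConnectedSpace C.1.dom] (y₀ : Y) :
    ∃ F : ChartLift A' A q y₀, F.chart = C := by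
  obtain ⟨v⟩ : Nonempty C.1.dom := inferInstance
  obtain ⟨y, hy⟩ := hq.surjective (C.1.proj v)
  obtain ⟨D, hD, hz, hlift⟩ := hq.exists_lift (C.1.proj v)
  obtain ⟨π, hπ, d, rfl⟩ := hlift y (hy ▸ hz)
  rw [hπ.comm] at hy
  have hC := A.compat C.1 C.2
  obtain ⟨N, i, φ, n, hN, hi, hφ, rfl, rfl, hx⟩ := (EtaleAt.of_hasChart hC v).exists_common
    (EtaleAt.of_hasChart hD d) hy.symm
  have h1 : ∀ x, extend i (π ∘ φ) (fun _ => y₀) (i x) = π (φ x) := hi.injective.extend_apply _ _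
  have h2 : EtaleAt A' (extend i (π ∘ φ) fun _ => y₀) (i n) :=
    EtaleAt.of_comp hi (((hπ.etale (φ n)).comp hφ).congr (Eventually.of_forall fun x => (h1 x).symm))
  obtain ⟨f, hf, hqf, -⟩ := hq.exists_lift_of_germ hC h2
    (hi.eventually (Eventually.of_forall fun x => by rw [h1, hπ.comm, hx]))
  obtain ⟨F, hF, -⟩ := ChartLift.exists_of_lift (y₀ := y₀) hf hqf
  exact ⟨F, hF⟩

variable [∀ C : A.charts, SimplyConnectedSpace C.1.dom] {x₀ : A.Obj}

theorem etaleAt_sheetMap {C : A.charts} {u : C.1.dom} (c : HClass x₀ (⟨C, u⟩ : A.Obj)) (v : C.1.dom) :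
    EtaleAt (A.coverAtlas x₀) (sheetMap c) v :=
  EtaleAt.of_hasChart (hasChart_sheetChart c) v

/-- A map `X → Y` over `Z` which is étale on all sheets is an orbifold covering. -/
theorem isOrbCovering_of_etale [T2Space Y] [T2Space Z] (hq : IsOrbCovering A' A q)
    {f : A.UnivCover x₀ → Y} (hqf : ∀ x, q (f x) = x.proj)
    (hf : ∀ (C : A.charts) (u : C.1.dom) (c : HClass x₀ (⟨C, u⟩ : A.Obj)) (v : C.1.dom),
      EtaleAt A' (f ∘ sheetMap c) v) : IsOrbCovering (A.coverAtlas x₀) A' f := by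
  have hT2 : T2Space (A.UnivCover x₀) := UnivCover.t2Space
  have hp : IsOrbCovering (A.coverAtlas x₀) A UnivCover.proj := UnivCover.isOrbCovering (x₀ := x₀)
  refine ⟨UnivCover.continuous_iff.2 fun C u c => EtaleAt.continuous (hf C u c), fun y => ?_⟩
  obtain ⟨D, hD, hz, hlift⟩ := hq.exists_lift (q y)
  obtain ⟨π, hπ, d, rfl⟩ := hlift y hz
  obtain ⟨C, hC, v, hv⟩ := A.cover (q (π d))
  rw [hπ.comm] at hv
  -- `C₀` embeds both into the chart `D` evenly covered by `q` and into the atlas chart `C`, over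
  -- which `X` has its sheets. The map `f₀ = π ∘ φ` becomes a chart of `Y` evenly covered by `f`.
  obtain ⟨C₀, φ, ψ, w, rfl, rfl⟩ := (hD C hC).exists_chartEmb hv.symm
  have hC₀ : A.HasChart C₀ := hasChart_of_etale fun x =>
    ((EtaleAt.of_hasChart hD _).comp φ.isEmb).congr (Eventually.of_forall φ.comm)
  set f₀ : C₀.dom → Y := π ∘ φ.toFun with hf₀
  have e₀ : ∀ x, EtaleAt A' f₀ x := fun x => (hπ.etale _).comp φ.isEmb
  have qf₀ : ∀ x, q (f₀ x) = C₀.proj x := fun x => (hπ.comm _).trans (φ.comm x)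
  let P₀ : OrbifoldChart m Y := C₀.lift f₀ (EtaleAt.continuous e₀) (EtaleAt.isOpenMap e₀)
    fun _ _ h => hq.exists_eq_of_lift hC₀ e₀ e₀ qf₀ qf₀ h
  -- Through every point above the image of `f₀` passes a lift of `f₀` to `X`. A sheet restricted to
  -- `C₀` and composed with `f` is a lift of the projection of `C₀` along `q`; it differs from `f₀`
  -- by a group element, which is absorbed into the sheet.
  have key : ∀ x, f x ∈ range f₀ → ∃ s : C₀.dom → A.UnivCover x₀,
      (∀ x, EtaleAt (A.coverAtlas x₀) s x) ∧ (∀ x, f (s x) = f₀ x) ∧ x ∈ range s := by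
    rintro x ⟨w', hw'⟩
    have h1 : x.proj = C.proj (ψ.toFun w') := by rw [← hqf, ← hw', qf₀, ψ.comm]
    obtain ⟨c, rfl⟩ := exists_sheetMap_of_proj (C := ⟨C, hC⟩) (u := ψ.toFun w') h1
    have h2 : ∀ x, EtaleAt A' (fun x => f (sheetMap c (ψ.toFun x))) x := fun x =>
      (hf _ _ c _).comp ψ.isEmb
    obtain ⟨g, hg, hgw, hgf⟩ := hq.exists_eq_of_lift hC₀ e₀ h2 qf₀
      (fun x => (hqf _).trans (ψ.comm x)) hw'
    exact ⟨fun x => sheetMap c (ψ.toFun (g x)), fun x =>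
      (etaleAt_sheetMap c _).comp (ψ.isEmb.comp (C₀.smooth_emb hg)), hgf, w',
      congrArg (fun x => sheetMap c (ψ.toFun x)) hgw⟩
  have hps : ∀ {s : C₀.dom → A.UnivCover x₀}, (∀ x, f (s x) = f₀ x) → ∀ x, (s x).proj = C₀.proj x :=
    fun hs x => by rw [← hqf, hs, qf₀]
  refine ⟨P₀, hasChart_of_etale e₀, ⟨w, rfl⟩, fun x hx => ?_⟩
  obtain ⟨s, es, fs, hxs⟩ := key x hx
  refine ⟨C₀.lift s (EtaleAt.continuous es) (EtaleAt.isOpenMap es) fun _ _ h =>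
    hp.exists_eq_of_lift hC₀ es es (hps fs) (hps fs) h, hasChart_of_etale es, ?_, rfl,
    fun v _ _ => fs _, fun g hg => ⟨g, ⟨hg.1, fun w => ?_⟩, fun _ _ _ => rfl⟩⟩
  · refine connectedComponentIn_eq_of_cover (𝒰 := {U | ∃ s : C₀.dom → A.UnivCover x₀,
      (∀ x, EtaleAt (A.coverAtlas x₀) s x) ∧ (∀ x, f (s x) = f₀ x) ∧ U = range s}) ?_ ?_ ?_ ?_ ?_
      ⟨s, es, fs, rfl⟩ hxs
    · rintro _ ⟨s, es, fs, rfl⟩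
      exact (EtaleAt.isOpenMap es).isOpen_range
    · rintro _ ⟨s, es, fs, rfl⟩
      exact isPreconnected_range (EtaleAt.continuous es)
    · rintro _ ⟨s, es, fs, rfl⟩ _ ⟨w, rfl⟩
      exact ⟨w, (fs w).symm⟩
    · intro x hx
      obtain ⟨s, es, fs, hxs⟩ := key x hx
      exact ⟨_, ⟨s, es, fs, rfl⟩, hxs⟩
    · rintro _ ⟨s, es, fs, rfl⟩ _ ⟨s', es', fs', rfl⟩ ⟨_, ⟨w, rfl⟩, w', h⟩
      obtain ⟨g, -, -, hg⟩ := hp.exists_eq_of_lift hC₀ es es' (hps fs) (hps fs') h.symm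
      rw [← g.surjective.range_comp s']
      exact congrArg range (funext fun w => (hg w).symm)
  -- An element preserving `s` preserves `f ∘ s = f₀`, so the group of the chart of `X` lies in that
  -- of `P₀`.
  · rw [← fs, ← fs]
    exact congrArg f (hg.2 w)

/-- The class of `[c]` is sent to the value, at the end point of `c`, of the lift transported along
`c`. Related lifts agree at the two ends of an arrow, so this descends to `X`; on a sheet the
transported lift is constant, so the map is étale there. -/
theorem exists_universal_lift [T2Space Y] [T2Space Z] [ConnectedSpace Z] [Nonempty Y]
    (hq : IsOrbCovering A' A q) : ∃ f : A.UnivCover x₀ → Y,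
      IsOrbCovering (A.coverAtlas x₀) A' f ∧ q ∘ f = UnivCover.proj := by
  obtain ⟨y₀⟩ := ‹Nonempty Y›
  obtain ⟨F₀, hF₀⟩ := exists_chartLift hq x₀.1 y₀
  obtain ⟨τ, h1, h2, h3⟩ := ChartLift.exists_transport hq hF₀
  let f : A.UnivCover x₀ → Y := Quot.lift (fun c => (τ c.pt c.cls).f c.pt) fun _ _ h => by
    cases h with
    | intro g c => exact (h2 g c).eq_tgt.symm
  have hf : ∀ {C : A.charts} {u : C.1.dom} (c : HClass x₀ (⟨C, u⟩ : A.Obj)) (v : C.1.dom),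
      f (sheetMap c v) = (τ _ c).f ⟨C, v⟩ := fun {C u} c v =>
    congrArg (fun F : ChartLift A' A q y₀ => F.f ⟨C, v⟩) (h3 C u v c)
  have hqf : ∀ x, q (f x) = x.proj := by
    intro x
    obtain ⟨C, u, c, rfl⟩ := exists_sheetMap x
    rw [hf, (τ _ c).comm_of_eq (h1 _ c)]
    rfl
  refine ⟨f, isOrbCovering_of_etale hq hqf fun C u c v => ?_, funext hqf⟩
  exact ((τ _ c).etale_of_eq (h1 _ c) v).congr (Eventually.of_forall fun w => (hf c w).symm)

end Orbi.OrbifoldAtlas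

/-! ### The universal covering orbifold -/

theorem theorem2p9 {m : ℕ} {Z : Type u} [TopologicalSpace Z] [T2Space Z]
    [SecondCountableTopology Z] [ConnectedSpace Z] (A : Orbi.OrbifoldAtlas m Z)
    (hA : A.charts.Countable) (hsc : ∀ C ∈ A.charts, SimplyConnectedSpace C.dom) (x₀ : A.Obj) :
    T2Space (A.UnivCover x₀) ∧ SecondCountableTopology (A.UnivCover x₀) ∧
    ∃ B : Orbi.OrbifoldAtlas m (A.UnivCover x₀),
      Orbi.OrbifoldAtlas.IsCanonicalAtlas B ∧
      (∀ γ : A.Pi1 x₀, Orbi.OrbSmooth B B (fun x => γ • x)) ∧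
      FaithfulSMul (A.Pi1 x₀) (A.UnivCover x₀) ∧
      ProperlyDiscontinuousSMul (A.Pi1 x₀) (A.UnivCover x₀) ∧
      (T2Space (A.DeckQuotient x₀) ∧ SecondCountableTopology (A.DeckQuotient x₀) ∧
        ∃ Q : Orbi.OrbifoldAtlas m (A.DeckQuotient x₀),
          Orbi.IsInducedAtlas B Q Orbi.OrbifoldAtlas.DeckQuotient.mk ∧
          Orbi.IsOrbIso Q A Orbi.OrbifoldAtlas.DeckQuotient.proj) ∧
      Orbi.IsUniversalOrbCovering.{v} B A Orbi.OrbifoldAtlas.UnivCover.proj := by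
  have : Countable A.charts := hA.to_subtype
  have : ∀ C : A.charts, SimplyConnectedSpace C.1.dom := fun C => hsc C.1 C.2
  have hT2 : T2Space (A.UnivCover x₀) := Orbi.OrbifoldAtlas.UnivCover.t2Space
  refine ⟨hT2, Orbi.OrbifoldAtlas.UnivCover.secondCountableTopology, A.coverAtlas x₀,
    Orbi.OrbifoldAtlas.coverAtlas_isCanonical, Orbi.OrbifoldAtlas.orbSmooth_smul,
    Orbi.OrbifoldAtlas.faithfulSMul, Orbi.OrbifoldAtlas.properlyDiscontinuousSMul,
    ⟨(A.deckHomeo x₀).symm.t2Space, (A.deckHomeo x₀).secondCountableTopology,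
      A.map (A.deckHomeo x₀).symm, Orbi.OrbifoldAtlas.isInducedAtlas_deckHomeo,
      A.isOrbIso_map (A.deckHomeo x₀)⟩,
    Orbi.OrbifoldAtlas.UnivCover.connectedSpace, Orbi.OrbifoldAtlas.UnivCover.isOrbCovering, ?_⟩
  intro Y _ _ _ _ A' p' hp'
  exact Orbi.OrbifoldAtlas.exists_universal_lift hp'
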